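/- **Setting.** Let $(M,\{\cdot,\cdot\})$ be a smooth (finite-dimensional, Hausdorff, second countable) Poisson manifold and let $A$ be a subgroup of the group $\mathcal P(M)$ of diffeomorphisms of $M$ that preserve the Poisson bracket. For a smooth function $f$ on an open set $U\subset M$, $X_f$ is the Hamiltonian vector field on $U$ given by $X_f[g]=\{g,f\}$. For a pseudogroup $T$ of local diffeomorphisms of $M$ (in particular for $T=A$): * $T\cdot m=\{F(m): F\in T,\ m\in \mathrm{Dom}\,F\}$ is the orbit of $m$, $M/T$ is the space of orbits (a partition of $M$) with the quotient topology, and $\pi_T:M\to M/T$ is the projection. A set $U\subset M$ is $T$-invariant if $F(z)\in U$ for all $F\in T$ and $z\in U\cap \mathrm{Dom}\, F$. For $U$ open and $T$-invariant, $C^\infty(U)^T$ is the set of $f\in C^\infty(U)$ with $f(F(z))=f(z)$ for all $F\in T$, $z\in U\cap\mathrm{Dom}\,F$. $C^\infty(M/T)$ is the set of continuous $f:M/T\to\mathbb R$ with $f\circ\pi_T\in C^\infty(M)$. * $T$ has the *extension property* if for every open $T$-invariant $U$, every $f\in C^\infty(U)^T$ and every $z\in U$ there are an open $T$-invariant $V$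 with $z\in V\subset U$ and $F\in C^\infty(M)^T$ with $F|_V=f|_V$. * $C^\infty(M)^T$ *separates the $T$-orbits* if $f(x)=f(y)$ for all $f\in C^\infty(M)^T$ implies $T\cdot x=T\cdot y$. * For a family $\mathcal D$ of vector fields defined on open subsets of $M$, $G_{\mathcal D}$ is the set of all finite compositions $F^1_{t_1}\circ\dots\circ F^k_{t_k}$, $k\ge 1$, $t_i\in\mathbb R$, of (local, maximally defined) flows of elements of $\mathcal D$. The *standard polar family* of $T$ is $\mathcal T'=\{X_f: f\in C^\infty(U)^T,\ U\subset M \text{ open and } T\text{-invariant}\}$; the generalized distribution $T'$ on $M$ that it spans is the *polar* of $T$, and $G_{T'}:=G_{\mathcal T'}$ is the standard polar pseudogroup. $A''=(A')'$ is the polar of the pseudogroup $G_{A'}$, and $G_{A''}$ is the standard polar pseudogroup of $G_{A'}$; $A'$ has the extension property if $G_{A'}$ has it. * A generalized distribution $D$ is *integrable* if through every point of $M$ there passes a leaf, i.e. a maximal integral submanifold: a connected immersed submanifold $N$ with $T_zN=D(z)$ for all $z\in N$ that is equal to every other such submanifold containing it. $M/D$ then denotes the partition of $M$ into leaves. Let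 $(\cdot)^c$ denote the centralizer in $C^\infty(M)$ with respect to $\{\cdot,\cdot\}$. The group $A$ is *strongly Hamiltonian* if each $g\in A$ can be written $g=F^1_{t_1}\circ\dots\circ F^k_{t_k}$ with $F^i_{t}$ the flow of $X_{h_i}$ for some $h_i\in (C^\infty(M)^A)^c$, and *weakly Hamiltonian* if for each $g\in A$ and $m\in M$ there is such a composition with $g\cdot m=F^1_{t_1}\circ\dots\circ F^k_{t_k}(m)$. For pseudogroups $S,T$ of local Poisson diffeomorphisms, the diagram $M/S\leftarrow M\to M/T$ is a *dual pair* if $S'$ and $T'$ are integrable, $M/S'=M/T$ and $M/T'=M/S$; it is a *Howe pair* if $(\pi_S^*C^\infty(M/S))^c=\pi_T^*C^\infty(M/T)$ and $(\pi_T^*C^\infty(M/T))^c=\pi_S^*C^\infty(M/S)$. $A$ is *von Neumann* if $A'$ and $A''$ are integrable and $M/A''=M/A$. **Proposition 6.2.** (i) If $A$ is strongly Hamiltonian and has the extension property, then $A\subset G_{A''}$. If $A$ is weakly Hamiltonian and has the extension property, then $A\cdot m\subset G_{A''}\cdot m$ for every $m\in M$. (ii) If $C^\infty(M)^A$ separates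 the $A$-orbits, then $G_{A''}\cdot m\subset A\cdot m$ for every $m\in M$. (iii) If $A$ is (strongly or weakly) Hamiltonian and has the extension property, and $C^\infty(M)^A$ separates the $A$-orbits, then $A$ is von Neumann and $M/A\leftarrow M\to M/A'$ is a dual pair (that is, the diagram $M/S\leftarrow M\to M/T$ with $S=A$, $T=G_{A'}$ is one). If in addition $A'$ has the extension property, this diagram is also a Howe pair. -/

import Mathlib

open Set
open scoped Manifold ContDiff

/-- A Poisson bracket on the algebra `C^∞(M)` of smooth functions of an `n`-dimensional smooth
manifold `M`: a Lie bracket that is a derivation in each argument. -/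
structure PoissonStructure (n : ℕ) (M : Type*) [TopologicalSpace M]
    [ChartedSpace (EuclideanSpace ℝ (Fin n)) M] where
  bracket : C^∞⟮𝓡 n, M; ℝ⟯ → C^∞⟮𝓡 n, M; ℝ⟯ → C^∞⟮𝓡 n, M; ℝ⟯
  add_left : ∀ f g h, bracket (f + g) h = bracket f h + bracket g h
  smul_left : ∀ (c : ℝ) f g, bracket (c • f) g = c • bracket f g
  skew : ∀ f g, bracket f g = -bracket g f
  leibniz : ∀ f g h, bracket (f * g) h = f * bracket g h + g * bracket f h
  jacobi : ∀ f g h,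
    bracket f (bracket g h) + bracket g (bracket h f) + bracket h (bracket f g) = 0

section Pseudogroups

/-! Local transformations `(F, Dom F)` of `M` are partial functions `M →. M`; their composition
`PFun.comp` has domain `F⁻¹(Dom G) ∩ Dom F`. A pseudogroup is given by its set of elements. -/

variable {n : ℕ} {M : Type*} [TopologicalSpace M] [ChartedSpace (EuclideanSpace ℝ (Fin n)) M]

/-- The orbit `T · m = {F(m) | F ∈ T, m ∈ Dom F}`. -/
def orbitOf (T : Set (M →. M)) (m : M) : Set M := {m' | ∃ F ∈ T, m' ∈ F m}

/-- The partition of `M` into `T`-orbits. -/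
def orbitPartition (T : Set (M →. M)) : Set (Set M) := Set.range (orbitOf T)

/-- The orbit space `M/T`, with its quotient topology. -/
abbrev OrbitSpace (T : Set (M →. M)) : Type _ := Quot fun x y : M => y ∈ orbitOf T x

/-- `U` is `T`-invariant (`T`-saturated). -/
def IsInvariantSet (T : Set (M →. M)) (U : Set M) : Prop :=
  ∀ F ∈ T, ∀ z ∈ U, ∀ z' ∈ F z, z' ∈ U

/-- `f ∈ C^∞(U)^T`, for a `T`-invariant open set `U` (the values of `f` off `U` are irrelevant). -/
def IsSmoothInvariantOn (n : ℕ) {M : Type*} [TopologicalSpace M]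
    [ChartedSpace (EuclideanSpace ℝ (Fin n)) M]
    (T : Set (M →. M)) (U : Set M) (f : M → ℝ) : Prop :=
  ContMDiffOn (𝓡 n) 𝓘(ℝ, ℝ) ∞ f U ∧ ∀ F ∈ T, ∀ z ∈ U, ∀ z' ∈ F z, f z' = f z

/-- `C^∞(M)^T`. -/
def invariantFunctions (n : ℕ) {M : Type*} [TopologicalSpace M]
    [ChartedSpace (EuclideanSpace ℝ (Fin n)) M] (T : Set (M →. M)) : Set C^∞⟮𝓡 n, M; ℝ⟯ :=
  {f | ∀ F ∈ T, ∀ z, ∀ z' ∈ F z, f z' = f z}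

/-- `π_T^* C^∞(M/T)`, where `C^∞(M/T)` consists of the continuous functions `φ` on the orbit space
such that `φ ∘ π_T` is smooth on `M`. -/
def pullbackFunctions (n : ℕ) {M : Type*} [TopologicalSpace M]
    [ChartedSpace (EuclideanSpace ℝ (Fin n)) M] (T : Set (M →. M)) : Set C^∞⟮𝓡 n, M; ℝ⟯ :=
  {f | ∃ φ : OrbitSpace T → ℝ, Continuous φ ∧ ∀ m, f m = φ (Quot.mk _ m)}

/-- The extension property: every smooth `T`-invariant function on a `T`-invariant open set agrees,
on a `T`-invariant open neighbourhood of each point, with a global smooth `T`-invariant function. -/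
def HasExtensionProperty (n : ℕ) {M : Type*} [TopologicalSpace M]
    [ChartedSpace (EuclideanSpace ℝ (Fin n)) M] (T : Set (M →. M)) : Prop :=
  ∀ U : Set M, IsOpen U → IsInvariantSet T U → ∀ f : M → ℝ, IsSmoothInvariantOn n T U f →
    ∀ z ∈ U, ∃ V ⊆ U, IsOpen V ∧ IsInvariantSet T V ∧ z ∈ V ∧
      ∃ F ∈ invariantFunctions n T, EqOn f F V

/-- `C^∞(M)^T` separates the `T`-orbits. -/
def SeparatesOrbits (n : ℕ) {M : Type*} [TopologicalSpace M]
    [ChartedSpace (EuclideanSpace ℝ (Fin n)) M] (T : Set (M →. M)) : Prop :=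
  ∀ x y : M, (∀ f ∈ invariantFunctions n T, f x = f y) → orbitOf T x = orbitOf T y

/-- A group of transformations of `M`, seen as a set of everywhere defined local ones. -/
def groupTransformations (A : Subgroup (Equiv.Perm M)) : Set (M →. M) :=
  {F | ∃ φ ∈ A, F = ((φ : M → M) : M →. M)}

end Pseudogroups

section VectorFields

/-- A smooth vector field defined on an open subset of `M` (the values of `vec` off `dom` are
irrelevant). -/
structure LocalVectorField (n : ℕ) (M : Type*) [TopologicalSpace M]
    [ChartedSpace (EuclideanSpace ℝ (Fin n)) M] [IsManifold (𝓡 n) ∞ M] where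
  dom : Set M
  isOpen_dom : IsOpen dom
  vec : (z : M) → TangentSpace (𝓡 n) z
  smooth : ContMDiffOn (𝓡 n) (𝓡 n).tangent ∞
    (fun z => (⟨z, vec z⟩ : TangentBundle (𝓡 n) M)) dom

variable {n : ℕ} {M : Type*} [TopologicalSpace M] [ChartedSpace (EuclideanSpace ℝ (Fin n)) M]
  [IsManifold (𝓡 n) ∞ M]

/-- `m'` is reached from `m` at time `t` along an integral curve of `X` that stays in `Dom X`. -/
def LocalVectorField.FlowsTo (X : LocalVectorField n M) (t : ℝ) (m m' : M) : Prop :=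
  ∃ (γ : ℝ → M) (a b : ℝ), 0 ∈ Ioo a b ∧ t ∈ Ioo a b ∧ IsMIntegralCurveOn γ X.vec (Ioo a b) ∧
    MapsTo γ (Ioo a b) X.dom ∧ γ 0 = m ∧ γ t = m'

/-- The time-`t` flow `F_t` of `X`, on its maximal domain. (On a Hausdorff manifold the end point is
determined by the initial one, so that the choice below is forced.) -/
noncomputable def LocalVectorField.flow (X : LocalVectorField n M) (t : ℝ) : M →. M :=
  fun m => ⟨∃ m', X.FlowsTo t m m', fun h => h.choose⟩

/-- The set `G_𝒟` of local diffeomorphisms generated by a family `𝒟` of vector fields: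
the compositions `F^1_{t_1} ∘ ⋯ ∘ F^k_{t_k}`, `k ≥ 1`, of flows of members of `𝒟`. -/
inductive generatedPseudogroup (D : Set (LocalVectorField n M)) : Set (M →. M)
  | flow (X : LocalVectorField n M) (hX : X ∈ D) (t : ℝ) : generatedPseudogroup D (X.flow t)
  | comp (F G : M →. M) (hF : generatedPseudogroup D F) (hG : generatedPseudogroup D G) :
      generatedPseudogroup D (F.comp G)

/-- The generalized distribution spanned by a family of vector fields. -/
noncomputable def spannedDistribution (D : Set (LocalVectorField n M)) (z : M) :
    Submodule ℝ (TangentSpace (𝓡 n) z) :=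
  Submodule.span ℝ {v | ∃ X ∈ D, z ∈ X.dom ∧ v = X.vec z}

end VectorFields

section Integrability

universe u

/-- A connected immersed submanifold of `M`: a connected smooth manifold with an injective
immersion into `M`. -/
structure ImmersedSubmanifold (n : ℕ) (M : Type u) [TopologicalSpace M]
    [ChartedSpace (EuclideanSpace ℝ (Fin n)) M] where
  dim : ℕ
  carrier : Type u
  [top : TopologicalSpace carrier]
  [charted : ChartedSpace (EuclideanSpace ℝ (Fin dim)) carrier]
  [manifold : IsManifold (𝓡 dim) ∞ carrier]
  [connected : ConnectedSpace carrier]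
  incl : carrier → M
  injective : Function.Injective incl
  smooth : ContMDiff (𝓡 dim) (𝓡 n) ∞ incl
  immersion : ∀ z, Function.Injective (mfderiv (𝓡 dim) (𝓡 n) incl z)

attribute [instance] ImmersedSubmanifold.top ImmersedSubmanifold.charted
  ImmersedSubmanifold.manifold ImmersedSubmanifold.connected

variable {n : ℕ} {M : Type u} [TopologicalSpace M] [ChartedSpace (EuclideanSpace ℝ (Fin n)) M]

/-- The underlying subset of `M`. -/
def ImmersedSubmanifold.image (N : ImmersedSubmanifold n M) : Set M := Set.range N.incl

/-- `N` is an integral submanifold of `D` that is everywhere of maximal dimension: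
`T_z i (T_z N) = D(z)` for all `z ∈ N`. -/
def ImmersedSubmanifold.IsIntegral (N : ImmersedSubmanifold n M)
    (D : (z : M) → Submodule ℝ (TangentSpace (𝓡 n) z)) : Prop :=
  ∀ z : N.carrier, ∀ v : TangentSpace (𝓡 n) (N.incl z),
    v ∈ Set.range (mfderiv (𝓡 N.dim) (𝓡 n) N.incl z) ↔ v ∈ D (N.incl z)

/-- `L` is a leaf of `D`: (the underlying set of) a maximal integral submanifold. -/
def IsLeaf (D : (z : M) → Submodule ℝ (TangentSpace (𝓡 n) z)) (L : Set M) : Prop :=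
  ∃ N : ImmersedSubmanifold n M, N.IsIntegral D ∧ N.image = L ∧
    ∀ N' : ImmersedSubmanifold n M, N'.IsIntegral D → N.image ⊆ N'.image → N'.image = N.image

/-- `D` is integrable: through every point there is a maximal integral submanifold. -/
def IsIntegrable (D : (z : M) → Submodule ℝ (TangentSpace (𝓡 n) z)) : Prop :=
  ∀ z : M, ∃ L, IsLeaf D L ∧ z ∈ L

/-- The partition `M/D` of `M` into the leaves of `D`. -/
def leafPartition (D : (z : M) → Submodule ℝ (TangentSpace (𝓡 n) z)) : Set (Set M) :=
  {L | IsLeaf D L}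

end Integrability

namespace PoissonStructure

variable {n : ℕ} {M : Type*} [TopologicalSpace M] [ChartedSpace (EuclideanSpace ℝ (Fin n)) M]

/-- The group `𝒫(M)` of Poisson automorphisms: the diffeomorphisms `φ` of `M` such that
`{f ∘ φ, g ∘ φ} = {f, g} ∘ φ`. -/
def automorphismGroup (P : PoissonStructure n M) : Subgroup (Equiv.Perm M) where
  carrier := {φ | ∃ h : ContMDiff (𝓡 n) (𝓡 n) ∞ φ, ContMDiff (𝓡 n) (𝓡 n) ∞ φ.symm ∧
    ∀ f g : C^∞⟮𝓡 n, M; ℝ⟯,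
      P.bracket (f.comp ⟨φ, h⟩) (g.comp ⟨φ, h⟩) = (P.bracket f g).comp ⟨φ, h⟩}
  mul_mem' := by
    rintro φ ψ ⟨hφ, hφ', hP⟩ ⟨hψ, hψ', hQ⟩
    refine ⟨hφ.comp hψ, hψ'.comp hφ', fun f g => ?_⟩
    exact (hQ (f.comp ⟨φ, hφ⟩) (g.comp ⟨φ, hφ⟩)).trans
      (congrArg (fun k : C^∞⟮𝓡 n, M; ℝ⟯ => k.comp ⟨ψ, hψ⟩) (hP f g))
  one_mem' := ⟨contMDiff_id, contMDiff_id, fun _ _ => rfl⟩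
  inv_mem' := by
    rintro φ ⟨hφ, hφ', hP⟩
    refine ⟨hφ', hφ, fun f g => ?_⟩
    have key : ∀ k : C^∞⟮𝓡 n, M; ℝ⟯,
        (k.comp (⟨φ.symm, hφ'⟩ : C^∞⟮𝓡 n, M; 𝓡 n, M⟯)).comp ⟨φ, hφ⟩ = k := by
      intro k
      ext x
      exact congrArg k (φ.symm_apply_apply x)
    have h := hP (f.comp ⟨φ.symm, hφ'⟩) (g.comp ⟨φ.symm, hφ'⟩)
    rw [key, key] at h
    ext x
    have hx := DFunLike.congr_fun h (φ.symm x)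
    refine Eq.trans ?_ hx.symm
    exact congrArg _ (φ.apply_symm_apply x).symm

/-- The centralizer of a set of functions with respect to the Poisson bracket. -/
def centralizer (P : PoissonStructure n M) (S : Set C^∞⟮𝓡 n, M; ℝ⟯) : Set C^∞⟮𝓡 n, M; ℝ⟯ :=
  {f | ∀ g ∈ S, P.bracket f g = 0}

variable [IsManifold (𝓡 n) ∞ M]

/-- `X` is the Hamiltonian vector field `X_f` of the smooth function `f` on the open set `Dom X`:
`dg(z) · X_f(z) = {g, f}(z)` for all `z ∈ Dom X` and all smooth `g`, where the bracket at `z` is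
that of `g` with any global smooth function `F` that coincides with `f` near `z`
(such `F` exist, and `{g, F}(z)` depends only on the germ of `F` at `z`). -/
def IsHamiltonianField (P : PoissonStructure n M) (X : LocalVectorField n M) (f : M → ℝ) : Prop :=
  ∀ z ∈ X.dom, ∀ F : C^∞⟮𝓡 n, M; ℝ⟯, (∀ᶠ y in nhds z, F y = f y) →
    ∀ g : C^∞⟮𝓡 n, M; ℝ⟯, mfderiv (𝓡 n) 𝓘(ℝ, ℝ) g z (X.vec z) = P.bracket g F z

/-- The globally defined Hamiltonian vector fields `X_h`, `h ∈ S`. -/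
def globalHamiltonianFields (P : PoissonStructure n M) (S : Set C^∞⟮𝓡 n, M; ℝ⟯) :
    Set (LocalVectorField n M) :=
  {X | X.dom = Set.univ ∧ ∃ h ∈ S, P.IsHamiltonianField X h}

/-- Every `g ∈ A` is a composition of flows of Hamiltonian vector fields of functions in the
centralizer `(C^∞(M)^A)^c`. -/
def IsStronglyHamiltonian (P : PoissonStructure n M) (A : Subgroup (Equiv.Perm M)) : Prop :=
  ∀ g ∈ A, ((g : M → M) : M →. M) ∈ generatedPseudogroup
    (P.globalHamiltonianFields (P.centralizer (invariantFunctions n (groupTransformations A))))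

/-- For every `g ∈ A` and `m ∈ M`, the point `g m` is the image of `m` under a composition of flows
of Hamiltonian vector fields of functions in the centralizer `(C^∞(M)^A)^c`. -/
def IsWeaklyHamiltonian (P : PoissonStructure n M) (A : Subgroup (Equiv.Perm M)) : Prop :=
  ∀ g ∈ A, ∀ m : M, ∃ F ∈ generatedPseudogroup
    (P.globalHamiltonianFields (P.centralizer (invariantFunctions n (groupTransformations A)))),
    g m ∈ F m

/-- The standard polar family of `T`: all `X_f`, `f ∈ C^∞(U)^T`, `U` open and `T`-invariant. -/
def polarFamily (P : PoissonStructure n M) (T : Set (M →. M)) : Set (LocalVectorField n M) :=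
  {X | IsInvariantSet T X.dom ∧
    ∃ f : M → ℝ, IsSmoothInvariantOn n T X.dom f ∧ P.IsHamiltonianField X f}

/-- The polar distribution of `T`. -/
noncomputable def polarDistribution (P : PoissonStructure n M) (T : Set (M →. M)) :
    (z : M) → Submodule ℝ (TangentSpace (𝓡 n) z) :=
  spannedDistribution (P.polarFamily T)

/-- The standard polar pseudogroup of `T`. -/
def polarPseudogroup (P : PoissonStructure n M) (T : Set (M →. M)) : Set (M →. M) :=
  generatedPseudogroup (P.polarFamily T)

/-- The diagram `M/A ← M → M/B` is a dual pair: the polar distributions `A'` and `B'` are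
integrable, `M/A' = M/B` and `M/B' = M/A`. -/
def IsDualPair (P : PoissonStructure n M) (A B : Set (M →. M)) : Prop :=
  IsIntegrable (P.polarDistribution A) ∧ IsIntegrable (P.polarDistribution B) ∧
    leafPartition (P.polarDistribution A) = orbitPartition B ∧
    leafPartition (P.polarDistribution B) = orbitPartition A

/-- `A` is von Neumann: `A'` and `A'' = (A')'` are integrable and `M/A'' = M/A`. -/
def IsVonNeumann (P : PoissonStructure n M) (A : Set (M →. M)) : Prop :=
  IsIntegrable (P.polarDistribution A) ∧
    IsIntegrable (P.polarDistribution (P.polarPseudogroup A)) ∧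
    leafPartition (P.polarDistribution (P.polarPseudogroup A)) = orbitPartition A

/-- The diagram `M/A ← M → M/B` is a Howe pair: `π_A^* C^∞(M/A)` and `π_B^* C^∞(M/B)` are
each other's centralizers. -/
def IsHowePair (P : PoissonStructure n M) (A B : Set (M →. M)) : Prop :=
  P.centralizer (pullbackFunctions n A) = pullbackFunctions n B ∧
    P.centralizer (pullbackFunctions n B) = pullbackFunctions n A

end PoissonStructure

-- Everything rests on one commutation fact. If `f` is invariant under `T` on an open invariant set,
-- then `X_f` belongs to the polar family of `T`, so a function `g` invariant under `G_{T'}` is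
-- constant along the flow of `X_f`, and `{g, f} = 0` (`localBracket_eq_zero`). Conversely, a
-- function annihilated by all generating fields is invariant under the pseudogroup they generate
-- (`eq_of_forall_differential_eq_zero`).
--
-- For (ii), a member of the standard family of `A''` is `X_h` with `h` invariant under `G_{A'}`. It
-- annihilates each `f` in `C^∞(M)^A`, so `G_{A''}` preserves all these functions, and if they
-- separate the `A`-orbits it cannot leave one. For (i), the extension property replaces a locally
-- defined invariant function by a global one near each point. A function in the centralizer of
-- `C^∞(M)^A` therefore commutes with the local invariants too and is `G_{A'}`-invariant
-- (`centralizer_subset`), so its Hamiltonian flows already lie in `G_{A''}`. The Howe property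
-- follows from the same two inclusions, since pull-backs from an orbit space are just the invariant
-- functions.
--
-- After this the orbits of `A` and `G_{A''}` agree, and (iii) reduces to showing that `A'` and
-- `A''` are integrable with leaves the orbits of `G_{A'}` and `G_{A''}`. This is the
-- Stefan-Sussmann orbit theorem `isIntegrable_of_isFlowInvariant`: if the linearized flows of the
-- generators preserve the distribution, its rank is constant on orbits, composing flows of a local
-- frame gives charts whose central plaques lie in an orbit, and these plaques are charts of a
-- manifold structure on the orbit.
--
-- Flow invariance of a polar distribution (`isFlowInvariant_polarDistribution`) comes from two
-- inputs. Invariant functions are closed under the bracket, because `A` acts by Poisson maps, or by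
-- the Jacobi identity for `G_{A'}`. The rank of their differentials does not increase near a point
-- of a flow line: for `A'` because its flows commute with `A` and so carry local invariants to
-- local invariants; for `A''` because separation keeps the flow line in one `A`-orbit, and `A`
-- carries invariants of `G_{A'}` to such invariants. A frame `X_{f_i}` then satisfies a linear
-- differential equation along the flow, and its span is constant.
--
-- The analytic base is smooth dependence of solutions on initial values, obtained from the inverse
-- function theorem in a space of curves, and the identification of point derivations with tangent
-- vectors through Hadamard's lemma.

universe u

/-! ### Superposition operators on spaces of continuous maps. -/

section Superposition

variable {K : Type*} [TopologicalSpace K] [CompactSpace K]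

/-- Pointwise application of a continuous family of operators. -/
noncomputable def ContinuousMap.applyFamily (K : Type*) [TopologicalSpace K] [CompactSpace K]
    (E F : Type*) [NormedAddCommGroup E] [NormedSpace ℝ E] [NormedAddCommGroup F]
    [NormedSpace ℝ F] : C(K, E →L[ℝ] F) →L[ℝ] C(K, E) →L[ℝ] C(K, F) :=
  LinearMap.mkContinuous₂
    (LinearMap.mk₂ ℝ (fun (A : C(K, E →L[ℝ] F)) (η : C(K, E)) =>
        (⟨fun t => A t (η t), by fun_prop⟩ : C(K, F)))
      (fun _ _ _ => by ext; simp) (fun _ _ _ => by ext; simp)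
      (fun _ _ _ => by ext; simp) (fun _ _ _ => by ext; simp)) 1
    (fun A η => by
      rw [one_mul]
      refine (ContinuousMap.norm_le _ (by positivity)).2 fun t => ?_
      exact ((A t).le_opNorm _).trans (mul_le_mul (A.norm_coe_le_norm t) (η.norm_coe_le_norm t)
        (norm_nonneg _) (norm_nonneg A)))

/-- The superposition operator of `f'` is continuous in the sup norm, so on a small ball around `γ`
the derivative varies by at most `ε` along all segments from `γ t` to `γ t + η t` at once. The mean
value inequality then gives an estimate uniform in `t`. -/
theorem ContinuousMap.hasFDerivAt_postcomp {E F : Type*} [NormedAddCommGroup E] [NormedSpace ℝ E]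
    [NormedAddCommGroup F] [NormedSpace ℝ F] {f : E → F} {f' : E → E →L[ℝ] F}
    (hf : ∀ x, HasFDerivAt f (f' x) x) (hc : Continuous f) (hc' : Continuous f') (γ : C(K, E)) :
    HasFDerivAt (fun γ : C(K, E) => (⟨f, hc⟩ : C(E, F)).comp γ)
      (ContinuousMap.applyFamily K E F ((⟨f', hc'⟩ : C(E, E →L[ℝ] F)).comp γ)) γ := by
  rw [hasFDerivAt_iff_isLittleO_nhds_zero, Asymptotics.isLittleO_iff]
  intro ε hε
  have hcont : Continuous fun γ : C(K, E) => (⟨f', hc'⟩ : C(E, E →L[ℝ] F)).comp γ :=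
    ContinuousMap.continuous_postcomp _
  obtain ⟨δ, hδ, hball⟩ := (Metric.continuous_iff (α := C(K, E)) (β := C(K, E →L[ℝ] F))).1 hcont γ ε hε
  filter_upwards [Metric.ball_mem_nhds (0 : C(K, E)) hδ] with η hη
  refine (ContinuousMap.norm_le _ (by positivity)).2 fun t => ?_
  have key : ∀ y ∈ segment ℝ (γ t) (γ t + η t), ‖f' y - f' (γ t)‖ ≤ ε := by
    intro y hy
    rw [segment_eq_image'] at hy
    obtain ⟨s, hs, rfl⟩ := hy
    have hlt : dist (γ + s • η) γ < δ := by
      rw [dist_eq_norm, add_sub_cancel_left, norm_smul, Real.norm_of_nonneg hs.1]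
      refine (mul_le_of_le_one_left (norm_nonneg _) hs.2).trans_lt ?_
      simpa using hη
    have := (ContinuousMap.dist_apply_le_dist t).trans_lt (hball _ hlt)
    simpa [dist_eq_norm] using this.le
  have := (convex_segment (γ t) (γ t + η t)).norm_image_sub_le_of_norm_hasFDerivWithin_le'
    (fun y _ => (hf y).hasFDerivWithinAt) key (left_mem_segment ℝ _ _) (right_mem_segment ℝ _ _)
  rw [add_sub_cancel_left] at this
  exact this.trans (mul_le_mul_of_nonneg_left (η.norm_coe_le_norm t) hε.le)

/-- The superposition operator of a smooth map is smooth. -/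
theorem ContinuousMap.contDiff_postcomp_nat {E : Type u} [NormedAddCommGroup E] [NormedSpace ℝ E]
    (n : ℕ) : ∀ {F : Type u} [NormedAddCommGroup F] [NormedSpace ℝ F] {f : E → F}
      (hf : ContDiff ℝ n f),
      ContDiff ℝ n (fun γ : C(K, E) => (⟨f, hf.continuous⟩ : C(E, F)).comp γ) := by
  induction n with
  | zero =>
    intro F _ _ f hf
    exact contDiff_zero.2 (ContinuousMap.continuous_postcomp _)
  -- The derivative is built from the superposition operator of `fderiv ℝ f`, with values in `E
  -- →L[ℝ] F`. Hence the target varies in the induction, and `E` and `F` share a universe.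
  | succ n ih =>
    intro F _ _ f hf
    have hd : Differentiable ℝ f := hf.differentiable (by simp)
    have hf' : ContDiff ℝ n (fderiv ℝ f) := hf.fderiv_right (by norm_cast)
    refine contDiff_succ_iff_hasFDerivAt.2
      ⟨fun γ => ContinuousMap.applyFamily K E F ((⟨_, hf'.continuous⟩ : C(E, E →L[ℝ] F)).comp γ),
        ContDiff.comp (g := ContinuousMap.applyFamily K E F)
          (by apply ContinuousLinearMap.contDiff) (ih hf'), fun γ =>
      ContinuousMap.hasFDerivAt_postcomp (fun x => (hd x).hasFDerivAt) _ hf'.continuous γ⟩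

theorem ContinuousMap.contDiff_postcomp {E F : Type u} [NormedAddCommGroup E] [NormedSpace ℝ E]
    [NormedAddCommGroup F] [NormedSpace ℝ F] {f : E → F} (hf : ContDiff ℝ ∞ f) :
    ContDiff ℝ ∞ (fun γ : C(K, E) => (⟨f, hf.continuous⟩ : C(E, F)).comp γ) :=
  contDiff_infty.2 fun n => ContinuousMap.contDiff_postcomp_nat n (contDiff_infty.1 hf n)

end Superposition

/-! ### Hadamard's lemma. -/

section Hadamard

/-- Hadamard's lemma. -/
theorem ContDiff.exists_hadamard {E : Type} [NormedAddCommGroup E] [NormedSpace ℝ E]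
    {f : E → ℝ} (hf : ContDiff ℝ ∞ f) (x₀ : E) :
    ∃ L : E → E →L[ℝ] ℝ, ContDiff ℝ ∞ L ∧ L x₀ = fderiv ℝ f x₀ ∧
      ∀ x, f x = f x₀ + L x (x - x₀) := by
  have hf' : ContDiff ℝ ∞ (fderiv ℝ f) := hf.fderiv_right (by simp)
  -- `L x` is the average of `fderiv ℝ f` over the segment from `x₀` to `x`. It is smooth in `x` as
  -- an affine map into a space of paths, followed by a superposition operator and by continuous
  -- linear integration.
  let path : E → C(Icc (0 : ℝ) 1, E) := fun x => ⟨fun t => x₀ + (t : ℝ) • (x - x₀), by fun_prop⟩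
  let lin : E →L[ℝ] C(Icc (0 : ℝ) 1, E) :=
    LinearMap.mkContinuous
      { toFun := fun x => ⟨fun t => (t : ℝ) • x, by fun_prop⟩
        map_add' := fun _ _ => by ext; simp
        map_smul' := fun c x => by ext t; simp [smul_comm (t : ℝ) c x] } 1 (fun x => by
      rw [one_mul]
      refine (ContinuousMap.norm_le _ (norm_nonneg _)).2 fun t => ?_
      have := mul_le_of_le_one_left (norm_nonneg x) t.2.2
      simpa [norm_smul, abs_of_nonneg t.2.1] using this)
  have hpath : ContDiff ℝ ∞ path := by
    have : path = fun x => ContinuousMap.const _ x₀ + lin (x - x₀) := by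
      ext x t; simp [path, lin]
    rw [this]
    exact contDiff_const.add (lin.contDiff.comp (contDiff_id.sub contDiff_const))
  let int : C(Icc (0 : ℝ) 1, E →L[ℝ] ℝ) →L[ℝ] (E →L[ℝ] ℝ) :=
    LinearMap.mkContinuous
      { toFun := fun γ : C(Icc (0 : ℝ) 1, E →L[ℝ] ℝ) => ∫ t in (0 : ℝ)..1, γ (projIcc 0 1 zero_le_one t)
        map_add' := fun γ γ' => by
          simp only [ContinuousMap.add_apply]
          exact intervalIntegral.integral_add
            (Continuous.intervalIntegrable (by fun_prop) _ _)
            (Continuous.intervalIntegrable (by fun_prop) _ _)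
        map_smul' := fun c γ => by simp } 1 (fun γ => by
      have := intervalIntegral.norm_integral_le_of_norm_le_const (a := 0) (b := 1) (C := ‖γ‖)
        (f := fun t => γ (projIcc 0 1 zero_le_one t)) (fun t _ => γ.norm_coe_le_norm _)
      simpa using this)
  have hsmooth : ContDiff ℝ ∞ fun x =>
      (⟨fderiv ℝ f, hf'.continuous⟩ : C(E, E →L[ℝ] ℝ)).comp (path x) :=
    (ContinuousMap.contDiff_postcomp hf').comp hpath
  refine ⟨fun x => int ((⟨fderiv ℝ f, hf'.continuous⟩ : C(E, E →L[ℝ] ℝ)).comp (path x)),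
    ContDiff.comp (g := int) (by apply ContinuousLinearMap.contDiff) hsmooth, ?_, fun x => ?_⟩
  · simp [int, path]
  · have hd : ∀ t : ℝ, HasDerivAt (fun t : ℝ => f (x₀ + t • (x - x₀)))
        (fderiv ℝ f (x₀ + t • (x - x₀)) (x - x₀)) t := fun t => by
      have h1 : HasDerivAt (fun t : ℝ => x₀ + t • (x - x₀)) (x - x₀) t := by
        simpa using ((hasDerivAt_id t).smul_const (x - x₀)).const_add x₀
      exact ((hf.differentiable (by simp)) _).hasFDerivAt.comp_hasDerivAt t h1
    have hcont : Continuous fun t : ℝ => fderiv ℝ f (x₀ + t • (x - x₀)) :=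
      hf'.continuous.comp (by fun_prop)
    have hint := intervalIntegral.integral_eq_sub_of_hasDerivAt (fun t _ => hd t)
      (Continuous.intervalIntegrable (by fun_prop) (0 : ℝ) 1)
    have heq : int ((⟨fderiv ℝ f, hf'.continuous⟩ : C(E, E →L[ℝ] ℝ)).comp (path x)) (x - x₀)
        = ∫ t in (0 : ℝ)..1, fderiv ℝ f (x₀ + t • (x - x₀)) (x - x₀) := by
      rw [← ContinuousLinearMap.intervalIntegral_apply (hcont.intervalIntegrable _ _)]
      congr 1
      refine intervalIntegral.integral_congr fun t ht => ?_
      rw [uIcc_of_le zero_le_one] at ht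
      simp [path, projIcc_of_mem zero_le_one ht]
    rw [heq, hint]
    simp

end Hadamard

/-! ### Smooth local inverses between Banach spaces. -/

section InverseFunction

/-- The inverse function theorem for `C^∞` maps, with a smooth inverse on the whole target. -/
theorem ContDiffOn.exists_openPartialHomeomorph {E F : Type*} [NormedAddCommGroup E]
    [NormedSpace ℝ E] [CompleteSpace E] [NormedAddCommGroup F] [NormedSpace ℝ F]
    {f : E → F} {U : Set E} (hU : IsOpen U) (hf : ContDiffOn ℝ ∞ f U) {a : E} (ha : a ∈ U)
    (f' : E ≃L[ℝ] F) (hf' : HasFDerivAt f (f' : E →L[ℝ] F) a) :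
    ∃ e : OpenPartialHomeomorph E F, a ∈ e.source ∧ e.source ⊆ U ∧ ⇑e = f ∧
      ContDiffOn ℝ ∞ e.symm e.target := by
  have hfa : ContDiffAt ℝ ∞ f a := hf.contDiffAt (hU.mem_nhds ha)
  let e₀ := hfa.toOpenPartialHomeomorph f hf' (by simp)
  have hcont : ContinuousOn (fderiv ℝ f) U :=
    (hf.fderiv_of_isOpen hU (m := ∞) (by simp)).continuousOn
  -- Restricting to the open set where the derivative is invertible makes the inverse smooth at
  -- every point of the target, not only at the image of `a`.
  have hS := hcont.isOpen_inter_preimage hU (ContinuousLinearEquiv.isOpen (𝕜 := ℝ) (E := E) (F := F))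
  refine ⟨e₀.restrOpen _ hS, ⟨hfa.mem_toOpenPartialHomeomorph_source hf' (by simp), ha, f', ?_⟩,
    fun x hx => hx.2.1, rfl, fun y hy => ?_⟩
  · exact hf'.fderiv.symm
  · have hy' := (e₀.restrOpen _ hS).map_target hy
    obtain ⟨hxU, g, hg⟩ : (e₀.restrOpen _ hS).symm y ∈ U ∩ _ := hy'.2
    have hxc := hf.contDiffAt (hU.mem_nhds hxU)
    refine ((e₀.restrOpen _ hS).contDiffAt_symm (f₀' := g) hy ?_ hxc).contDiffWithinAt
    rw [hg]
    exact (hxc.differentiableAt (by simp)).hasFDerivAt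

end InverseFunction

/-! ### Smooth dependence of solutions on time and initial value. -/

section SmoothFlow

variable {E : Type} [NormedAddCommGroup E] [NormedSpace ℝ E] [CompleteSpace E]

/-- The primitive vanishing at `0`, as an operator on the continuous functions on `[-1, 1]`. -/
noncomputable def primitiveCLM (E : Type) [NormedAddCommGroup E] [NormedSpace ℝ E]
    [CompleteSpace E] : C(Icc (-1 : ℝ) 1, E) →L[ℝ] C(Icc (-1 : ℝ) 1, E) :=
  LinearMap.mkContinuous
    { toFun := fun γ : C(Icc (-1 : ℝ) 1, E) =>
        ⟨fun s => ∫ r in (0 : ℝ)..s, γ (projIcc (-1) 1 (by norm_num) r),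
          (intervalIntegral.continuous_primitive
            (fun _ _ => (γ.continuous.comp continuous_projIcc).intervalIntegrable _ _) 0).comp
            continuous_subtype_val⟩
      map_add' := fun γ γ' => by
        ext s
        exact intervalIntegral.integral_add (Continuous.intervalIntegrable (by fun_prop) _ _)
          (Continuous.intervalIntegrable (by fun_prop) _ _)
      map_smul' := fun c γ => by
        ext s
        exact intervalIntegral.integral_smul c _ } 1 (fun γ => by
    rw [one_mul]
    refine (ContinuousMap.norm_le _ (norm_nonneg _)).2 fun s => ?_
    have h := intervalIntegral.norm_integral_le_of_norm_le_const (a := 0) (b := s) (C := ‖γ‖)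
      (f := fun t => γ (projIcc (-1) 1 (by norm_num) t)) (fun t _ => γ.norm_coe_le_norm _)
    refine h.trans (mul_le_of_le_one_right (norm_nonneg _) ?_)
    rw [sub_zero, abs_le]
    exact s.2)

theorem primitiveCLM_apply (γ : C(Icc (-1 : ℝ) 1, E)) (s : Icc (-1 : ℝ) 1) :
    primitiveCLM E γ s = ∫ r in (0 : ℝ)..s, γ (projIcc (-1) 1 (by norm_num) r) := rfl

/-- Smooth dependence of the solutions of an autonomous differential equation on the initial
condition. -/
theorem exists_contDiffOn_flow {f : E → E} (hf : ContDiff ℝ ∞ f) (x₀ : E) :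
    ∃ ε > 0, ∃ V : Set E, IsOpen V ∧ x₀ ∈ V ∧ ∃ Φ : ℝ × E → E,
      ContDiffOn ℝ ∞ Φ (Ioo (-ε) ε ×ˢ V) ∧ ∀ x ∈ V, Φ (0, x) = x ∧
        ∀ t ∈ Ioo (-ε) ε, HasDerivAt (fun s => Φ (s, x)) (f (Φ (t, x))) t := by
  let C := C(Icc (-1 : ℝ) 1, E)
  let cst : E →L[ℝ] C := ContinuousLinearMap.const ℝ (Icc (-1 : ℝ) 1)
  let N : C → C := fun γ => primitiveCLM E ((⟨f, hf.continuous⟩ : C(E, E)).comp γ)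
  have hN : ContDiff ℝ ∞ N :=
    ContDiff.comp (g := primitiveCLM E) (by apply ContinuousLinearMap.contDiff)
      (ContinuousMap.contDiff_postcomp hf)
  -- With time rescaled to `[-1, 1]`, the curve `s ↦ Φ (s * τ, x)` is the solution `γ` of `γ = x + τ
  -- • N γ`. Inverting `H` near `τ = 0` and reading off the preimage of `(τ, x, 0)` solves this
  -- equation smoothly in `(τ, x)`.
  let H : ℝ × E × C → ℝ × E × C := fun p => (p.1, p.2.1, p.2.2 - cst p.2.1 - p.1 • N p.2.2)
  have hH : ContDiff ℝ ∞ H := by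
    have h1 : ContDiff ℝ ∞ fun p : ℝ × E × C => cst p.2.1 := by
      have : ContDiff ℝ ∞ cst := by apply ContinuousLinearMap.contDiff
      exact this.comp (by fun_prop)
    have h2 : ContDiff ℝ ∞ fun p : ℝ × E × C => N p.2.2 := hN.comp (by fun_prop)
    fun_prop
  let a : ℝ × E × C := (0, x₀, cst x₀)
  -- In the derivative of `p.1 • N p.2.2` at `a` the factor `p.1` vanishes, so only the value of `N`
  -- survives and the derivative of `H` is triangular.
  let b : C := N (cst x₀)
  let L : (ℝ × E × C) ≃L[ℝ] (ℝ × E × C) :=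
    { toFun := fun p => (p.1, p.2.1, p.2.2 - cst p.2.1 - p.1 • b)
      invFun := fun p => (p.1, p.2.1, p.2.2 + cst p.2.1 + p.1 • b)
      map_add' := fun p q => by
        ext1
        · simp
        · ext1
          · simp
          · simp only [Prod.fst_add, Prod.snd_add, map_add, add_smul]; abel
      map_smul' := fun c p => by
        ext1
        · simp
        · ext1
          · simp
          · simp [smul_sub, mul_smul]
      left_inv := fun p => Prod.ext rfl (Prod.ext rfl (by simp; abel))
      right_inv := fun p => Prod.ext rfl (Prod.ext rfl (by simp; abel))
      continuous_toFun := by fun_prop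
      continuous_invFun := by fun_prop }
  have hL : HasFDerivAt H (L : (ℝ × E × C) →L[ℝ] (ℝ × E × C)) a := by
    have h1 : HasFDerivAt (fun p : ℝ × E × C => p.1) (ContinuousLinearMap.fst ℝ ℝ (E × C)) a :=
      hasFDerivAt_fst
    have h2 : HasFDerivAt (fun p : ℝ × E × C => p.2.1)
        ((ContinuousLinearMap.fst ℝ E C).comp (ContinuousLinearMap.snd ℝ ℝ (E × C))) a :=
      HasFDerivAt.comp a hasFDerivAt_fst hasFDerivAt_snd
    have h3 : HasFDerivAt (fun p : ℝ × E × C => p.2.2)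
        ((ContinuousLinearMap.snd ℝ E C).comp (ContinuousLinearMap.snd ℝ ℝ (E × C))) a :=
      HasFDerivAt.comp a hasFDerivAt_snd hasFDerivAt_snd
    have h4 := (((hN.differentiable (by simp)) (cst x₀)).hasFDerivAt (x := a.2.2)).comp a h3
    have h5 := h1.smul h4
    have h6 := (h3.sub (cst.hasFDerivAt.comp a h2)).sub h5
    have h7 := h1.prodMk (h2.prodMk h6)
    refine h7.congr_fderiv ?_
    ext p <;> simp [a, b, L]
  obtain ⟨e, hae, -, heH, hesymm⟩ :=
    hH.contDiffOn.exists_openPartialHomeomorph isOpen_univ (mem_univ a) L hL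
  have hHa : H a = (0, x₀, 0) := by simp [H, a]
  have hsrc : ∀ᶠ p in nhds a, p ∈ e.source := e.open_source.mem_nhds hae
  obtain ⟨ρ, hρ, hball⟩ := Metric.eventually_nhds_iff.1 hsrc
  let Γ : ℝ × E → C := fun q => (e.symm (q.1, q.2, 0)).2.2
  have hta : (0, x₀, 0) ∈ e.target := by
    rw [← hHa, ← heH]; exact e.map_source hae
  have hincl : Continuous fun q : ℝ × E => ((q.1, q.2, 0) : ℝ × E × C) := by fun_prop
  have hΓa : Γ (0, x₀) = cst x₀ := by
    have : e.symm (0, x₀, 0) = a := by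
      rw [← hHa, ← heH]; exact e.left_inv hae
    simp only [Γ, this, a]
  have hΓc : ContinuousAt Γ (0, x₀) := by
    have h1 : ContinuousAt e.symm ((fun q : ℝ × E => ((q.1, q.2, 0) : ℝ × E × C)) (0, x₀)) :=
      e.continuousAt_symm hta
    have := h1.comp (x := (0, x₀)) hincl.continuousAt
    exact (continuous_snd.comp continuous_snd).continuousAt.comp this
  have hev : ∀ᶠ q : ℝ × E in nhds ((0 : ℝ), x₀), (q.1, q.2, (0 : C)) ∈ e.target ∧
      Γ q ∈ Metric.ball (cst x₀) ρ ∧ q ∈ Metric.ball ((0 : ℝ), x₀) ρ := by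
    refine (hincl.continuousAt.eventually (e.open_target.mem_nhds hta)).and
      (((?_ : ∀ᶠ q : ℝ × E in nhds ((0 : ℝ), x₀), Γ q ∈ Metric.ball (cst x₀) ρ)).and
        (Metric.ball_mem_nhds _ hρ))
    rw [← hΓa]
    exact hΓc (Metric.ball_mem_nhds _ hρ)
  obtain ⟨δ, hδ, hbox⟩ := Metric.eventually_nhds_iff.1 hev
  have hbox' : ∀ τ : ℝ, ∀ x : E, |τ| < δ → dist x x₀ < δ →
      (τ, x, (0 : C)) ∈ e.target ∧ dist (Γ (τ, x)) (cst x₀) < ρ ∧ |τ| < ρ ∧ dist x x₀ < ρ := by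
    intro τ x hτ hx
    obtain ⟨h1, h2, h3⟩ := hbox (y := (τ, x)) (by simpa [Prod.dist_eq] using ⟨hτ, hx⟩)
    refine ⟨h1, h2, ?_⟩
    simpa [Prod.dist_eq] using h3
  have hΓeq : ∀ τ : ℝ, ∀ x : E, |τ| < δ → dist x x₀ < δ →
      Γ (τ, x) = cst x + τ • N (Γ (τ, x)) := by
    intro τ x hτ hx
    have h1 := e.right_inv (hbox' τ x hτ hx).1
    rw [heH] at h1
    have h2 := congrArg (fun p : ℝ × E × C => p.1) h1
    have h3 := congrArg (fun p : ℝ × E × C => p.2.1) h1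
    have h4 := congrArg (fun p : ℝ × E × C => p.2.2) h1
    simp only [H] at h2 h3 h4
    rw [h2, h3, sub_sub, sub_eq_zero] at h4
    exact h4
  have huniq : ∀ τ : ℝ, ∀ x : E, |τ| < δ → dist x x₀ < δ → ∀ γ : C, dist γ (cst x₀) < ρ →
      γ = cst x + τ • N γ → γ = Γ (τ, x) := by
    intro τ x hτ hx γ hγ heq
    obtain ⟨-, -, h1, h2⟩ := hbox' τ x hτ hx
    have hmem : (τ, x, γ) ∈ e.source := by
      apply hball
      simp only [Prod.dist_eq, a, max_lt_iff]
      exact ⟨by simpa using h1, h2, hγ⟩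
    have hval : e (τ, x, γ) = (τ, x, 0) := by
      rw [heH]
      simp only [H]
      rw [sub_sub, sub_eq_zero.2 heq]
    have := e.left_inv hmem
    rw [hval] at this
    simp only [Γ, this]
  let one : Icc (-1 : ℝ) 1 := ⟨1, by norm_num⟩
  let Φ : ℝ × E → E := fun q => Γ q one
  -- The curve `r ↦ Γ (τ, x) (s * r)` solves the equation with parameter `s * τ`, so local
  -- uniqueness identifies it with `Γ (s * τ, x)`. Thus one curve `Γ (τ, x)` contains all values of
  -- `Φ` for times up to `|τ|`.
  have hscale : ∀ τ : ℝ, ∀ x : E, |τ| < δ → dist x x₀ < δ → ∀ s : Icc (-1 : ℝ) 1,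
      Φ (s * τ, x) = Γ (τ, x) s := by
    intro τ x hτ hx s
    have habs : |(s : ℝ)| ≤ 1 := abs_le.2 s.2
    have hmul : ∀ r ∈ Icc (-1 : ℝ) 1, (s : ℝ) * r ∈ Icc (-1 : ℝ) 1 := by
      intro r hr
      rw [mem_Icc, ← abs_le, abs_mul]
      exact mul_le_one₀ habs (abs_nonneg _) (abs_le.2 hr)
    let γ : C := ⟨fun r => Γ (τ, x) ⟨s * r, hmul r r.2⟩, by fun_prop⟩
    have hγρ : dist γ (cst x₀) < ρ := by
      refine lt_of_le_of_lt ?_ (hbox' τ x hτ hx).2.1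
      refine (ContinuousMap.dist_le dist_nonneg).2 fun r => ?_
      exact ContinuousMap.dist_apply_le_dist (f := Γ (τ, x)) (g := cst x₀) ⟨s * r, hmul r r.2⟩
    have hsτ : |s * τ| < δ := by
      rw [abs_mul]
      exact (mul_le_of_le_one_left (abs_nonneg _) habs).trans_lt hτ
    have hγ : γ = cst x + ((s : ℝ) * τ) • N γ := by
      ext r
      have h1 := DFunLike.congr_fun (hΓeq τ x hτ hx) ⟨s * r, hmul r r.2⟩
      refine h1.trans ?_
      change x + τ • primitiveCLM E _ _ = x + ((s : ℝ) * τ) • primitiveCLM E _ _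
      rw [primitiveCLM_apply, primitiveCLM_apply, mul_comm (s : ℝ) τ, mul_smul]
      congr 2
      have h2 := intervalIntegral.smul_integral_comp_mul_left (a := 0) (b := r)
        (fun u => f (Γ (τ, x) (projIcc (-1) 1 (by norm_num) u))) (s : ℝ)
      rw [mul_zero] at h2
      change (∫ u in (0 : ℝ)..(s * r), f (Γ (τ, x) (projIcc (-1) 1 (by norm_num) u))) = _
      rw [← h2]
      congr 1
      refine intervalIntegral.integral_congr fun u hu => ?_
      have hu' : u ∈ Icc (-1 : ℝ) 1 := by
        have : (0 : ℝ) ∈ Icc (-1 : ℝ) 1 := by norm_num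
        exact ordConnected_Icc.uIcc_subset this r.2 hu
      change f (Γ (τ, x) _) = f (γ _)
      rw [projIcc_of_mem _ (hmul u hu'), projIcc_of_mem _ hu']
      rfl
    have := DFunLike.congr_fun (huniq _ x hsτ hx γ hγρ hγ) one
    refine this.symm.trans ?_
    change Γ (τ, x) _ = _
    congr 1
    ext
    exact mul_one _
  have hε : 0 < δ / 2 := by positivity
  have habs2 : |δ / 2| < δ := by rw [abs_of_pos hε]; linarith
  refine ⟨δ / 2, hε, Metric.ball x₀ δ, Metric.isOpen_ball, Metric.mem_ball_self hδ, Φ, ?_,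
    fun x hx => ⟨?_, fun t ht => ?_⟩⟩
  · have h1 : ContDiffOn ℝ ∞ (fun q : ℝ × E => e.symm (q.1, q.2, (0 : C)))
        (Ioo (-(δ / 2)) (δ / 2) ×ˢ Metric.ball x₀ δ) := by
      refine hesymm.comp (f := fun q : ℝ × E => ((q.1, q.2, 0) : ℝ × E × C)) ?_ fun q hq => ?_
      · exact ContDiff.contDiffOn (by fun_prop)
      · refine (hbox' q.1 q.2 ?_ hq.2).1
        rw [abs_lt]; constructor <;> linarith [hq.1.1, hq.1.2]
    have h2 : ContDiff ℝ ∞ (fun p : ℝ × E × C => p.2.2 one) :=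
      ContDiff.comp (g := ContinuousMap.evalCLM ℝ one)
        (by apply ContinuousLinearMap.contDiff) (contDiff_snd.comp contDiff_snd)
    exact h2.comp_contDiffOn h1
  · have h0 : |(0 : ℝ)| < δ := by simpa using hδ
    have := DFunLike.congr_fun (hΓeq 0 x h0 hx) one
    rw [zero_smul, add_zero] at this
    exact this
  -- All times in the interval are read from the single curve with parameter `δ / 2`, which is a
  -- primitive and can be differentiated.
  · have hform : ∀ s ∈ Ioo (-(δ / 2)) (δ / 2), Φ (s, x) = x + (δ / 2) •
        ∫ r in (0 : ℝ)..(s / (δ / 2)),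
          f (Γ (δ / 2, x) (projIcc (-1) 1 (by norm_num) r)) := by
      intro s hs
      have hs' : s / (δ / 2) ∈ Icc (-1 : ℝ) 1 := by
        constructor
        · rw [le_div_iff₀ hε]; linarith [hs.1]
        · rw [div_le_iff₀ hε]; linarith [hs.2]
      have h1 := hscale (δ / 2) x habs2 hx ⟨s / (δ / 2), hs'⟩
      rw [div_mul_cancel₀ _ hε.ne'] at h1
      rw [h1]
      exact DFunLike.congr_fun (hΓeq _ x habs2 hx) ⟨s / (δ / 2), hs'⟩
    have hcontf : Continuous fun r : ℝ =>
        f (Γ (δ / 2, x) (projIcc (-1) 1 (by norm_num) r)) :=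
      hf.continuous.comp ((Γ (δ / 2, x)).continuous.comp continuous_projIcc)
    have hd1 : HasDerivAt (fun s : ℝ => s / (δ / 2)) (1 / (δ / 2)) t :=
      (hasDerivAt_id t).div_const _
    have hd2 := (intervalIntegral.integral_hasDerivAt_right (a := 0) (b := t / (δ / 2))
      (hcontf.intervalIntegrable _ _) (hcontf.stronglyMeasurableAtFilter _ _)
      hcontf.continuousAt)
    have hd3 := ((hd2.scomp t hd1).const_smul (δ / 2)).const_add x
    have hd4 : HasDerivAt (fun s => Φ (s, x)) _ t :=
      hd3.congr_of_eventuallyEq (by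
        filter_upwards [isOpen_Ioo.mem_nhds ht] with s hs using hform s hs)
    convert hd4 using 1
    have ht' : t / (δ / 2) ∈ Icc (-1 : ℝ) 1 := by
      constructor
      · rw [le_div_iff₀ hε]; linarith [ht.1]
      · rw [div_le_iff₀ hε]; linarith [ht.2]
    have h1 := hscale (δ / 2) x habs2 hx ⟨t / (δ / 2), ht'⟩
    rw [div_mul_cancel₀ _ hε.ne'] at h1
    rw [h1, projIcc_of_mem _ ht', smul_smul, mul_one_div_cancel hε.ne', one_smul]

end SmoothFlow

/-! ### Constancy of a span under a linear differential equation. -/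

section LinearODE

/-- If the derivatives of a finite family of curves are linear combinations of the curves, then the
span of the family is constant. -/
theorem span_range_eq_of_hasDerivAt {ι E : Type*} [Fintype ι] [NormedAddCommGroup E]
    [NormedSpace ℝ E] [FiniteDimensional ℝ E] {e : ι → ℝ → E} {c : ι → ι → ℝ → ℝ} {a b : ℝ}
    (hc : ∀ i j, ContinuousOn (c i j) (Ioo a b))
    (he : ∀ i, ∀ t ∈ Ioo a b, HasDerivAt (e i) (∑ j, c i j t • e j t) t)
    {s t : ℝ} (hs : s ∈ Ioo a b) (ht : t ∈ Ioo a b) :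
    Submodule.span ℝ (range fun i => e i s) = Submodule.span ℝ (range fun i => e i t) := by
  have main : ∀ s ∈ Ioo a b, ∀ t ∈ Ioo a b, ∀ i,
      e i t ∈ Submodule.span ℝ (range fun i => e i s) := by
    intro s hs t ht i
    by_contra hnot
    -- A functional vanishing on the span at time `s` but not on `e i t`, applied to the family,
    -- solves a linear equation with zero value at `s`; uniqueness gives a contradiction.
    obtain ⟨f, hf, hker⟩ := Submodule.exists_le_ker_of_notMem hnot
    -- The coefficients need not be bounded on the open interval; a compact subinterval containing
    -- `s` and `t` gives a uniform Lipschitz constant.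
    obtain ⟨a', ha', ha''⟩ := exists_between (lt_min hs.1 ht.1)
    obtain ⟨b', hb', hb''⟩ := exists_between (max_lt hs.2 ht.2)
    have hsub : Icc a' b' ⊆ Ioo a b := Icc_subset_Ioo ha' hb''
    have hbound : ∀ i j, ∃ B, ∀ t ∈ Icc a' b', ‖c i j t‖ ≤ B := fun i j =>
      isCompact_Icc.exists_bound_of_continuousOn ((hc i j).mono hsub)
    choose B hB using hbound
    have hB0 : ∀ i j, 0 ≤ max (B i j) 0 := fun i j => le_max_right _ _
    let v : ℝ → (ι → ℝ) → ι → ℝ := fun t u i => ∑ j, c i j t * u j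
    let K : NNReal := ⟨∑ i, ∑ j, max (B i j) 0,
      Finset.sum_nonneg fun i _ => Finset.sum_nonneg fun j _ => hB0 i j⟩
    have hlip : ∀ t ∈ Ioo a' b', LipschitzOnWith K (v t) univ := by
      intro t ht
      refine LipschitzWith.lipschitzOnWith (LipschitzWith.of_dist_le_mul fun u w => ?_)
      refine (dist_pi_le_iff (by positivity)).2 fun i => ?_
      rw [Real.dist_eq]
      have h1 : v t u i - v t w i = ∑ j, c i j t * (u j - w j) := by
        simp only [v, ← Finset.sum_sub_distrib, mul_sub]
      rw [h1]
      calc |∑ j, c i j t * (u j - w j)| ≤ ∑ j, |c i j t * (u j - w j)| :=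
            Finset.abs_sum_le_sum_abs _ _
        _ ≤ ∑ j, max (B i j) 0 * dist u w := by
            refine Finset.sum_le_sum fun j _ => ?_
            rw [abs_mul]
            refine mul_le_mul ((hB i j t (Ioo_subset_Icc_self ht)).trans (le_max_left _ _)) ?_
              (abs_nonneg _) (hB0 i j)
            rw [← Real.dist_eq]
            exact dist_le_pi_dist u w j
        _ = (∑ j, max (B i j) 0) * dist u w := (Finset.sum_mul _ _ _).symm
        _ ≤ K * dist u w := by
            refine mul_le_mul_of_nonneg_right ?_ dist_nonneg
            exact Finset.single_le_sum (f := fun i => ∑ j, max (B i j) 0)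
              (fun i _ => Finset.sum_nonneg fun j _ => hB0 i j) (Finset.mem_univ i)
    let F : E →L[ℝ] ℝ := f.toContinuousLinearMap
    have hu : ∀ t ∈ Ioo a' b', HasDerivAt (fun t i => F (e i t)) (v t fun i => F (e i t)) t ∧
        (fun i => F (e i t)) ∈ (univ : Set (ι → ℝ)) := by
      refine fun t ht => ⟨hasDerivAt_pi.2 fun i => ?_, mem_univ _⟩
      have := F.hasFDerivAt.comp_hasDerivAt t (he i t (hsub (Ioo_subset_Icc_self ht)))
      refine this.congr_deriv ?_
      simp only [v, map_sum, map_smul, smul_eq_mul]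
    have h0 : ∀ t ∈ Ioo a' b', HasDerivAt (fun _ _ => 0) (v t fun _ => 0) t ∧
        (fun _ => 0) ∈ (univ : Set (ι → ℝ)) := by
      refine fun t _ => ⟨?_, mem_univ _⟩
      have : (v t fun _ => 0) = 0 := by ext; simp [v]
      rw [this]
      exact hasDerivAt_const t _
    have hs' : s ∈ Ioo a' b' :=
      ⟨ha''.trans_le (min_le_left _ _), (le_max_left _ _).trans_lt hb'⟩
    have ht' : t ∈ Ioo a' b' :=
      ⟨ha''.trans_le (min_le_right _ _), (le_max_right _ _).trans_lt hb'⟩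
    have heq := ODE_solution_unique_of_mem_Ioo hlip hs' hu h0 (by
      ext i
      exact hker (Submodule.subset_span ⟨i, rfl⟩)) ht'
    exact hf (congrFun heq i)
  refine le_antisymm (Submodule.span_le.2 ?_) (Submodule.span_le.2 ?_)
  · rintro _ ⟨i, rfl⟩; exact main t ht s hs i
  · rintro _ ⟨i, rfl⟩; exact main s hs t ht i

end LinearODE

/-! ### Local flows in Euclidean space and the variational equation. -/

section LocalFlow

variable {E : Type} [NormedAddCommGroup E] [NormedSpace ℝ E]

/-- A smooth map on an open set coincides near each point with a globally defined smooth map. -/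
theorem ContDiffOn.exists_contDiff_eventuallyEq [FiniteDimensional ℝ E] {F : Type*}
    [NormedAddCommGroup F] [NormedSpace ℝ F] {Ω : Set E} (hΩ : IsOpen Ω) {f : E → F}
    (hf : ContDiffOn ℝ ∞ f Ω) {x₀ : E} (hx₀ : x₀ ∈ Ω) :
    ∃ g : E → F, ContDiff ℝ ∞ g ∧ g =ᶠ[nhds x₀] f := by
  obtain ⟨r, hr, hball⟩ := Metric.nhds_basis_closedBall.mem_iff.1 (hΩ.mem_nhds hx₀)
  let χ : ContDiffBump x₀ := ⟨r / 2, r, by positivity, by linarith⟩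
  refine ⟨fun x => χ x • f x, contDiff_iff_contDiffAt.2 fun x => ?_, ?_⟩
  · by_cases hx : x ∈ Ω
    · exact χ.contDiff.contDiffAt.smul (hf.contDiffAt (hΩ.mem_nhds hx))
    · have hx' : x ∈ (tsupport χ)ᶜ := by
        rw [χ.tsupport_eq]
        exact fun h => hx (hball h)
      have : (fun x => χ x • f x) =ᶠ[nhds x] fun _ => 0 := by
        filter_upwards [(isClosed_tsupport χ).isOpen_compl.mem_nhds hx'] with y hy
        rw [image_eq_zero_of_notMem_tsupport hy, zero_smul]
      exact contDiffAt_const.congr_of_eventuallyEq this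
  · filter_upwards [χ.eventuallyEq_one] with x hx
    rw [hx, Pi.one_apply, one_smul]

/-- The local flow of a smooth vector field, with its variational equation. -/
theorem ContDiffOn.exists_localFlow [FiniteDimensional ℝ E] {Ω : Set E} (hΩ : IsOpen Ω)
    {X : E → E} (hX : ContDiffOn ℝ ∞ X Ω) {x₀ : E} (hx₀ : x₀ ∈ Ω) :
    ∃ ε > 0, ∃ V : Set E, IsOpen V ∧ x₀ ∈ V ∧ ∃ Φ : ℝ × E → E,
      ContDiffOn ℝ ∞ Φ (Ioo (-ε) ε ×ˢ V) ∧ ∀ x ∈ V, Φ (0, x) = x ∧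
        ∀ t ∈ Ioo (-ε) ε, Φ (t, x) ∈ Ω ∧ HasDerivAt (fun s => Φ (s, x)) (X (Φ (t, x))) t ∧
          (fderiv ℝ (fun y => Φ (t, y)) x).IsInvertible ∧
          HasDerivAt (fun s => fderiv ℝ (fun y => Φ (s, y)) x)
            ((fderiv ℝ X (Φ (t, x))).comp (fderiv ℝ (fun y => Φ (t, y)) x)) t := by
  have : CompleteSpace E := FiniteDimensional.complete ℝ E
  -- The flow is that of a global extension `f`; the box is shrunk below so that `f` and `X` agree
  -- near every point reached.
  obtain ⟨f, hf, hfX⟩ := hX.exists_contDiff_eventuallyEq hΩ hx₀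
  obtain ⟨ε, hε, V, hV, hxV, Φ, hΦ, hflow⟩ := exists_contDiffOn_flow hf x₀
  have hopen : IsOpen (Ioo (-ε) ε ×ˢ V) := isOpen_Ioo.prod hV
  have hmem : ((0 : ℝ), x₀) ∈ Ioo (-ε) ε ×ˢ V := ⟨⟨by linarith, hε⟩, hxV⟩
  have hΦc : ContinuousAt Φ (0, x₀) := (hΦ.continuousOn).continuousAt (hopen.mem_nhds hmem)
  have hΦ0 : Φ (0, x₀) = x₀ := (hflow x₀ hxV).1
  have hslice : ∀ p ∈ Ioo (-ε) ε ×ˢ V, HasFDerivAt (fun y => Φ (p.1, y))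
      ((fderiv ℝ Φ p).comp (ContinuousLinearMap.inr ℝ ℝ E)) p.2 := by
    intro p hp
    have h1 : HasFDerivAt Φ (fderiv ℝ Φ p) (p.1, p.2) :=
      ((hΦ.contDiffAt (hopen.mem_nhds hp)).differentiableAt (by simp)).hasFDerivAt
    exact h1.comp p.2 (hasFDerivAt_prodMk_right p.1 p.2)
  have hdc : ContinuousOn (fun p => (fderiv ℝ Φ p).comp (ContinuousLinearMap.inr ℝ ℝ E))
      (Ioo (-ε) ε ×ˢ V) :=
    (hΦ.fderiv_of_isOpen hopen (m := ∞) (by simp)).continuousOn.clm_comp continuousOn_const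
  have hd0 : (fderiv ℝ Φ (0, x₀)).comp (ContinuousLinearMap.inr ℝ ℝ E) =
      ((ContinuousLinearEquiv.refl ℝ E : E ≃L[ℝ] E) : E →L[ℝ] E) := by
    refine (hslice _ hmem).unique ?_
    refine (hasFDerivAt_id x₀).congr_of_eventuallyEq ?_
    filter_upwards [hV.mem_nhds hxV] with y hy using (hflow y hy).1
  have hinv : ∀ᶠ p in nhds ((0 : ℝ), x₀),
      ((fderiv ℝ Φ p).comp (ContinuousLinearMap.inr ℝ ℝ E)).IsInvertible := by
    have h1 : ContinuousAt (fun p => (fderiv ℝ Φ p).comp (ContinuousLinearMap.inr ℝ ℝ E))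
      (0, x₀) := hdc.continuousAt (hopen.mem_nhds hmem)
    refine h1 (?_ : {f : E →L[ℝ] E | f.IsInvertible} ∈ _)
    exact (congrArg nhds hd0) ▸ ContinuousLinearEquiv.nhds _
  have hfX' : ∀ᶠ p in nhds ((0 : ℝ), x₀), f =ᶠ[nhds (Φ p)] X := by
    refine hΦc.eventually (p := fun y => f =ᶠ[nhds y] X) ?_
    rw [hΦ0]
    exact hfX.eventuallyEq_nhds
  have hΩ' : ∀ᶠ p in nhds ((0 : ℝ), x₀), Φ p ∈ Ω := by
    refine hΦc.eventually (p := fun y => y ∈ Ω) ?_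
    rw [hΦ0]
    exact hΩ.mem_nhds hx₀
  obtain ⟨δ, hδ, hbox⟩ := Metric.eventually_nhds_iff.1
    ((hopen.eventually_mem hmem).and (hinv.and (hfX'.and hΩ')))
  have hbox' : ∀ t ∈ Ioo (-δ) δ, ∀ x ∈ Metric.ball x₀ δ,
      (t, x) ∈ Ioo (-ε) ε ×ˢ V ∧
        ((fderiv ℝ Φ (t, x)).comp (ContinuousLinearMap.inr ℝ ℝ E)).IsInvertible ∧
          f =ᶠ[nhds (Φ (t, x))] X ∧ Φ (t, x) ∈ Ω := fun t ht x hx =>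
    hbox (y := (t, x)) (by
      rw [Prod.dist_eq]
      refine max_lt ?_ hx
      simpa [abs_lt] using ht)
  refine ⟨δ, hδ, Metric.ball x₀ δ, Metric.isOpen_ball, Metric.mem_ball_self hδ, Φ, ?_, ?_⟩
  · exact hΦ.mono fun p hp => (hbox' p.1 hp.1 p.2 hp.2).1
  · intro x hx
    have hxV : x ∈ V := (hbox' 0 ⟨by linarith, hδ⟩ x hx).1.2
    refine ⟨(hflow x hxV).1, fun t ht => ?_⟩
    obtain ⟨h1, h2, h3, h4⟩ := hbox' t ht x hx
    refine ⟨h4, ?_, ?_, ?_⟩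
    · rw [← h3.eq_of_nhds]
      exact (hflow x hxV).2 t h1.1
    · rw [(hslice _ h1).fderiv]; exact h2
    · have hev : (fun s => fderiv ℝ (fun y => Φ (s, y)) x) =ᶠ[nhds t]
          fun s => (fderiv ℝ Φ (s, x)).comp (ContinuousLinearMap.inr ℝ ℝ E) := by
        filter_upwards [isOpen_Ioo.mem_nhds h1.1] with s hs
        exact (hslice (s, x) ⟨hs, hxV⟩).fderiv
      have hΦt : ContDiffAt ℝ ∞ Φ (t, x) := hΦ.contDiffAt (hopen.mem_nhds h1)
      have hD : HasFDerivAt (fderiv ℝ Φ) (fderiv ℝ (fderiv ℝ Φ) (t, x)) (t, x) :=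
        ((hΦt.fderiv_right (m := ∞) (by simp)).differentiableAt (by simp)).hasFDerivAt
      have hDt : HasDerivAt (fun s => fderiv ℝ Φ (s, x))
          (fderiv ℝ (fderiv ℝ Φ) (t, x) (1, 0)) t := by
        have h5 : HasDerivAt (fun s : ℝ => (s, x)) ((1 : ℝ), (0 : E)) t :=
          (hasDerivAt_id t).prodMk (hasDerivAt_const t x)
        exact HasFDerivAt.comp_hasDerivAt (x := t) (f := fun s : ℝ => (s, x)) hD h5
      refine HasDerivAt.congr_of_eventuallyEq ?_ hev
      have h6 := hDt.clm_comp (hasDerivAt_const t (ContinuousLinearMap.inr ℝ ℝ E))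
      refine h6.congr_deriv ?_
      rw [hev.eq_of_nhds]
      ext ξ
      -- Symmetry of the second derivative exchanges the time and space derivatives of `Φ`; the
      -- variational equation is the space derivative of `∂ₜΦ = f ∘ Φ`.
      have hsymm := (hΦt.isSymmSndFDerivAt
        (by rw [minSmoothness_of_isRCLikeNormedField]; exact WithTop.coe_le_coe.2 (le_top (a := (2 : ℕ∞))))).eq (1, (0 : E)) (0, ξ)
      have h7 : HasFDerivAt (fun p => fderiv ℝ Φ p (1, (0 : E)))
          ((fderiv ℝ (fderiv ℝ Φ) (t, x)).flip (1, (0 : E))) (t, x) := by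
        have := hD.clm_apply (hasFDerivAt_const (1, (0 : E)) (t, x))
        simpa using this
      have h8 : HasFDerivAt (fun p => f (Φ p)) ((fderiv ℝ f (Φ (t, x))).comp
          (fderiv ℝ Φ (t, x))) (t, x) :=
        ((hf.differentiable (by simp)) _).hasFDerivAt.comp (t, x)
          (hΦt.differentiableAt (by simp)).hasFDerivAt
      have h9 : (fun p => fderiv ℝ Φ p (1, (0 : E))) =ᶠ[nhds (t, x)] fun p => f (Φ p) := by
        filter_upwards [hopen.mem_nhds h1] with p hp
        have h10 : HasDerivAt (fun s : ℝ => (s, p.2)) ((1 : ℝ), (0 : E)) p.1 :=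
          (hasDerivAt_id p.1).prodMk (hasDerivAt_const p.1 p.2)
        have h11 : HasFDerivAt Φ (fderiv ℝ Φ p) (p.1, p.2) :=
          ((hΦ.contDiffAt (hopen.mem_nhds hp)).differentiableAt (by simp)).hasFDerivAt
        exact (HasFDerivAt.comp_hasDerivAt (x := p.1) (f := fun s : ℝ => (s, p.2)) h11 h10).unique
          ((hflow p.2 hp.2).2 p.1 hp.1)
      have h12 := (h8.congr_of_eventuallyEq h9).unique h7
      have h13 := DFunLike.congr_fun h12 (0, ξ)
      have h14 : fderiv ℝ f (Φ (t, x)) = fderiv ℝ X (Φ (t, x)) := h3.fderiv_eq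
      rw [h14] at h13
      simp only [ContinuousLinearMap.comp_apply, ContinuousLinearMap.inr_apply,
        ContinuousLinearMap.flip_apply, add_apply, zero_apply, ContinuousLinearMap.comp_zero] at h13 ⊢
      rw [h13, ← hsymm]
      simp

end LocalFlow

/-! ### Distributions preserved by a linearized flow. -/

section FlowInvariance

variable {E : Type} [NormedAddCommGroup E] [NormedSpace ℝ E]

/-- `D` is invariant under the linearized flow of the vector field `X` on `Ω`: for every solution
`J` of the variational equation along an integral curve `c`, the pull-back of `D` by `J` is
constant. -/
def IsFlowInvariant (X : E → E) (Ω : Set E) (D : E → Submodule ℝ E) : Prop :=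
  ∀ (a b : ℝ) (c : ℝ → E) (J : ℝ → E →L[ℝ] E),
    (∀ t ∈ Ioo a b, c t ∈ Ω ∧ HasDerivAt c (X (c t)) t ∧ (J t).IsInvertible ∧
      HasDerivAt J ((fderiv ℝ X (c t)).comp (J t)) t) →
    ∀ s ∈ Ioo a b, ∀ t ∈ Ioo a b, (D (c s)).comap (J s : E →ₗ[ℝ] E) = (D (c t)).comap (J t : E →ₗ[ℝ] E)

theorem ContinuousLinearMap.IsInvertible.hasDerivAt_inverse [CompleteSpace E] {J : ℝ → E →L[ℝ] E}
    {J' : E →L[ℝ] E} {t : ℝ} (hJ : (J t).IsInvertible) (h : HasDerivAt J J' t) :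
    HasDerivAt (fun s => (J s).inverse) (-((J t).inverse.comp (J'.comp (J t).inverse))) t := by
  obtain ⟨e, he⟩ := hJ
  have h1 := hasFDerivAt_ringInverse (𝕜 := ℝ) (ContinuousLinearEquiv.toUnit e)
  have h2 : ((ContinuousLinearEquiv.toUnit e : (E →L[ℝ] E)ˣ) : E →L[ℝ] E) = J t := he
  rw [h2] at h1
  have h3 := h1.comp_hasDerivAt t h
  rw [ContinuousLinearMap.ringInverse_eq_inverse] at h3
  refine h3.congr_deriv ?_
  have h4 : (((ContinuousLinearEquiv.toUnit e)⁻¹ : (E →L[ℝ] E)ˣ) : E →L[ℝ] E) = (J t).inverse := by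
    rw [← he, ContinuousLinearMap.inverse_equiv]
    rfl
  rw [h4]
  ext v
  simp [ContinuousLinearMap.mul_def]

/-- A distribution is invariant under the linearized flow of `X` if along each integral curve it is
locally spanned by finitely many vector fields whose brackets with `X` are continuous combinations
of these fields. -/
theorem isFlowInvariant_of_lieBracket [FiniteDimensional ℝ E] {X : E → E} {Ω : Set E}
    {D : E → Submodule ℝ E}
    (h : ∀ (a b : ℝ) (c : ℝ → E), (∀ t ∈ Ioo a b, c t ∈ Ω ∧ HasDerivAt c (X (c t)) t) →
      ∀ t₀ ∈ Ioo a b, ∃ (r : ℕ) (Y : Fin r → E → E) (C : Fin r → Fin r → ℝ → ℝ),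
        ∀ᶠ t in nhds t₀, (∀ i j, ContinuousAt (C i j) t) ∧
          D (c t) = Submodule.span ℝ (range fun i => Y i (c t)) ∧
          ∀ i, DifferentiableAt ℝ (Y i) (c t) ∧
            VectorField.lieBracket ℝ X (Y i) (c t) = ∑ j, C i j t • Y j (c t)) :
    IsFlowInvariant X Ω D := by
  have : CompleteSpace E := FiniteDimensional.complete ℝ E
  intro a b c J hc s hs t ht
  -- The hypothesis is local in time, so local constancy of the pulled-back subspace is proved and
  -- then propagated over the interval.
  refine isPreconnected_Ioo.induction₂ (fun s t => (D (c s)).comap (J s : E →ₗ[ℝ] E) = (D (c t)).comap (J t : E →ₗ[ℝ] E))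
    (fun t₀ ht₀ => ?_) (fun _ _ _ _ _ _ h h' => h.trans h') (fun _ _ _ _ h => h.symm) hs ht
  apply Filter.Eventually.filter_mono nhdsWithin_le_nhds
  obtain ⟨r, Y, C, hev⟩ := h a b c (fun t ht => ⟨(hc t ht).1, (hc t ht).2.1⟩) t₀ ht₀
  obtain ⟨δ, hδ, hball⟩ := Metric.eventually_nhds_iff_ball.1 (hev.and (isOpen_Ioo.eventually_mem ht₀))
  rw [Real.ball_eq_Ioo] at hball
  have hcomap : ∀ t ∈ Ioo (t₀ - δ) (t₀ + δ), (D (c t)).comap (J t : E →ₗ[ℝ] E) =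
      Submodule.span ℝ (range fun i => (J t).inverse (Y i (c t))) := by
    intro t ht
    obtain ⟨⟨-, hD, -⟩, hI⟩ := hball t ht
    have hJ := (hc t hI).2.2.1
    have : (range fun i => (J t).inverse (Y i (c t))) =
        (J t).inverse.toLinearMap '' range fun i => Y i (c t) := by
      rw [← range_comp]; rfl
    rw [this, Submodule.span_image, ← hD]
    ext v
    simp only [Submodule.mem_comap, Submodule.mem_map]
    constructor
    · intro hv
      exact ⟨J t v, hv, hJ.inverse_apply_self v⟩
    · rintro ⟨w, hw, rfl⟩
      change J t ((J t).inverse w) ∈ _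
      rw [hJ.self_apply_inverse]
      exact hw
  have ht₀' : t₀ ∈ Ioo (t₀ - δ) (t₀ + δ) := ⟨by linarith, by linarith⟩
  filter_upwards [isOpen_Ioo.mem_nhds ht₀'] with t ht
  rw [hcomap t ht, hcomap t₀ ht₀']
  refine span_range_eq_of_hasDerivAt (e := fun i t => (J t).inverse (Y i (c t))) (c := C)
    (fun i j t ht => ((hball t ht).1.1 i j).continuousWithinAt) (fun i t ht => ?_) ht₀' ht
  obtain ⟨⟨-, -, hY⟩, hI⟩ := hball t ht
  obtain ⟨hcΩ, hc', hJ, hJ'⟩ := hc t hI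
  -- The derivative of `J⁻¹ Y i` is `J⁻¹ (DY i · X - DX · Y i)`, that is `J⁻¹` of the bracket of `X`
  -- and `Y i`; by hypothesis it is a combination of the `J⁻¹ Y j`.
  have h1 := (hJ.hasDerivAt_inverse hJ').clm_apply
    ((hY i).1.hasFDerivAt.comp_hasDerivAt t hc')
  refine h1.congr_deriv ?_
  have h2 := (hY i).2
  rw [VectorField.lieBracket] at h2
  have h3 : ∑ j, C i j t • (J t).inverse (Y j (c t)) =
      (J t).inverse (∑ j, C i j t • Y j (c t)) := by simp
  rw [h3, ← h2]
  have h4 : (J t).comp (J t).inverse = ContinuousLinearMap.id ℝ E := hJ.self_comp_inverse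
  have h5 : ∀ v, (J t) ((J t).inverse v) = v := hJ.self_apply_inverse
  simp [h5]
  abel

end FlowInvariance

/-! ### Adapted coordinates obtained by composing flows. -/

section FlatChart

variable {E : Type} [NormedAddCommGroup E] [NormedSpace ℝ E] [FiniteDimensional ℝ E]

/-- The local flow of a vector field that leaves the distribution `D` invariant. -/
theorem IsFlowInvariant.exists_localFlow {Ω : Set E} (hΩ : IsOpen Ω) {X : E → E}
    (hX : ContDiffOn ℝ ∞ X Ω) {D : E → Submodule ℝ E} (hD : IsFlowInvariant X Ω D)
    {x₀ : E} (hx₀ : x₀ ∈ Ω) :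
    ∃ ε > 0, ∃ V : Set E, IsOpen V ∧ x₀ ∈ V ∧ ∃ Φ : ℝ × E → E,
      ContDiffOn ℝ ∞ Φ (Ioo (-ε) ε ×ˢ V) ∧ ∀ x ∈ V, Φ (0, x) = x ∧
        ∀ t ∈ Ioo (-ε) ε, Φ (t, x) ∈ Ω ∧ HasDerivAt (fun s => Φ (s, x)) (X (Φ (t, x))) t ∧
          ∃ B : E →L[ℝ] E, B.IsInvertible ∧ (t = 0 → B = ContinuousLinearMap.id ℝ E) ∧
            (∀ σ v, fderiv ℝ Φ (t, x) (σ, v) = σ • X (Φ (t, x)) + B v) ∧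
            ∀ v, B v ∈ D (Φ (t, x)) ↔ v ∈ D x := by
  obtain ⟨ε, hε, V, hV, hxV, Φ, hΦ, hflow⟩ := hX.exists_localFlow hΩ hx₀
  have hopen : IsOpen (Ioo (-ε) ε ×ˢ V) := isOpen_Ioo.prod hV
  have h0 : (0 : ℝ) ∈ Ioo (-ε) ε := ⟨by linarith, hε⟩
  refine ⟨ε, hε, V, hV, hxV, Φ, hΦ, fun x hx => ⟨(hflow x hx).1, fun t ht => ?_⟩⟩
  obtain ⟨h1, h2, h3, -⟩ := (hflow x hx).2 t ht
  have hid : fderiv ℝ (fun y => Φ (0, y)) x = ContinuousLinearMap.id ℝ E := by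
    refine HasFDerivAt.fderiv ((hasFDerivAt_id x).congr_of_eventuallyEq ?_)
    filter_upwards [hV.mem_nhds hx] with y hy using (hflow y hy).1
  refine ⟨h1, h2, fderiv ℝ (fun y => Φ (t, y)) x, h3, ?_, fun σ v => ?_, fun v => ?_⟩
  · rintro rfl
    exact hid
  · have hd : HasFDerivAt Φ (fderiv ℝ Φ (t, x)) (t, x) :=
      ((hΦ.contDiffAt (hopen.mem_nhds ⟨ht, hx⟩)).differentiableAt (by simp)).hasFDerivAt
    have h4 : HasFDerivAt (fun y => Φ (t, y))
        ((fderiv ℝ Φ (t, x)).comp (ContinuousLinearMap.inr ℝ ℝ E)) x :=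
      hd.comp x (hasFDerivAt_prodMk_right t x)
    have h5 : HasDerivAt (fun s : ℝ => (s, x)) ((1 : ℝ), (0 : E)) t :=
      (hasDerivAt_id t).prodMk (hasDerivAt_const t x)
    have h6 := (HasFDerivAt.comp_hasDerivAt (x := t) (f := fun s : ℝ => (s, x)) hd h5).unique h2
    have h7 : ((σ, v) : ℝ × E) = σ • ((1 : ℝ), (0 : E)) + (0, v) := by simp
    rw [h4.fderiv, h7, map_add, map_smul, h6]
    simp
  · have := hD (-ε) ε (fun s => Φ (s, x)) (fun s => fderiv ℝ (fun y => Φ (s, y)) x)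
      (fun s hs => (hflow x hx).2 s hs) t ht 0 h0
    have h4 := SetLike.ext_iff.1 this v
    rw [hid] at h4
    simpa [(hflow x hx).1] using h4

/-- The composition of the flows of the vector fields in a list. -/
theorem exists_composite_flow {T : Type} [NormedAddCommGroup T] [NormedSpace ℝ T]
    {ι : Type} {Ω : Set E} (hΩ : IsOpen Ω)
    {D : E → Submodule ℝ E} {X : ι → E → E} (τ : ι → T →L[ℝ] ℝ)
    (hX : ∀ i, ContDiffOn ℝ ∞ (X i) Ω)
    (hD : ∀ i, IsFlowInvariant (X i) Ω D) (hmem : ∀ i, ∀ x ∈ Ω, X i x ∈ D x)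
    {R : E → E → Prop} (hrefl : ∀ x, R x x) (htrans : ∀ x y z, R x y → R y z → R x z)
    (hR : ∀ i (a b : ℝ) (c : ℝ → E), (∀ t ∈ Ioo a b, c t ∈ Ω ∧ HasDerivAt c (X i (c t)) t) →
      ∀ s ∈ Ioo a b, ∀ t ∈ Ioo a b, R (c s) (c t))
    {x₀ : E} (hx₀ : x₀ ∈ Ω) (l : List ι) :
    ∃ W : Set (T × E), IsOpen W ∧ (0, x₀) ∈ W ∧ ∃ Ψ : T × E → E, ContDiffOn ℝ ∞ Ψ W ∧
      Ψ (0, x₀) = x₀ ∧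
      (∀ p ∈ W, Ψ p ∈ Ω ∧ R p.2 (Ψ p) ∧ ∀ u v, fderiv ℝ Ψ p (u, v) ∈ D (Ψ p) ↔ v ∈ D p.2) ∧
      ∀ u v, fderiv ℝ Ψ (0, x₀) (u, v) = (l.map fun i => τ i u • X i x₀).sum + v := by
  induction l with
  | nil =>
    refine ⟨univ ×ˢ Ω, isOpen_univ.prod hΩ, ⟨mem_univ _, hx₀⟩, Prod.snd,
      contDiff_snd.contDiffOn, rfl, fun p hp => ⟨hp.2, hrefl _, fun u v => ?_⟩, fun u v => ?_⟩
    · rw [fderiv_snd]; rfl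
    · rw [fderiv_snd]; simp
  | cons i l ih =>
    obtain ⟨W, hW, h0W, Ψ, hΨ, hΨ0, hΨW, hΨd⟩ := ih
    obtain ⟨ε, hε, V, hV, hxV, Φ, hΦ, hflow⟩ := (hD i).exists_localFlow hΩ (hX i) hx₀
    have hopen : IsOpen (Ioo (-ε) ε ×ˢ V) := isOpen_Ioo.prod hV
    have h0 : (0 : ℝ) ∈ Ioo (-ε) ε := ⟨by linarith, hε⟩
    -- The flow of `X i` is applied after the previous ones, for the time `τ i u`.
    let g : T × E → ℝ × E := fun p => (τ i p.1, Ψ p)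
    have hg : ContDiffOn ℝ ∞ g W :=
      (ContDiff.contDiffOn ((τ i).contDiff.comp contDiff_fst)).prodMk hΨ
    have hW' : IsOpen (W ∩ g ⁻¹' (Ioo (-ε) ε ×ˢ V)) := hg.continuousOn.isOpen_inter_preimage hW hopen
    have hg0 : g (0, x₀) = (0, x₀) := by simp [g, hΨ0]
    have hderiv : ∀ p ∈ W ∩ g ⁻¹' (Ioo (-ε) ε ×ˢ V), ∀ u v,
        fderiv ℝ (Φ ∘ g) p (u, v) = fderiv ℝ Φ (g p) (τ i u, fderiv ℝ Ψ p (u, v)) := by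
      intro p hp u v
      have h1 : HasFDerivAt Φ (fderiv ℝ Φ (g p)) (g p) :=
        ((hΦ.contDiffAt (hopen.mem_nhds hp.2)).differentiableAt (by simp)).hasFDerivAt
      have h2 : HasFDerivAt Ψ (fderiv ℝ Ψ p) p :=
        ((hΨ.contDiffAt (hW.mem_nhds hp.1)).differentiableAt (by simp)).hasFDerivAt
      have h3 : HasFDerivAt g (((τ i).comp (ContinuousLinearMap.fst ℝ T E)).prod
          (fderiv ℝ Ψ p)) p :=
        ((τ i).hasFDerivAt.comp p hasFDerivAt_fst).prodMk h2
      rw [(h1.comp p h3).fderiv]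
      rfl
    refine ⟨_, hW', ⟨h0W, ?_⟩, Φ ∘ g, hΦ.comp (hg.mono inter_subset_left) fun p hp => hp.2,
      ?_, fun p hp => ?_, fun u v => ?_⟩
    · rw [mem_preimage, hg0]; exact ⟨h0, hxV⟩
    · rw [Function.comp_apply, hg0]; exact (hflow x₀ hxV).1
    · obtain ⟨h1, h2, h3⟩ := hΨW p hp.1
      obtain ⟨h4, h5⟩ := hflow (Ψ p) hp.2.2
      obtain ⟨h6, h7, B, hB, -, hBd, hBD⟩ := h5 (τ i p.1) hp.2.1
      refine ⟨h6, ?_, fun u v => ?_⟩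
      · refine htrans _ _ _ h2 ?_
        have := hR i (-ε) ε (fun s => Φ (s, Ψ p)) (fun s hs => ⟨(h5 s hs).1, (h5 s hs).2.1⟩)
          0 h0 (τ i p.1) hp.2.1
        simp only [h4] at this
        exact this
      · rw [hderiv p hp, ← h3 u v, ← hBD]
        refine (iff_of_eq (congrArg (· ∈ _) (hBd _ _))).trans ?_
        -- The time derivative contributes a multiple of `X i`, which lies in `D` and does not
        -- affect membership.
        exact (D _).add_mem_iff_right ((D _).smul_mem _ (hmem i _ h6))
    · rw [hderiv _ ⟨h0W, by rw [mem_preimage, hg0]; exact ⟨h0, hxV⟩⟩, hg0]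
      obtain ⟨h4, h5⟩ := hflow x₀ hxV
      obtain ⟨-, -, B, -, hB, hBd, -⟩ := h5 0 h0
      rw [hBd, hB rfl, h4, hΨd]
      simp [add_assoc]

/-- **Coordinates adapted to a flow-invariant distribution.** -/
theorem exists_flat_chart {k : ℕ} {Ω : Set E} (hΩ : IsOpen Ω)
    {D : E → Submodule ℝ E} {X : Fin k → E → E} (hX : ∀ i, ContDiffOn ℝ ∞ (X i) Ω)
    (hD : ∀ i, IsFlowInvariant (X i) Ω D) (hmem : ∀ i, ∀ x ∈ Ω, X i x ∈ D x)
    {R : E → E → Prop} (hrefl : ∀ x, R x x) (htrans : ∀ x y z, R x y → R y z → R x z)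
    (hR : ∀ i (a b : ℝ) (c : ℝ → E), (∀ t ∈ Ioo a b, c t ∈ Ω ∧ HasDerivAt c (X i (c t)) t) →
      ∀ s ∈ Ioo a b, ∀ t ∈ Ioo a b, R (c s) (c t))
    {x₀ : E} (hx₀ : x₀ ∈ Ω) (hspan : Submodule.span ℝ (range fun i => X i x₀) = D x₀)
    (hli : LinearIndependent ℝ fun i => X i x₀) {K : Submodule ℝ E} (hK : IsCompl (D x₀) K) :
    ∃ e : OpenPartialHomeomorph (EuclideanSpace ℝ (Fin k) × K) E,
      (0, 0) ∈ e.source ∧ e (0, 0) = x₀ ∧ e.target ⊆ Ω ∧ ContDiffOn ℝ ∞ e e.source ∧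
      ContDiffOn ℝ ∞ e.symm e.target ∧ (∀ p ∈ e.source, ∀ u, fderiv ℝ e p (u, 0) ∈ D (e p)) ∧
      ∀ u, (u, 0) ∈ e.source → R x₀ (e (u, 0)) := by
  let T := EuclideanSpace ℝ (Fin k)
  have : CompleteSpace E := FiniteDimensional.complete ℝ E
  have : CompleteSpace K := FiniteDimensional.complete ℝ K
  let τ : Fin k → T →L[ℝ] ℝ := fun i => EuclideanSpace.proj i
  obtain ⟨W, hW, h0W, Ψ, hΨ, hΨ0, hΨW, hΨd⟩ :=
    exists_composite_flow hΩ τ hX hD hmem hrefl htrans hR hx₀ (List.finRange k)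
  -- Starting points are restricted to the transversal `x₀ + K`. The derivative at the origin is
  -- then `(u, v) ↦ ∑ u i • X i x₀ + v`, bijective because the `X i x₀` form a basis of `D x₀` and
  -- `K` is a complement.
  let g : T × K → T × E := fun p => (p.1, x₀ + p.2)
  have hg : ContDiff ℝ ∞ g :=
    contDiff_fst.prodMk (contDiff_const.add (K.subtypeL.contDiff.comp contDiff_snd))
  have hg0 : g (0, 0) = (0, x₀) := by simp [g]
  have hW' : IsOpen (g ⁻¹' W) := hW.preimage hg.continuous
  have h0W' : (0, 0) ∈ g ⁻¹' W := by rw [mem_preimage, hg0]; exact h0W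
  have hderiv : ∀ p ∈ g ⁻¹' W, ∀ u v, HasFDerivAt (Ψ ∘ g) (fderiv ℝ (Ψ ∘ g) p) p ∧
      fderiv ℝ (Ψ ∘ g) p (u, v) = fderiv ℝ Ψ (g p) (u, (v : E)) := by
    intro p hp u v
    have h1 : HasFDerivAt Ψ (fderiv ℝ Ψ (g p)) (g p) :=
      ((hΨ.contDiffAt (hW.mem_nhds hp)).differentiableAt (by simp)).hasFDerivAt
    have h3 : HasFDerivAt g ((ContinuousLinearMap.fst ℝ T K).prod
        (K.subtypeL.comp (ContinuousLinearMap.snd ℝ T K))) p :=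
      hasFDerivAt_fst.prodMk ((K.subtypeL.hasFDerivAt.comp p hasFDerivAt_snd).const_add x₀)
    have h4 := h1.comp p h3
    rw [h4.fderiv]
    exact ⟨h4, rfl⟩
  have hform : ∀ u : T, ∀ v : K, fderiv ℝ (Ψ ∘ g) (0, 0) (u, v) = ∑ i, u i • X i x₀ + (v : E) := by
    intro u v
    rw [(hderiv _ h0W' u v).2, hg0, hΨd, ← List.ofFn_eq_map, List.sum_ofFn]
    rfl
  have hsum : ∀ u : T, ∑ i, u i • X i x₀ ∈ D x₀ := fun u =>
    (D x₀).sum_mem fun i _ => (D x₀).smul_mem _ (hmem i x₀ hx₀)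
  have hinj : Function.Injective (fderiv ℝ (Ψ ∘ g) (0, 0)) := by
    rw [injective_iff_map_eq_zero]
    rintro ⟨u, v⟩ huv
    rw [hform] at huv
    have h1 : (v : E) ∈ D x₀ := by
      rw [← neg_eq_of_add_eq_zero_right huv]
      exact (D x₀).neg_mem (hsum u)
    have h2 : (v : E) = 0 := (Submodule.disjoint_def.1 hK.disjoint) _ h1 v.2
    rw [h2, add_zero] at huv
    have h3 := Fintype.linearIndependent_iff.1 hli _ huv
    ext i
    · exact h3 i
    · exact h2
  have hsurj : Function.Surjective (fderiv ℝ (Ψ ∘ g) (0, 0)) := by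
    intro w
    have hw : w ∈ D x₀ ⊔ K := by rw [hK.sup_eq_top]; trivial
    obtain ⟨y, hy, z, hz, rfl⟩ := Submodule.mem_sup.1 hw
    rw [← hspan, Submodule.mem_span_range_iff_exists_fun] at hy
    obtain ⟨u, rfl⟩ := hy
    exact ⟨(WithLp.toLp 2 u, ⟨z, hz⟩), hform _ _⟩
  let L : (T × K) ≃L[ℝ] E :=
    (LinearEquiv.ofBijective (fderiv ℝ (Ψ ∘ g) (0, 0) : (T × K) →ₗ[ℝ] E)
      ⟨hinj, hsurj⟩).toContinuousLinearEquiv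
  have hL : HasFDerivAt (Ψ ∘ g) (L : (T × K) →L[ℝ] E) (0, 0) := by
    have : (L : (T × K) →L[ℝ] E) = fderiv ℝ (Ψ ∘ g) (0, 0) := by ext <;> rfl
    rw [this]
    exact (hderiv _ h0W' 0 0).1
  have hsm : ContDiffOn ℝ ∞ (Ψ ∘ g) (g ⁻¹' W) := hΨ.comp hg.contDiffOn fun p hp => hp
  obtain ⟨e, h0e, heW, heq, hsymm⟩ := hsm.exists_openPartialHomeomorph hW' h0W' L hL
  refine ⟨e, h0e, ?_, fun y hy => ?_, ?_, hsymm, fun p hp u => ?_, fun u hu => ?_⟩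
  · rw [heq, Function.comp_apply, hg0, hΨ0]
  · rw [← e.right_inv hy, heq]
    exact (hΨW _ (heW (e.map_target hy))).1
  · rw [heq]; exact hsm.mono heW
  · rw [heq, (hderiv p (heW hp) u 0).2]
    exact ((hΨW _ (heW hp)).2.2 u _).2 (D _).zero_mem
  · rw [heq]
    have := (hΨW _ (heW hu)).2.1
    simpa [g] using this

end FlatChart

/-! ### Vector fields and distributions in charts. -/

section LocalRepresentatives

variable {n : ℕ} {M : Type*} [TopologicalSpace M] [ChartedSpace (EuclideanSpace ℝ (Fin n)) M]

/-- The representative of a vector field in the chart at `z₀`. -/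
noncomputable def localVec (z₀ : M) (X : (z : M) → TangentSpace (𝓡 n) z)
    (x : EuclideanSpace ℝ (Fin n)) : EuclideanSpace ℝ (Fin n) :=
  mfderiv (𝓡 n) 𝓘(ℝ, EuclideanSpace ℝ (Fin n)) (extChartAt (𝓡 n) z₀)
    ((extChartAt (𝓡 n) z₀).symm x) (X ((extChartAt (𝓡 n) z₀).symm x))

/-- The representative of a distribution in the chart at `z₀`. -/
noncomputable def localDist (z₀ : M) (D : (z : M) → Submodule ℝ (TangentSpace (𝓡 n) z))
    (x : EuclideanSpace ℝ (Fin n)) : Submodule ℝ (EuclideanSpace ℝ (Fin n)) :=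
  (D ((extChartAt (𝓡 n) z₀).symm x)).map
    (mfderiv (𝓡 n) 𝓘(ℝ, EuclideanSpace ℝ (Fin n)) (extChartAt (𝓡 n) z₀)
      ((extChartAt (𝓡 n) z₀).symm x)).toLinearMap

variable [IsManifold (𝓡 n) ∞ M]

theorem hasMFDerivAt_extChartAt_symm {z₀ : M} {x : EuclideanSpace ℝ (Fin n)}
    (hx : x ∈ (extChartAt (𝓡 n) z₀).target) :
    HasMFDerivAt 𝓘(ℝ, EuclideanSpace ℝ (Fin n)) (𝓡 n) (extChartAt (𝓡 n) z₀).symm x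
      (mfderiv (𝓡 n) 𝓘(ℝ, EuclideanSpace ℝ (Fin n)) (extChartAt (𝓡 n) z₀)
        ((extChartAt (𝓡 n) z₀).symm x)).inverse := by
  have hsrc := (extChartAt (𝓡 n) z₀).map_target hx
  have h1 : MDifferentiableAt 𝓘(ℝ, EuclideanSpace ℝ (Fin n)) (𝓡 n)
      (extChartAt (𝓡 n) z₀).symm x :=
    ((contMDiffOn_extChartAt_symm (n := ∞) z₀).contMDiffAt
      ((isOpen_extChartAt_target z₀).mem_nhds hx)).mdifferentiableAt (by simp)
  have h2 := mfderivWithin_extChartAt_symm_comp_mfderiv_extChartAt (I := 𝓡 n) hx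
  have h3 := mfderiv_extChartAt_comp_mfderivWithin_extChartAt_symm (I := 𝓡 n) hx
  rw [(𝓡 n).range_eq_univ, mfderivWithin_univ] at h2 h3
  have h4 := ContinuousLinearMap.inverse_eq h3 h2
  exact h1.hasMFDerivAt.congr_mfderiv h4.symm

/-- On the fibres, the trivialization of the tangent bundle at `z₀` is the derivative of the chart,
so `localVec` is the section read in that trivialization. -/
theorem contDiffAt_localVec {z₀ : M} {X : (z : M) → TangentSpace (𝓡 n) z}
    {x : EuclideanSpace ℝ (Fin n)} (hx : x ∈ (extChartAt (𝓡 n) z₀).target)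
    (hX : ContMDiffAt (𝓡 n) (𝓡 n).tangent ∞ (fun z => (⟨z, X z⟩ : TangentBundle (𝓡 n) M))
      ((extChartAt (𝓡 n) z₀).symm x)) :
    ContDiffAt ℝ ∞ (localVec z₀ X) x := by
  have hsrc := (extChartAt (𝓡 n) z₀).map_target hx
  have hsrc' : (extChartAt (𝓡 n) z₀).symm x ∈
      (chartAt (EuclideanSpace ℝ (Fin n)) z₀).source := by rwa [← extChartAt_source (𝓡 n)]
  have h1 := (Bundle.Trivialization.contMDiffAt_section_iff (IB := 𝓡 n) (n := ∞) (s := X)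
    (e := trivializationAt (EuclideanSpace ℝ (Fin n)) (TangentSpace (𝓡 n)) z₀)
    (x₀ := (extChartAt (𝓡 n) z₀).symm x) (by simpa using hsrc')).1 hX
  rw [← contMDiffAt_iff_contDiffAt]
  have h2 := h1.comp x ((contMDiffOn_extChartAt_symm (n := ∞) z₀).contMDiffAt
      ((isOpen_extChartAt_target z₀).mem_nhds hx))
  refine h2.congr_of_eventuallyEq ?_
  filter_upwards [(isOpen_extChartAt_target z₀).mem_nhds hx] with y hy
  have hy' : (extChartAt (𝓡 n) z₀).symm y ∈
      (chartAt (EuclideanSpace ℝ (Fin n)) z₀).source := by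
    rw [← extChartAt_source (𝓡 n)]; exact (extChartAt (𝓡 n) z₀).map_target hy
  have h3 := TangentBundle.continuousLinearMapAt_trivializationAt (I := 𝓡 n) (M := M) hy'
  have h4 := DFunLike.congr_fun h3 (X ((extChartAt (𝓡 n) z₀).symm y))
  refine h4.symm.trans ?_
  rw [Bundle.Trivialization.continuousLinearMapAt_apply, Bundle.Trivialization.coe_linearMapAt_of_mem _
    (by simpa using hy')]
  rfl

theorem hasMFDerivAt_extChartAt_symm_comp {z₀ : M} {X : (z : M) → TangentSpace (𝓡 n) z}
    {c : ℝ → EuclideanSpace ℝ (Fin n)} {t : ℝ} (hc : HasDerivAt c (localVec z₀ X (c t)) t)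
    (ht : c t ∈ (extChartAt (𝓡 n) z₀).target) :
    HasMFDerivAt 𝓘(ℝ, ℝ) (𝓡 n) (fun s => (extChartAt (𝓡 n) z₀).symm (c s)) t
      ((1 : ℝ →L[ℝ] ℝ).smulRight (X ((extChartAt (𝓡 n) z₀).symm (c t)))) := by
  have h2 := (hasMFDerivAt_extChartAt_symm ht).comp t hc.hasFDerivAt.hasMFDerivAt
  refine h2.congr_mfderiv ?_
  have hsrc := (extChartAt (𝓡 n) z₀).map_target ht
  ext
  change (mfderiv (𝓡 n) 𝓘(ℝ, EuclideanSpace ℝ (Fin n)) (extChartAt (𝓡 n) z₀)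
        ((extChartAt (𝓡 n) z₀).symm (c t))).inverse ((1 : ℝ) • localVec z₀ X (c t)) =
        (1 : ℝ) • X ((extChartAt (𝓡 n) z₀).symm (c t))
  rw [one_smul, one_smul]
  exact (isInvertible_mfderiv_extChartAt hsrc).inverse_apply_self _

end LocalRepresentatives

/-! ### Integral curves of local vector fields and uniqueness of flows. -/

section Flows

variable {n : ℕ} {M : Type*} [TopologicalSpace M] [ChartedSpace (EuclideanSpace ℝ (Fin n)) M]
  [IsManifold (𝓡 n) ∞ M]

/-- The domain of a local vector field, seen in the chart at `z₀`. -/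
def LocalVectorField.chartDom (X : LocalVectorField n M) (z₀ : M) :
    Set (EuclideanSpace ℝ (Fin n)) :=
  (extChartAt (𝓡 n) z₀).target ∩ (extChartAt (𝓡 n) z₀).symm ⁻¹' X.dom

theorem LocalVectorField.isOpen_chartDom (X : LocalVectorField n M) (z₀ : M) :
    IsOpen (X.chartDom z₀) :=
  (continuousOn_extChartAt_symm z₀).isOpen_inter_preimage (isOpen_extChartAt_target z₀)
    X.isOpen_dom

theorem LocalVectorField.contDiffOn_localVec (X : LocalVectorField n M) (z₀ : M) :
    ContDiffOn ℝ ∞ (localVec z₀ X.vec) (X.chartDom z₀) := fun _ hx =>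
  (contDiffAt_localVec hx.1 (X.smooth.contMDiffAt
    (X.isOpen_dom.mem_nhds hx.2))).contDiffWithinAt

theorem LocalVectorField.mem_chartDom (X : LocalVectorField n M) {z₀ z : M} (hz : z ∈ X.dom)
    (hz' : z ∈ (extChartAt (𝓡 n) z₀).source) : extChartAt (𝓡 n) z₀ z ∈ X.chartDom z₀ :=
  ⟨(extChartAt (𝓡 n) z₀).map_source hz', by
    rw [mem_preimage, (extChartAt (𝓡 n) z₀).left_inv hz']; exact hz⟩

/-- `γ` is an integral curve of `X` in the domain of `X`, on the interval `(a, b)`. -/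
def LocalVectorField.IsCurveOn (X : LocalVectorField n M) (γ : ℝ → M) (a b : ℝ) : Prop :=
  ∀ t ∈ Ioo a b, γ t ∈ X.dom ∧
    HasMFDerivAt 𝓘(ℝ, ℝ) (𝓡 n) γ t ((1 : ℝ →L[ℝ] ℝ).smulRight (X.vec (γ t)))

theorem LocalVectorField.isCurveOn_iff (X : LocalVectorField n M) (γ : ℝ → M) (a b : ℝ) :
    X.IsCurveOn γ a b ↔ IsMIntegralCurveOn γ X.vec (Ioo a b) ∧ MapsTo γ (Ioo a b) X.dom := by
  constructor
  · intro h
    exact ⟨fun t ht => (h t ht).2.hasMFDerivWithinAt, fun t ht => (h t ht).1⟩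
  · rintro ⟨h, h'⟩ t ht
    exact ⟨h' ht, (h t ht).hasMFDerivAt (isOpen_Ioo.mem_nhds ht)⟩

theorem LocalVectorField.IsCurveOn.mono {X : LocalVectorField n M} {γ : ℝ → M} {a b a' b' : ℝ}
    (h : X.IsCurveOn γ a b) (ha : a ≤ a') (hb : b' ≤ b) : X.IsCurveOn γ a' b' :=
  fun t ht => h t ⟨ha.trans_lt ht.1, ht.2.trans_le hb⟩

theorem LocalVectorField.IsCurveOn.continuousAt {X : LocalVectorField n M} {γ : ℝ → M} {a b : ℝ}
    (h : X.IsCurveOn γ a b) {t : ℝ} (ht : t ∈ Ioo a b) : ContinuousAt γ t :=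
  (h t ht).2.continuousAt

theorem LocalVectorField.IsCurveOn.comp_add {X : LocalVectorField n M} {γ : ℝ → M} {a b : ℝ}
    (h : X.IsCurveOn γ a b) (s : ℝ) : X.IsCurveOn (fun t => γ (t + s)) (a - s) (b - s) := by
  rw [X.isCurveOn_iff] at h ⊢
  refine ⟨(h.1.comp_add s).mono fun t ht => ?_, fun t ht => h.2 ?_⟩ <;>
  · have h1 := ht.1
    have h2 := ht.2
    constructor <;> linarith

theorem LocalVectorField.isCurveOn_of_hasDerivAt {X : LocalVectorField n M} {z₀ : M}
    {c : ℝ → EuclideanSpace ℝ (Fin n)} {a b : ℝ}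
    (hc : ∀ t ∈ Ioo a b, c t ∈ X.chartDom z₀ ∧ HasDerivAt c (localVec z₀ X.vec (c t)) t) :
    X.IsCurveOn (fun t => (extChartAt (𝓡 n) z₀).symm (c t)) a b := fun t ht =>
  ⟨(hc t ht).1.2, hasMFDerivAt_extChartAt_symm_comp (hc t ht).2 (hc t ht).1.1⟩

/-- The set of times of agreement is open by local uniqueness and closed because `M` is Hausdorff;
the interval is connected. -/
theorem LocalVectorField.IsCurveOn.eqOn [T2Space M] {X : LocalVectorField n M} {γ γ' : ℝ → M}
    {a b : ℝ} (h : X.IsCurveOn γ a b) (h' : X.IsCurveOn γ' a b) {t₀ : ℝ} (ht₀ : t₀ ∈ Ioo a b)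
    (heq : γ t₀ = γ' t₀) : EqOn γ γ' (Ioo a b) := by
  have hev : ∀ t ∈ Ioo a b, γ t = γ' t → γ =ᶠ[nhds t] γ' := by
    intro t ht hγ
    have hmem := isOpen_Ioo.mem_nhds ht
    exact isMIntegralCurveAt_eventuallyEq_of_contMDiffAt_boundaryless
      ((X.smooth.contMDiffAt (X.isOpen_dom.mem_nhds (h t ht).1)).of_le (by simp))
      (((X.isCurveOn_iff _ _ _).1 h).1.isMIntegralCurveAt hmem)
      (((X.isCurveOn_iff _ _ _).1 h').1.isMIntegralCurveAt hmem) hγ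
  intro t ht
  have key := isPreconnected_Ioo.induction₂ (fun s t => γ s = γ' s ↔ γ t = γ' t) (s := Ioo a b)
    (fun s hs => ?_) (fun _ _ _ _ _ _ h h' => h.trans h') (fun _ _ _ _ h => h.symm) ht₀ ht
  · exact key.1 heq
  · apply Filter.Eventually.filter_mono nhdsWithin_le_nhds
    by_cases hs' : γ s = γ' s
    · filter_upwards [hev s hs hs'] with t ht
      exact ⟨fun _ => ht, fun _ => hs'⟩
    · have h1 := (h.continuousAt hs).prodMk (h'.continuousAt hs)
      have h2 : {p : M × M | p.1 ≠ p.2} ∈ nhds (γ s, γ' s) :=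
        (isClosed_diagonal.isOpen_compl).mem_nhds hs'
      filter_upwards [h1 h2] with t ht
      exact ⟨fun h => absurd h hs', fun h => absurd h ht⟩

theorem LocalVectorField.IsCurveOn.flowsTo {X : LocalVectorField n M} {γ : ℝ → M} {a b : ℝ}
    (h : X.IsCurveOn γ a b) {s t : ℝ} (hs : s ∈ Ioo a b) (ht : t ∈ Ioo a b) :
    X.FlowsTo (t - s) (γ s) (γ t) := by
  have h1 := (X.isCurveOn_iff _ _ _).1 (h.comp_add s)
  refine ⟨_, a - s, b - s, ⟨by linarith [hs.1], by linarith [hs.2]⟩,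
    ⟨by linarith [ht.1], by linarith [ht.2]⟩, h1.1, h1.2, by simp, by simp⟩

theorem LocalVectorField.flowsTo_iff (X : LocalVectorField n M) (t : ℝ) (m m' : M) :
    X.FlowsTo t m m' ↔ ∃ (γ : ℝ → M) (a b : ℝ), 0 ∈ Ioo a b ∧ t ∈ Ioo a b ∧
      X.IsCurveOn γ a b ∧ γ 0 = m ∧ γ t = m' := by
  simp only [LocalVectorField.FlowsTo, X.isCurveOn_iff, and_assoc]

theorem LocalVectorField.FlowsTo.symm {X : LocalVectorField n M} {t : ℝ} {m m' : M}
    (h : X.FlowsTo t m m') : X.FlowsTo (-t) m' m := by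
  obtain ⟨γ, a, b, h0, ht, hγ, rfl, rfl⟩ := (X.flowsTo_iff _ _ _).1 h
  simpa using hγ.flowsTo ht h0

theorem LocalVectorField.FlowsTo.unique [T2Space M] {X : LocalVectorField n M} {t : ℝ}
    {m m' m'' : M} (h : X.FlowsTo t m m') (h' : X.FlowsTo t m m'') : m' = m'' := by
  obtain ⟨γ, a, b, h0, ht, hγ, rfl, rfl⟩ := (X.flowsTo_iff _ _ _).1 h
  obtain ⟨γ', a', b', h0', ht', hγ', h1, rfl⟩ := (X.flowsTo_iff _ _ _).1 h'
  exact (hγ.mono (le_max_left a a') (min_le_left b b')).eqOn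
    (hγ'.mono (le_max_right a a') (min_le_right b b'))
    ⟨max_lt h0.1 h0'.1, lt_min h0.2 h0'.2⟩ h1.symm ⟨max_lt ht.1 ht'.1, lt_min ht.2 ht'.2⟩

/-- Uniqueness of end points removes the choice made in `LocalVectorField.flow`. -/
theorem LocalVectorField.mem_flow_iff [T2Space M] (X : LocalVectorField n M) (t : ℝ) (m m' : M) :
    m' ∈ X.flow t m ↔ X.FlowsTo t m m' := by
  constructor
  · rintro ⟨h, rfl⟩
    exact h.choose_spec
  · intro h
    exact ⟨⟨m', h⟩, (Exists.choose_spec (⟨m', h⟩ : ∃ m', X.FlowsTo t m m')).unique h⟩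

end Flows

/-! ### Orbits of generated pseudogroups. -/

section Orbits

variable {n : ℕ} {M : Type*} [TopologicalSpace M] [ChartedSpace (EuclideanSpace ℝ (Fin n)) M]
  [IsManifold (𝓡 n) ∞ M] {D : Set (LocalVectorField n M)}

theorem mem_orbitOf_trans {a b c : M} (hab : b ∈ orbitOf (generatedPseudogroup D) a)
    (hbc : c ∈ orbitOf (generatedPseudogroup D) b) : c ∈ orbitOf (generatedPseudogroup D) a := by
  obtain ⟨F, hF, hb⟩ := hab
  obtain ⟨G, hG, hc⟩ := hbc
  exact ⟨G.comp F, .comp _ _ hG hF, Part.mem_bind hb hc⟩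

theorem generatedPseudogroup_mono {D' : Set (LocalVectorField n M)} (h : D ⊆ D') :
    generatedPseudogroup D ⊆ generatedPseudogroup D' := by
  intro F hF
  induction hF with
  | flow X hX t => exact .flow X (h hX) t
  | comp F G _ _ ihF ihG => exact .comp F G ihF ihG

variable [T2Space M]

theorem LocalVectorField.FlowsTo.mem_orbitOf {X : LocalVectorField n M} (hX : X ∈ D) {t : ℝ}
    {m m' : M} (h : X.FlowsTo t m m') : m' ∈ orbitOf (generatedPseudogroup D) m :=
  ⟨_, .flow X hX t, (X.mem_flow_iff _ _ _).2 h⟩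

/-- Induction along the elements of a generated pseudogroup. -/
theorem generatedPseudogroup_induction {r : M → M → Prop}
    (hflow : ∀ X ∈ D, ∀ t m m', X.FlowsTo t m m' → r m m')
    (htrans : ∀ a b c, r a b → r b c → r a c) {F : M →. M}
    (hF : F ∈ generatedPseudogroup D) : ∀ m, ∀ m' ∈ F m, r m m' := by
  induction hF with
  | flow X hX t => exact fun m m' h => hflow X hX t m m' ((X.mem_flow_iff _ _ _).1 h)
  | comp F G _ _ ihF ihG =>
    intro m m' h
    obtain ⟨b, hb, hc⟩ := Part.mem_bind_iff.1 h
    exact htrans _ _ _ (ihG m b hb) (ihF b m' hc)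

/-- Each flow is undone by the flow for the opposite time, and a composition by the inverses in
reverse order. -/
theorem mem_orbitOf_symm {a b : M} (hab : b ∈ orbitOf (generatedPseudogroup D) a) :
    a ∈ orbitOf (generatedPseudogroup D) b := by
  obtain ⟨F, hF, hb⟩ := hab
  exact generatedPseudogroup_induction
    (r := fun a b => a ∈ orbitOf (generatedPseudogroup D) b)
    (fun X hX t m m' h => h.symm.mem_orbitOf hX) (fun _ _ _ h h' => mem_orbitOf_trans h' h)
    hF a b hb

end Orbits

/-! ### Flat charts and their central plaques. -/

section FlatCharts

variable {n : ℕ} {M : Type u} [TopologicalSpace M] [ChartedSpace (EuclideanSpace ℝ (Fin n)) M]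

/-- Coordinates around `z` whose slices are tangent to the distribution `D`; the central slice is
contained in `O`. -/
structure FlatChart (D : (z : M) → Submodule ℝ (TangentSpace (𝓡 n) z)) (k : ℕ) (O : Set M)
    (z : M) where
  K : Submodule ℝ (EuclideanSpace ℝ (Fin n))
  e : OpenPartialHomeomorph M (EuclideanSpace ℝ (Fin k) × K)
  mem_source : z ∈ e.source
  apply_self : (e z).2 = 0
  smooth : ContMDiffOn (𝓡 n) 𝓘(ℝ, EuclideanSpace ℝ (Fin k) × K) ∞ e e.source
  smooth_symm : ContMDiffOn 𝓘(ℝ, EuclideanSpace ℝ (Fin k) × K) (𝓡 n) ∞ e.symm e.target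
  tangent : ∀ p ∈ e.target, ∀ u : EuclideanSpace ℝ (Fin k),
    mfderiv 𝓘(ℝ, EuclideanSpace ℝ (Fin k) × K) (𝓡 n) e.symm p (u, (0 : K)) ∈ D (e.symm p)
  plaque_subset : ∀ u, (u, (0 : K)) ∈ e.target → e.symm (u, (0 : K)) ∈ O

namespace FlatChart

variable {D : (z : M) → Submodule ℝ (TangentSpace (𝓡 n) z)} {k : ℕ} {O : Set M} {z : M}
  (c : FlatChart D k O z)

theorem hasMFDerivAt {w : M} (hw : w ∈ c.e.source) :
    HasMFDerivAt (𝓡 n) 𝓘(ℝ, EuclideanSpace ℝ (Fin k) × c.K) c.e w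
      (mfderiv (𝓡 n) 𝓘(ℝ, EuclideanSpace ℝ (Fin k) × c.K) c.e w) :=
  ((c.smooth.contMDiffAt (c.e.open_source.mem_nhds hw)).mdifferentiableAt (by simp)).hasMFDerivAt

theorem hasMFDerivAt_symm {p : EuclideanSpace ℝ (Fin k) × c.K} (hp : p ∈ c.e.target) :
    HasMFDerivAt 𝓘(ℝ, EuclideanSpace ℝ (Fin k) × c.K) (𝓡 n) c.e.symm p
      (mfderiv 𝓘(ℝ, EuclideanSpace ℝ (Fin k) × c.K) (𝓡 n) c.e.symm p) :=
  ((c.smooth_symm.contMDiffAt (c.e.open_target.mem_nhds hp)).mdifferentiableAt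
    (by simp)).hasMFDerivAt

theorem mfderiv_symm_mfderiv {w : M} (hw : w ∈ c.e.source) (v : TangentSpace (𝓡 n) w) :
    mfderiv 𝓘(ℝ, EuclideanSpace ℝ (Fin k) × c.K) (𝓡 n) c.e.symm (c.e w)
      (mfderiv (𝓡 n) 𝓘(ℝ, EuclideanSpace ℝ (Fin k) × c.K) c.e w v) = v := by
  have h1 := (c.hasMFDerivAt_symm (c.e.map_source hw)).comp w (c.hasMFDerivAt hw)
  have h2 : HasMFDerivAt (𝓡 n) (𝓡 n) (c.e.symm ∘ c.e) w
      (ContinuousLinearMap.id ℝ (TangentSpace (𝓡 n) w)) := by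
    refine (hasMFDerivAt_id w).congr_of_eventuallyEq ?_
    filter_upwards [c.e.open_source.mem_nhds hw] with y hy using c.e.left_inv hy
  exact DFunLike.congr_fun (hasMFDerivAt_unique h1 h2) v

theorem mfderiv_mfderiv_symm {w : M} (hw : w ∈ c.e.source)
    (v : EuclideanSpace ℝ (Fin k) × c.K) :
    mfderiv (𝓡 n) 𝓘(ℝ, EuclideanSpace ℝ (Fin k) × c.K) c.e w
      (mfderiv 𝓘(ℝ, EuclideanSpace ℝ (Fin k) × c.K) (𝓡 n) c.e.symm (c.e w) v) = v := by
  have h3 : HasMFDerivAt (𝓡 n) 𝓘(ℝ, EuclideanSpace ℝ (Fin k) × c.K) c.e (c.e.symm (c.e w))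
      (mfderiv (𝓡 n) 𝓘(ℝ, EuclideanSpace ℝ (Fin k) × c.K) c.e w) := by
    rw [c.e.left_inv hw]; exact c.hasMFDerivAt hw
  have h1 := h3.comp (c.e w) (c.hasMFDerivAt_symm (c.e.map_source hw))
  have h2 : HasMFDerivAt 𝓘(ℝ, EuclideanSpace ℝ (Fin k) × c.K)
      𝓘(ℝ, EuclideanSpace ℝ (Fin k) × c.K) (c.e ∘ c.e.symm) (c.e w)
      (ContinuousLinearMap.id ℝ _) := by
    refine (hasMFDerivAt_id (c.e w)).congr_of_eventuallyEq ?_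
    filter_upwards [c.e.open_target.mem_nhds (c.e.map_source hw)] with y hy using c.e.right_inv hy
  exact DFunLike.congr_fun (hasMFDerivAt_unique h1 h2) v

/-- At the points where `D` has rank `k`, it is the tangent space of the slice. -/
theorem mem_iff {w : M} (hw : w ∈ c.e.source) (hk : Module.finrank ℝ (D w) = k)
    (v : TangentSpace (𝓡 n) w) :
    v ∈ D w ↔ ∃ u : EuclideanSpace ℝ (Fin k),
      mfderiv 𝓘(ℝ, EuclideanSpace ℝ (Fin k) × c.K) (𝓡 n) c.e.symm (c.e w) (u, (0 : c.K)) = v := by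
  let A : (EuclideanSpace ℝ (Fin k) × c.K) →ₗ[ℝ] TangentSpace (𝓡 n) w :=
    (mfderiv 𝓘(ℝ, EuclideanSpace ℝ (Fin k) × c.K) (𝓡 n) c.e.symm (c.e w)).toLinearMap
  let B : EuclideanSpace ℝ (Fin k) →ₗ[ℝ] TangentSpace (𝓡 n) w :=
    A.comp (LinearMap.inl ℝ _ _)
  have hB : Function.Injective B := by
    intro u u' h
    have h1 := congrArg (mfderiv (𝓡 n) 𝓘(ℝ, EuclideanSpace ℝ (Fin k) × c.K) c.e w) h
    have h2 := c.mfderiv_mfderiv_symm hw (u, 0)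
    have h3 := c.mfderiv_mfderiv_symm hw (u', 0)
    exact congrArg Prod.fst (h2.symm.trans (h1.trans h3))
  have hle : LinearMap.range B ≤ D w := by
    rintro _ ⟨u, rfl⟩
    have := c.tangent _ (c.e.map_source hw) u
    rw [c.e.left_inv hw] at this
    exact this
  have hfd : FiniteDimensional ℝ (TangentSpace (𝓡 n) w) :=
    inferInstanceAs (FiniteDimensional ℝ (EuclideanSpace ℝ (Fin n)))
  have heq : LinearMap.range B = D w := by
    refine Submodule.eq_of_le_of_finrank_eq hle ?_
    rw [LinearMap.finrank_range_of_inj hB, hk]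
    simp
  rw [← heq]
  rfl

theorem mem_iff_snd {w : M} (hw : w ∈ c.e.source) (hk : Module.finrank ℝ (D w) = k)
    (v : TangentSpace (𝓡 n) w) :
    v ∈ D w ↔ (mfderiv (𝓡 n) 𝓘(ℝ, EuclideanSpace ℝ (Fin k) × c.K) c.e w v).2 = 0 := by
  rw [c.mem_iff hw hk]
  constructor
  · rintro ⟨u, rfl⟩
    exact congrArg Prod.snd (c.mfderiv_mfderiv_symm hw (u, 0))
  · intro h
    refine ⟨(mfderiv (𝓡 n) 𝓘(ℝ, EuclideanSpace ℝ (Fin k) × c.K) c.e w v).1, ?_⟩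
    have h1 := c.mfderiv_symm_mfderiv hw v
    have h2 : mfderiv (𝓡 n) 𝓘(ℝ, EuclideanSpace ℝ (Fin k) × c.K) c.e w v =
      ((mfderiv (𝓡 n) 𝓘(ℝ, EuclideanSpace ℝ (Fin k) × c.K) c.e w v).1, (0 : c.K)) :=
      Prod.ext rfl h
    rw [h2] at h1
    exact h1

/-- A map tangent to `D` that starts in the central plaque remains there, as long as `D` has the
same rank. -/
theorem eventually_mem_plaque {F : Type*} [NormedAddCommGroup F] [NormedSpace ℝ F] {S : F → M}
    {p₀ : F} (hS : ∀ᶠ p in nhds p₀, MDifferentiableAt 𝓘(ℝ, F) (𝓡 n) S p ∧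
      Module.finrank ℝ (D (S p)) = k ∧ ∀ v : F, mfderiv 𝓘(ℝ, F) (𝓡 n) S p v ∈ D (S p))
    (h0 : S p₀ ∈ c.e.source) (h0' : (c.e (S p₀)).2 = 0) :
    ∀ᶠ p in nhds p₀, S p ∈ c.e.source ∧ (c.e (S p)).2 = 0 := by
  have hsrc : ∀ᶠ p in nhds p₀, S p ∈ c.e.source :=
    hS.self_of_nhds.1.continuousAt (c.e.open_source.mem_nhds h0)
  obtain ⟨δ, hδ, hball⟩ := Metric.eventually_nhds_iff_ball.1 (hS.and hsrc)
  -- The transverse coordinate has zero derivative along a map tangent to `D`, so it is constant on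
  -- the ball.
  have hd : ∀ p ∈ Metric.ball p₀ δ, HasFDerivWithinAt (fun p => (c.e (S p)).2)
      (0 : F →L[ℝ] c.K) (Metric.ball p₀ δ) p := by
    intro p hp
    obtain ⟨⟨h1, h2, h3⟩, h4⟩ := hball p hp
    have h5 : HasMFDerivAt 𝓘(ℝ, F) 𝓘(ℝ, EuclideanSpace ℝ (Fin k) × c.K) (fun p => c.e (S p)) p
        _ := (c.hasMFDerivAt h4).comp p h1.hasMFDerivAt
    let A : F →L[ℝ] EuclideanSpace ℝ (Fin k) × c.K :=
      (mfderiv (𝓡 n) 𝓘(ℝ, EuclideanSpace ℝ (Fin k) × c.K) c.e (S p)).comp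
        (mfderiv 𝓘(ℝ, F) (𝓡 n) S p)
    have h6 : HasFDerivAt (fun p => c.e (S p)) A p := h5.hasFDerivAt
    have h7 : HasFDerivAt (fun p => (c.e (S p)).2)
        ((ContinuousLinearMap.snd ℝ (EuclideanSpace ℝ (Fin k)) c.K).comp A) p :=
      HasFDerivAt.comp p hasFDerivAt_snd h6
    have h8 : (ContinuousLinearMap.snd ℝ (EuclideanSpace ℝ (Fin k)) c.K).comp A = 0 := by
      ext v : 1
      exact (c.mem_iff_snd h4 h2 _).1 (h3 v)
    rw [h8] at h7
    exact h7.hasFDerivWithinAt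
  filter_upwards [Metric.ball_mem_nhds p₀ hδ] with p hp
  refine ⟨(hball p hp).2, ?_⟩
  have h9 := (convex_ball p₀ δ).norm_image_sub_le_of_norm_hasFDerivWithin_le (C := 0) hd
    (fun _ _ => ContinuousLinearMap.opNorm_le_bound _ le_rfl fun _ => by simp) (Metric.mem_ball_self hδ) hp
  rw [zero_mul, h0', sub_zero] at h9
  exact norm_le_zero_iff.1 h9

/-- The parametrization of the central plaque. -/
noncomputable def param (u : EuclideanSpace ℝ (Fin k)) : M := c.e.symm (u, (0 : c.K))

theorem isOpen_param_domain : IsOpen {u : EuclideanSpace ℝ (Fin k) | (u, (0 : c.K)) ∈ c.e.target} :=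
  c.e.open_target.preimage (by fun_prop)

theorem contMDiffAt_param {u : EuclideanSpace ℝ (Fin k)} (hu : (u, (0 : c.K)) ∈ c.e.target) :
    ContMDiffAt 𝓘(ℝ, EuclideanSpace ℝ (Fin k)) (𝓡 n) ∞ c.param u := by
  have h1 : ContMDiffAt 𝓘(ℝ, EuclideanSpace ℝ (Fin k))
      𝓘(ℝ, EuclideanSpace ℝ (Fin k) × c.K) ∞ (fun u => (u, (0 : c.K))) u :=
    (contDiff_id.prodMk contDiff_const).contMDiff.contMDiffAt
  exact (c.smooth_symm.contMDiffAt (c.e.open_target.mem_nhds hu)).comp u h1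

theorem mfderiv_param {u : EuclideanSpace ℝ (Fin k)} (hu : (u, (0 : c.K)) ∈ c.e.target)
    (v : EuclideanSpace ℝ (Fin k)) :
    mfderiv 𝓘(ℝ, EuclideanSpace ℝ (Fin k)) (𝓡 n) c.param u v =
      mfderiv 𝓘(ℝ, EuclideanSpace ℝ (Fin k) × c.K) (𝓡 n) c.e.symm (u, (0 : c.K))
        (v, (0 : c.K)) := by
  have h1 : HasFDerivAt (fun u : EuclideanSpace ℝ (Fin k) => (u, (0 : c.K)))
      (ContinuousLinearMap.inl ℝ _ _) u := hasFDerivAt_prodMk_left u 0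
  have h2 := (c.hasMFDerivAt_symm hu).comp u h1.hasMFDerivAt
  exact DFunLike.congr_fun h2.mfderiv v

/-- The parametrization of a plaque is tangent to `D`. -/
theorem eventually_param (hO : ∀ p ∈ O, Module.finrank ℝ (D p) = k)
    {u : EuclideanSpace ℝ (Fin k)} (hu : (u, (0 : c.K)) ∈ c.e.target) :
    ∀ᶠ p in nhds u, MDifferentiableAt 𝓘(ℝ, EuclideanSpace ℝ (Fin k)) (𝓡 n) c.param p ∧
      Module.finrank ℝ (D (c.param p)) = k ∧ ∀ v : EuclideanSpace ℝ (Fin k),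
        mfderiv 𝓘(ℝ, EuclideanSpace ℝ (Fin k)) (𝓡 n) c.param p v ∈ D (c.param p) := by
  filter_upwards [c.isOpen_param_domain.mem_nhds hu] with p hp
  refine ⟨(c.contMDiffAt_param hp).mdifferentiableAt (by simp), hO _ (c.plaque_subset p hp),
    fun v => ?_⟩
  rw [c.mfderiv_param hp]
  exact c.tangent _ hp v

end FlatChart

end FlatCharts

/-! ### The leaf manifold structure on a set covered by plaques. -/

section Leaves

variable {n : ℕ} {M : Type u} [TopologicalSpace M] [ChartedSpace (EuclideanSpace ℝ (Fin n)) M]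

/-- A subset of `M`, to be endowed with the topology generated by plaques. -/
@[ext]
structure PlaqueSpace (O : Set M) : Type u where
  val : M
  property : val ∈ O

variable {D : (z : M) → Submodule ℝ (TangentSpace (𝓡 n) z)} {k : ℕ} {O : Set M}

namespace FlatChart

open Classical in
/-- The central plaque of a flat chart, as a chart of `O`. -/
noncomputable def plaqueChart {z : PlaqueSpace O} (c : FlatChart D k O z.1) :
    PartialEquiv (PlaqueSpace O) (EuclideanSpace ℝ (Fin k)) where
  toFun q := (c.e q.1).1
  -- Off the target, the value `z` is an arbitrary default.
  invFun u := if h : (u, (0 : c.K)) ∈ c.e.target then ⟨c.param u, c.plaque_subset u h⟩ else z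
  source := {q | q.1 ∈ c.e.source ∧ (c.e q.1).2 = 0}
  target := {u | (u, (0 : c.K)) ∈ c.e.target}
  map_source' := by
    rintro q ⟨h1, h2⟩
    have h3 := c.e.map_source h1
    rwa [show c.e q.1 = ((c.e q.1).1, 0) from Prod.ext rfl h2] at h3
  map_target' := by
    intro u hu
    have hu' : (u, (0 : c.K)) ∈ c.e.target := hu
    rw [dif_pos hu']
    exact ⟨c.e.map_target hu', congrArg Prod.snd (c.e.right_inv hu')⟩
  left_inv' := by
    rintro q ⟨h1, h2⟩
    have h4 : c.e q.1 = ((c.e q.1).1, 0) := Prod.ext rfl h2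
    have h3 := c.e.map_source h1
    rw [h4] at h3
    rw [dif_pos h3]
    refine PlaqueSpace.ext ?_
    exact (congrArg c.e.symm h4).symm.trans (c.e.left_inv h1)
  right_inv' := by
    intro u hu
    have hu' : (u, (0 : c.K)) ∈ c.e.target := hu
    rw [dif_pos hu']
    exact congrArg Prod.fst (c.e.right_inv hu')

open Classical in
theorem plaqueChart_symm_val {z : PlaqueSpace O} (c : FlatChart D k O z.1)
    {u : EuclideanSpace ℝ (Fin k)} (hu : (u, (0 : c.K)) ∈ c.e.target) :
    (c.plaqueChart.symm u).1 = c.param u := by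
  change (dite _ _ _ : PlaqueSpace O).1 = _
  rw [dif_pos hu]

/-- The parametrization of one plaque is tangent to `D`, which has rank `k` on `O`. By
`eventually_mem_plaque`, once it meets the central plaque of another chart it stays there nearby.
This makes overlaps open; smoothness is inherited from the ambient charts. -/
theorem eventually_transition (hO : ∀ p ∈ O, Module.finrank ℝ (D p) = k) {z z' : PlaqueSpace O}
    (c : FlatChart D k O z.1) (c' : FlatChart D k O z'.1) {u : EuclideanSpace ℝ (Fin k)}
    (hu : u ∈ (c.plaqueChart.symm.trans c'.plaqueChart).source) :
    (∀ᶠ v in nhds u, v ∈ (c.plaqueChart.symm.trans c'.plaqueChart).source) ∧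
      ContDiffAt ℝ ∞ (c.plaqueChart.symm.trans c'.plaqueChart) u := by
  obtain ⟨h1, h2⟩ := hu
  have h1' : (u, (0 : c.K)) ∈ c.e.target := h1
  have h3 : (c.plaqueChart.symm u).1 ∈ c'.e.source ∧ (c'.e (c.plaqueChart.symm u).1).2 = 0 := h2
  rw [plaqueChart_symm_val c h1'] at h3
  have h4 := c'.eventually_mem_plaque (c.eventually_param hO h1') h3.1 h3.2
  have h5 := c.isOpen_param_domain.mem_nhds h1'
  constructor
  · filter_upwards [h4, h5] with v hv hv'
    refine ⟨hv', ?_⟩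
    change (c.plaqueChart.symm v).1 ∈ c'.e.source ∧ (c'.e (c.plaqueChart.symm v).1).2 = 0
    rwa [plaqueChart_symm_val c hv']
  · have h6 : ContMDiffAt 𝓘(ℝ, EuclideanSpace ℝ (Fin k))
        𝓘(ℝ, EuclideanSpace ℝ (Fin k) × c'.K) ∞ (fun v => c'.e (c.param v)) u :=
      (c'.smooth.contMDiffAt (c'.e.open_source.mem_nhds h3.1)).comp u (c.contMDiffAt_param h1')
    refine (contDiffAt_fst.comp u h6.contDiffAt).congr_of_eventuallyEq ?_
    filter_upwards [h5] with v hv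
    change (c'.e (c.plaqueChart.symm v).1).1 = _
    rw [plaqueChart_symm_val c hv]
    rfl

/-- The charted space structure on `O` whose charts are the plaques. -/
noncomputable def plaqueCore (hO : ∀ p ∈ O, Module.finrank ℝ (D p) = k)
    (c : ∀ z : PlaqueSpace O, FlatChart D k O z.1) :
    ChartedSpaceCore (EuclideanSpace ℝ (Fin k)) (PlaqueSpace O) where
  atlas := Set.range fun z => (c z).plaqueChart
  chartAt z := (c z).plaqueChart
  mem_chart_source z := ⟨(c z).mem_source, (c z).apply_self⟩
  chart_mem_atlas z := ⟨z, rfl⟩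
  open_source := by
    rintro _ _ ⟨z, rfl⟩ ⟨z', rfl⟩
    exact isOpen_iff_mem_nhds.2 fun u hu => ((c z).eventually_transition hO (c z') hu).1
  continuousOn_toFun := by
    rintro _ _ ⟨z, rfl⟩ ⟨z', rfl⟩ u hu
    exact ((c z).eventually_transition hO (c z') hu).2.continuousAt.continuousWithinAt

theorem isManifold_plaqueCore (hO : ∀ p ∈ O, Module.finrank ℝ (D p) = k)
    (c : ∀ z : PlaqueSpace O, FlatChart D k O z.1) :
    letI := (plaqueCore hO c).toTopologicalSpace
    letI := (plaqueCore hO c).toChartedSpace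
    IsManifold (𝓡 k) ∞ (PlaqueSpace O) := by
  let _ := (plaqueCore hO c).toTopologicalSpace
  let _ := (plaqueCore hO c).toChartedSpace
  refine isManifold_of_contDiffOn _ _ _ ?_
  rintro e e' he he'
  obtain ⟨f, hf⟩ := mem_iUnion.1 he
  obtain ⟨f', hf'⟩ := mem_iUnion.1 he'
  obtain ⟨⟨z, rfl⟩, rfl⟩ := mem_iUnion.1 hf
  obtain ⟨⟨z', rfl⟩, rfl⟩ := mem_iUnion.1 hf'
  rintro u ⟨hu, -⟩
  exact ((c z).eventually_transition hO (c z') hu).2.contDiffWithinAt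

/-- In the plaque chart at `q` the inclusion is `param`, whose derivative identifies the model space
with the slice directions, and these are `D` by the rank condition. -/
theorem mfderiv_plaque_incl (hO : ∀ p ∈ O, Module.finrank ℝ (D p) = k)
    (c : ∀ z : PlaqueSpace O, FlatChart D k O z.1) (q : PlaqueSpace O) :
    letI := (plaqueCore hO c).toTopologicalSpace
    letI := (plaqueCore hO c).toChartedSpace
    ContMDiffAt (𝓡 k) (𝓡 n) ∞ (fun q : PlaqueSpace O => q.1) q ∧
      Function.Injective (mfderiv (𝓡 k) (𝓡 n) (fun q : PlaqueSpace O => q.1) q) ∧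
      ∀ v : TangentSpace (𝓡 n) q.1,
        v ∈ Set.range (mfderiv (𝓡 k) (𝓡 n) (fun q : PlaqueSpace O => q.1) q) ↔ v ∈ D q.1 := by
  let _ := (plaqueCore hO c).toTopologicalSpace
  let _ := (plaqueCore hO c).toChartedSpace
  have := isManifold_plaqueCore hO c
  have hq : q ∈ (chartAt (EuclideanSpace ℝ (Fin k)) q).source := mem_chart_source _ q
  have heq : (fun q : PlaqueSpace O => q.1) =ᶠ[nhds q]
      (c q).param ∘ extChartAt (𝓡 k) q := by
    filter_upwards [(chartAt (EuclideanSpace ℝ (Fin k)) q).open_source.mem_nhds hq] with p hp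
    have hp' : p ∈ (c q).plaqueChart.source := hp
    have h1 := plaqueChart_symm_val (c q) ((c q).plaqueChart.map_source hp')
    rw [(c q).plaqueChart.left_inv hp'] at h1
    exact h1
  have hu : ((extChartAt (𝓡 k) q q), (0 : (c q).K)) ∈ (c q).e.target :=
    (c q).plaqueChart.map_source (⟨(c q).mem_source, (c q).apply_self⟩ : q ∈ (c q).plaqueChart.source)
  have he : (extChartAt (𝓡 k) q q, (0 : (c q).K)) = (c q).e q.1 :=
    Prod.ext rfl (c q).apply_self.symm
  have h1 : ContMDiffAt (𝓡 k) 𝓘(ℝ, EuclideanSpace ℝ (Fin k)) ∞ (extChartAt (𝓡 k) q) q :=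
    contMDiffAt_extChartAt
  have h2 := ((c q).contMDiffAt_param hu).comp q h1
  have h3 := ((((c q).contMDiffAt_param hu).mdifferentiableAt (by simp)).hasMFDerivAt.comp q
    (h1.mdifferentiableAt (by simp)).hasMFDerivAt).congr_of_eventuallyEq heq
  have hinv : (mfderiv (𝓡 k) 𝓘(ℝ, EuclideanSpace ℝ (Fin k)) (extChartAt (𝓡 k) q) q).IsInvertible :=
    isInvertible_mfderiv_extChartAt (mem_extChartAt_source q)
  have h4 : ∀ v, mfderiv (𝓡 k) (𝓡 n) (fun q : PlaqueSpace O => q.1) q v =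
      mfderiv 𝓘(ℝ, EuclideanSpace ℝ (Fin k) × (c q).K) (𝓡 n) (c q).e.symm ((c q).e q.1)
        (mfderiv (𝓡 k) 𝓘(ℝ, EuclideanSpace ℝ (Fin k)) (extChartAt (𝓡 k) q) q v, (0 : (c q).K)) := by
    intro v
    refine (DFunLike.congr_fun h3.mfderiv v).trans ?_
    rw [← he]
    exact (c q).mfderiv_param hu _
  refine ⟨h2.congr_of_eventuallyEq heq, ?_, fun v => ?_⟩
  · intro v w hvw
    have h5 := ((h4 v).symm.trans hvw).trans (h4 w)
    have h6 := congrArg (mfderiv (𝓡 n) 𝓘(ℝ, EuclideanSpace ℝ (Fin k) × (c q).K) (c q).e q.1) h5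
    have h7 := ((c q).mfderiv_mfderiv_symm (c q).mem_source _).symm.trans
      (h6.trans ((c q).mfderiv_mfderiv_symm (c q).mem_source _))
    exact hinv.injective (congrArg Prod.fst h7)
  · rw [(c q).mem_iff (c q).mem_source (hO _ q.2)]
    constructor
    · rintro ⟨w, rfl⟩
      exact ⟨_, (h4 w).symm⟩
    · rintro ⟨u, rfl⟩
      obtain ⟨w, hw⟩ := hinv.surjective u
      exact ⟨w, by rw [h4, hw]⟩

/-- The leaf topology can be finer than that of `M`, but a curve tangent to `D` cannot jump between
plaques, so it remains continuous. -/
theorem continuousAt_plaque_lift (hO : ∀ p ∈ O, Module.finrank ℝ (D p) = k)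
    (c : ∀ z : PlaqueSpace O, FlatChart D k O z.1) {γ : ℝ → PlaqueSpace O} {t : ℝ}
    (hγ : ∀ᶠ s in nhds t, MDifferentiableAt 𝓘(ℝ, ℝ) (𝓡 n) (fun s => (γ s).1) s ∧
      ∀ v : ℝ, mfderiv 𝓘(ℝ, ℝ) (𝓡 n) (fun s => (γ s).1) s v ∈ D (γ s).1) :
    letI := (plaqueCore hO c).toTopologicalSpace
    ContinuousAt γ t := by
  let _ := (plaqueCore hO c).toTopologicalSpace
  let _ := (plaqueCore hO c).toChartedSpace
  have h1 := (c (γ t)).eventually_mem_plaque (S := fun s => (γ s).1) (p₀ := t)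
    (hγ.mono fun s hs => ⟨hs.1, hO _ (γ s).2, hs.2⟩) (c (γ t)).mem_source (c (γ t)).apply_self
  let e := chartAt (EuclideanSpace ℝ (Fin k)) (γ t)
  have h2 : γ ⁻¹' e.source ∈ nhds t := h1
  rw [e.continuousAt_iff_continuousAt_comp_left h2]
  have h3 : ContinuousAt (fun s => (c (γ t)).e (γ s).1) t :=
    ContinuousAt.comp (f := fun s => (γ s).1)
      ((c (γ t)).e.continuousAt (c (γ t)).mem_source) hγ.self_of_nhds.1.continuousAt
  exact h3.fst

end FlatChart

end Leaves

/-! ### Constancy of the rank along integral curves. -/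

section RankAlongCurves

variable {n : ℕ} {M : Type*} [TopologicalSpace M] [ChartedSpace (EuclideanSpace ℝ (Fin n)) M]
  [IsManifold (𝓡 n) ∞ M]

theorem LocalVectorField.exists_isCurveOn (X : LocalVectorField n M) {z : M} (hz : z ∈ X.dom) :
    ∃ ε > 0, ∃ γ : ℝ → M, X.IsCurveOn γ (-ε) ε ∧ γ 0 = z := by
  have hs := mem_extChartAt_source (I := 𝓡 n) z
  obtain ⟨ε, hε, V, -, hxV, Φ, -, h⟩ := (X.contDiffOn_localVec z).exists_localFlow
    (X.isOpen_chartDom z) (X.mem_chartDom hz hs)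
  refine ⟨ε, hε, _, X.isCurveOn_of_hasDerivAt fun t ht =>
    ⟨((h _ hxV).2 t ht).1, ((h _ hxV).2 t ht).2.1⟩, ?_⟩
  rw [(h _ hxV).1, (extChartAt (𝓡 n) z).left_inv hs]

/-- The pseudogroup contains no identity by definition; the time-zero flow of a field defined at `z`
replaces it. -/
theorem mem_orbitOf_self [T2Space M] {𝒟 : Set (LocalVectorField n M)} {z : M}
    (h : ∃ X ∈ 𝒟, z ∈ X.dom) : z ∈ orbitOf (generatedPseudogroup 𝒟) z := by
  obtain ⟨X, hX, hz⟩ := h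
  obtain ⟨ε, hε, γ, hγ, h0⟩ := X.exists_isCurveOn hz
  have h1 : (0 : ℝ) ∈ Ioo (-ε) ε := ⟨by linarith, hε⟩
  have h2 := hγ.flowsTo h1 h1
  rw [h0] at h2
  exact h2.mem_orbitOf hX

instance (z : M) : FiniteDimensional ℝ (TangentSpace (𝓡 n) z) :=
  inferInstanceAs (FiniteDimensional ℝ (EuclideanSpace ℝ (Fin n)))

theorem finrank_localDist {z₀ : M} {D : (z : M) → Submodule ℝ (TangentSpace (𝓡 n) z)}
    {x : EuclideanSpace ℝ (Fin n)} (hx : x ∈ (extChartAt (𝓡 n) z₀).target) :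
    Module.finrank ℝ (localDist z₀ D x) = Module.finrank ℝ (D ((extChartAt (𝓡 n) z₀).symm x)) := by
  obtain ⟨A, hA⟩ := isInvertible_mfderiv_extChartAt (I := 𝓡 n)
    ((extChartAt (𝓡 n) z₀).map_target hx)
  have h := LinearEquiv.finrank_map_eq A.toLinearEquiv (D ((extChartAt (𝓡 n) z₀).symm x))
  rw [← h, localDist, ← hA]
  rfl

/-- Near each time the curve is a flow line in a chart, and the derivative of the local flow maps
the distribution isomorphically along it. Hence the rank is locally constant on a connected
interval. -/
theorem finrank_eq_of_isCurveOn [T2Space M] {D : (z : M) → Submodule ℝ (TangentSpace (𝓡 n) z)}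
    {X : LocalVectorField n M}
    (hX : ∀ z₀, IsFlowInvariant (localVec z₀ X.vec) (X.chartDom z₀) (localDist z₀ D))
    {γ : ℝ → M} {a b : ℝ} (hγ : X.IsCurveOn γ a b) {s t : ℝ} (hs : s ∈ Ioo a b)
    (ht : t ∈ Ioo a b) : Module.finrank ℝ (D (γ s)) = Module.finrank ℝ (D (γ t)) := by
  refine isPreconnected_Ioo.induction₂
    (fun s t => Module.finrank ℝ (D (γ s)) = Module.finrank ℝ (D (γ t))) (fun t₀ ht₀ => ?_)
    (fun _ _ _ _ _ _ h h' => h.trans h') (fun _ _ _ _ h => h.symm) hs ht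
  apply Filter.Eventually.filter_mono nhdsWithin_le_nhds
  set φ := extChartAt (𝓡 n) (γ t₀) with hφ
  have hsrc := mem_extChartAt_source (I := 𝓡 n) (γ t₀)
  obtain ⟨ε, hε, V, -, hxV, Φ, -, h⟩ := (hX (γ t₀)).exists_localFlow (X.isOpen_chartDom _)
    (X.contDiffOn_localVec _) (X.mem_chartDom (hγ t₀ ht₀).1 hsrc)
  obtain ⟨h0, h⟩ := h _ hxV
  have h1 : X.IsCurveOn (fun s => φ.symm (Φ (s, φ (γ t₀)))) (-ε) ε :=
    X.isCurveOn_of_hasDerivAt fun t ht => ⟨(h t ht).1, (h t ht).2.1⟩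
  have h2 := h1.comp_add (-t₀)
  have h3 := (hγ.mono (le_max_left a (-ε - -t₀)) (min_le_left b (ε - -t₀))).eqOn
    (h2.mono (le_max_right _ _) (min_le_right _ _)) (t₀ := t₀)
    ⟨max_lt ht₀.1 (by linarith), lt_min ht₀.2 (by linarith)⟩
    (by rw [add_neg_cancel, h0, φ.left_inv hsrc])
  filter_upwards [isOpen_Ioo.mem_nhds (show t₀ ∈ Ioo (max a (-ε - -t₀)) (min b (ε - -t₀)) from
    ⟨max_lt ht₀.1 (by linarith), lt_min ht₀.2 (by linarith)⟩)] with t ht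
  have h4 : t + -t₀ ∈ Ioo (-ε) ε :=
    ⟨by linarith [(le_max_right a (-ε - -t₀)).trans_lt ht.1],
      by linarith [ht.2.trans_le (min_le_right b (ε - -t₀))]⟩
  obtain ⟨h5, -, B, ⟨B', rfl⟩, -, -, h6⟩ := h _ h4
  have h7 : (localDist (γ t₀) D (φ (γ t₀))).map B'.toLinearEquiv.toLinearMap =
      localDist (γ t₀) D (Φ (t + -t₀, φ (γ t₀))) := by
    ext w
    constructor
    · rintro ⟨v, hv, rfl⟩
      exact (h6 v).2 hv
    · intro hw
      refine ⟨B'.symm w, (h6 _).1 ?_, B'.apply_symm_apply w⟩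
      rwa [ContinuousLinearEquiv.coe_coe, B'.apply_symm_apply]
  have h8 := LinearEquiv.finrank_map_eq B'.toLinearEquiv (localDist (γ t₀) D (φ (γ t₀)))
  rw [h7, finrank_localDist h5.1, finrank_localDist (φ.map_source hsrc)] at h8
  rw [h3 ht]
  change _ = Module.finrank ℝ (D (φ.symm (Φ (t + -t₀, φ (γ t₀)))))
  rw [h8, φ.left_inv hsrc]

end RankAlongCurves

/-! ### The orbit theorem for flow-invariant distributions. -/

section OrbitTheorem

variable {n : ℕ} {M : Type u} [TopologicalSpace M] [ChartedSpace (EuclideanSpace ℝ (Fin n)) M]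
  [IsManifold (𝓡 n) ∞ M] {𝒟 : Set (LocalVectorField n M)}

theorem exists_basis_spannedDistribution (w : M) :
    ∃ X : Fin (Module.finrank ℝ (spannedDistribution 𝒟 w)) → LocalVectorField n M,
      (∀ i, X i ∈ 𝒟 ∧ w ∈ (X i).dom) ∧
        Submodule.span ℝ (range fun i => (X i).vec w) = spannedDistribution 𝒟 w ∧
        LinearIndependent ℝ fun i => (X i).vec w := by
  obtain ⟨f, hf, hspan, hli⟩ := Submodule.exists_fun_fin_finrank_span_eq ℝ
    {v : TangentSpace (𝓡 n) w | ∃ X ∈ 𝒟, w ∈ X.dom ∧ v = X.vec w}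
  choose X hX hw hf using hf
  obtain rfl : f = fun i => (X i).vec w := funext hf
  exact ⟨X, fun i => ⟨hX i, hw i⟩, hspan, hli⟩

theorem vec_mem_spannedDistribution {X : LocalVectorField n M} (hX : X ∈ 𝒟) {z : M}
    (hz : z ∈ X.dom) : X.vec z ∈ spannedDistribution 𝒟 z :=
  Submodule.subset_span ⟨X, hX, hz, rfl⟩

variable [T2Space M]

/-- `exists_flat_chart` is applied in the chart at `z`, with "lies in the orbit of" as the relation
`R`; this puts the central plaque inside the orbit of `z`. -/
theorem exists_flatChart_orbitOf (hcover : ∀ z, ∃ X ∈ 𝒟, z ∈ X.dom)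
    (hFI : ∀ X ∈ 𝒟, ∀ z₀, IsFlowInvariant (localVec z₀ X.vec) (X.chartDom z₀)
      (localDist z₀ (spannedDistribution 𝒟))) (z : M) :
    Nonempty (FlatChart (spannedDistribution 𝒟)
      (Module.finrank ℝ (spannedDistribution 𝒟 z)) (orbitOf (generatedPseudogroup 𝒟) z) z) := by
  set φ := extChartAt (𝓡 n) z with hφ
  have hsrc := mem_extChartAt_source (I := 𝓡 n) z
  have hx₀ : φ z ∈ φ.target := φ.map_source hsrc
  have hw : φ.symm (φ z) = z := φ.left_inv hsrc
  -- The frame is taken at `φ.symm (φ z)`, the base point appearing in `localVec`; only its index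
  -- type is transported along the equality with `z`.
  obtain ⟨X, hX, hspan, hli⟩ := exists_basis_spannedDistribution (𝒟 := 𝒟) (φ.symm (φ z))
  have hk : Module.finrank ℝ (spannedDistribution 𝒟 (φ.symm (φ z))) =
    Module.finrank ℝ (spannedDistribution 𝒟 z) := by rw [hw]
  revert X
  rw [hk]
  intro X hX hspan hli
  have hmap : ∀ L : TangentSpace (𝓡 n) (φ.symm (φ z)) →ₗ[ℝ] EuclideanSpace ℝ (Fin n),
      Submodule.span ℝ (range fun i => L ((X i).vec (φ.symm (φ z)))) =
        (spannedDistribution 𝒟 (φ.symm (φ z))).map L := fun L => by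
    rw [← hspan, Submodule.map_span, ← range_comp]
    rfl
  have hli' : ∀ L : TangentSpace (𝓡 n) (φ.symm (φ z)) →ₗ[ℝ] EuclideanSpace ℝ (Fin n),
      Function.Injective L → LinearIndependent ℝ fun i => L ((X i).vec (φ.symm (φ z))) :=
    fun L hL => hli.map' L (LinearMap.ker_eq_bot.2 hL)
  let Ω : Set (EuclideanSpace ℝ (Fin n)) := φ.target ∩ ⋂ i, (X i).chartDom z
  have hΩ : IsOpen Ω := (isOpen_extChartAt_target z).inter
    (isOpen_iInter_of_finite fun i => (X i).isOpen_chartDom z)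
  have hΩi : ∀ i, Ω ⊆ (X i).chartDom z := fun i x hx => mem_iInter.1 hx.2 i
  obtain ⟨K, hK⟩ := Submodule.exists_isCompl (localDist z (spannedDistribution 𝒟) (φ z))
  obtain ⟨e, h0e, he0, heΩ, hes, hes', hetan, heR⟩ := exists_flat_chart hΩ
    (D := localDist z (spannedDistribution 𝒟))
    (X := fun i => localVec z (X i).vec)
    (fun i => ((X i).contDiffOn_localVec z).mono (hΩi i))
    (fun i a b c J hc => hFI _ (hX i).1 z a b c J fun t ht =>
      ⟨hΩi i (hc t ht).1, (hc t ht).2⟩)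
    (fun i x hx => Submodule.mem_map_of_mem
      (vec_mem_spannedDistribution (hX i).1 (hΩi i hx).2))
    (R := fun x y => φ.symm y ∈ orbitOf (generatedPseudogroup 𝒟) (φ.symm x))
    (fun x => mem_orbitOf_self (hcover _)) (fun _ _ _ => mem_orbitOf_trans)
    (fun i a b c hc s hs t ht => (((X i).isCurveOn_of_hasDerivAt (z₀ := z) fun t ht =>
      ⟨hΩi i (hc t ht).1, (hc t ht).2⟩).flowsTo hs ht).mem_orbitOf (hX i).1)
    (x₀ := φ z) ⟨hx₀, mem_iInter.2 fun i => (X i).mem_chartDom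
      (by have := (hX i).2; rwa [hw] at this) hsrc⟩
    (hmap _) (hli' _ (isInvertible_mfderiv_extChartAt (φ.map_target hx₀)).injective) hK
  have hcoe : ∀ y, chartAt (EuclideanSpace ℝ (Fin n)) z y = φ y := fun y => rfl
  have hcoe' : ∀ y, (chartAt (EuclideanSpace ℝ (Fin n)) z).symm y = φ.symm y := fun y => rfl
  refine ⟨⟨K, (chartAt (EuclideanSpace ℝ (Fin n)) z).trans e.symm, ?_, ?_, ?_, ?_, ?_, ?_⟩⟩
  · refine ⟨mem_chart_source _ z, ?_⟩
    change φ z ∈ e.target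
    rw [← he0]
    exact e.map_source h0e
  · change (e.symm (φ z)).2 = 0
    rw [← he0, e.left_inv h0e]
  · intro y hy
    have h1 : ContMDiffAt (𝓡 n) 𝓘(ℝ, EuclideanSpace ℝ (Fin n)) ∞ φ y :=
      contMDiffAt_extChartAt' hy.1
    have h2 : ContDiffAt ℝ ∞ e.symm (φ y) := hes'.contDiffAt (e.open_target.mem_nhds hy.2)
    exact (h2.contMDiffAt.comp y h1).contMDiffWithinAt
  · intro p hp
    have h1 := hp.1
    have h2 : ContDiffAt ℝ ∞ e p := hes.contDiffAt (e.open_source.mem_nhds hp.1)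
    have h3 := (contMDiffOn_extChartAt_symm (I := 𝓡 n) (n := ∞) z).contMDiffAt
      ((isOpen_extChartAt_target z).mem_nhds (heΩ (e.map_source h1)).1)
    exact (h3.comp p h2.contMDiffAt).contMDiffWithinAt
  · intro p hp u
    have h1 : p ∈ e.source := hp.1
    have h2 : e p ∈ φ.target := (heΩ (e.map_source h1)).1
    have h3 := ((hes.contDiffAt (e.open_source.mem_nhds h1)).differentiableAt
      (by simp)).hasFDerivAt.hasMFDerivAt
    have h4 := (hasMFDerivAt_extChartAt_symm h2).comp p h3
    obtain ⟨v, hv, hv'⟩ := hetan p h1 u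
    have h5 := DFunLike.congr_fun h4.mfderiv (u, (0 : K))
    have h6 : mfderiv 𝓘(ℝ, EuclideanSpace ℝ (Fin _) × K) (𝓡 n) (φ.symm ∘ e) p (u, (0 : K)) =
        v := by
      refine h5.trans ((congrArg _ hv'.symm).trans ?_)
      exact (isInvertible_mfderiv_extChartAt (φ.map_target h2)).inverse_apply_self _
    change mfderiv 𝓘(ℝ, EuclideanSpace ℝ (Fin _) × K) (𝓡 n) (φ.symm ∘ e) p (u, (0 : K)) ∈ _
    rw [h6]
    exact hv
  · intro u hu
    have h1 := heR u hu.1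
    rwa [hw] at h1

/-- The orbit through a point, with the topology generated by plaques, is an integral
submanifold. -/
theorem exists_integral_orbitOf (hcover : ∀ z, ∃ X ∈ 𝒟, z ∈ X.dom)
    (hFI : ∀ X ∈ 𝒟, ∀ z₀, IsFlowInvariant (localVec z₀ X.vec) (X.chartDom z₀)
      (localDist z₀ (spannedDistribution 𝒟))) (z : M) :
    ∃ N : ImmersedSubmanifold n M, N.IsIntegral (spannedDistribution 𝒟) ∧
      N.image = orbitOf (generatedPseudogroup 𝒟) z := by
  set O := orbitOf (generatedPseudogroup 𝒟) z with hOdef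
  set k := Module.finrank ℝ (spannedDistribution 𝒟 z) with hk
  have hO : ∀ p ∈ O, Module.finrank ℝ (spannedDistribution 𝒟 p) = k := by
    rintro p ⟨F, hF, hp⟩
    exact (generatedPseudogroup_induction (r := fun m m' =>
      Module.finrank ℝ (spannedDistribution 𝒟 m) = Module.finrank ℝ (spannedDistribution 𝒟 m'))
      (fun X hX t m m' h => by
        obtain ⟨γ, a, b, h0, ht, hγ, rfl, rfl⟩ := (X.flowsTo_iff _ _ _).1 h
        exact finrank_eq_of_isCurveOn (hFI X hX) hγ h0 ht)
      (fun _ _ _ h h' => h.trans h') hF z p hp).symm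
  have hOeq : ∀ p ∈ O, orbitOf (generatedPseudogroup 𝒟) p = O := fun p hp =>
    Subset.antisymm (fun q hq => mem_orbitOf_trans hp hq)
      (fun q hq => mem_orbitOf_trans (mem_orbitOf_symm hp) hq)
  have hc : ∀ p : PlaqueSpace O, Nonempty (FlatChart (spannedDistribution 𝒟) k O p.1) := by
    intro p
    have := exists_flatChart_orbitOf hcover hFI p.1
    rwa [hO _ p.2, hOeq _ p.2] at this
  let c : ∀ p : PlaqueSpace O, FlatChart (spannedDistribution 𝒟) k O p.1 := fun p => (hc p).some
  let _ := (FlatChart.plaqueCore hO c).toTopologicalSpace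
  let _ := (FlatChart.plaqueCore hO c).toChartedSpace
  have := FlatChart.isManifold_plaqueCore hO c
  -- Flow lines are continuous for the leaf topology, so the points they join lie in one connected
  -- component; this yields connectedness of the orbit.
  have hflow : ∀ X ∈ 𝒟, ∀ t m m', X.FlowsTo t m m' → ∀ hm : m ∈ O, ∃ hm' : m' ∈ O,
      (⟨m', hm'⟩ : PlaqueSpace O) ∈ connectedComponent (⟨m, hm⟩ : PlaqueSpace O) := by
    intro X hX t m m' h hm
    obtain ⟨γ, a, b, h0, ht, hγ, rfl, rfl⟩ := (X.flowsTo_iff _ _ _).1 h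
    have hγO : ∀ s ∈ Ioo a b, γ s ∈ O := fun s hs =>
      mem_orbitOf_trans hm ((hγ.flowsTo h0 hs).mem_orbitOf hX)
    classical
    let γ' : ℝ → PlaqueSpace O := fun s => if h : γ s ∈ O then ⟨γ s, h⟩ else ⟨γ 0, hm⟩
    have hγ' : ∀ s ∈ Ioo a b, ∀ h : γ s ∈ O, γ' s = ⟨γ s, h⟩ := fun s hs h => dif_pos h
    have hval : ∀ s ∈ Ioo a b, (γ' s).1 = γ s := fun s hs => by rw [hγ' s hs (hγO s hs)]
    have hcont : ContinuousOn γ' (Ioo a b) := by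
      intro s hs
      refine (FlatChart.continuousAt_plaque_lift hO c ?_).continuousWithinAt
      filter_upwards [isOpen_Ioo.mem_nhds hs] with r hr
      have hev : (fun s => (γ' s).1) =ᶠ[nhds r] γ := by
        filter_upwards [isOpen_Ioo.mem_nhds hr] with q hq using hval q hq
      have h1 := (hγ r hr).2.congr_of_eventuallyEq hev
      refine ⟨h1.mdifferentiableAt, fun v => ?_⟩
      have h2 := DFunLike.congr_fun h1.mfderiv v
      -- The base points `(γ' r).1` and `γ r` are only propositionally equal; quantifying over `p`
      -- allows the tangent vector to be transported.
      have h3 : ∀ p, p = γ r → ∀ w : TangentSpace (𝓡 n) p,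
          (w : EuclideanSpace ℝ (Fin n)) = v • (X.vec (γ r) : EuclideanSpace ℝ (Fin n)) →
            w ∈ spannedDistribution 𝒟 p := by
        rintro p rfl w rfl
        exact Submodule.smul_mem _ _ (vec_mem_spannedDistribution hX (hγ r hr).1)
      exact h3 _ (hval r hr) _ h2
    refine ⟨hγO t ht, ?_⟩
    have h4 := (isPreconnected_Ioo.image γ' hcont).subset_connectedComponent
      (mem_image_of_mem γ' h0) (mem_image_of_mem γ' ht)
    rwa [hγ' 0 h0 hm, hγ' t ht (hγO t ht)] at h4
  have hz : z ∈ O := mem_orbitOf_self (hcover z)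
  have hconn : ConnectedSpace (PlaqueSpace O) := by
    rw [connectedSpace_iff_connectedComponent]
    refine ⟨⟨z, hz⟩, eq_univ_of_forall fun q => ?_⟩
    obtain ⟨q, F, hF, hq⟩ := q
    obtain ⟨hm', h⟩ := generatedPseudogroup_induction (r := fun m m' => ∀ hm : m ∈ O,
      ∃ hm' : m' ∈ O, (⟨m', hm'⟩ : PlaqueSpace O) ∈ connectedComponent (⟨m, hm⟩ : PlaqueSpace O))
      hflow (fun a b d hab hbd ha => by
        obtain ⟨hb, hab⟩ := hab ha
        obtain ⟨hd, hbd⟩ := hbd hb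
        exact ⟨hd, connectedComponent_eq hab ▸ hbd⟩) hF z q hq hz
    exact h
  refine ⟨{ dim := k, carrier := PlaqueSpace O, incl := fun q => q.1
            injective := fun p q h => PlaqueSpace.ext h
            smooth := fun q => (FlatChart.mfderiv_plaque_incl hO c q).1
            immersion := fun q => (FlatChart.mfderiv_plaque_incl hO c q).2.1 },
    fun q => (FlatChart.mfderiv_plaque_incl hO c q).2.2, ?_⟩
  exact Subset.antisymm (by rintro _ ⟨q, rfl⟩; exact q.2) fun p hp => ⟨⟨p, hp⟩, rfl⟩

/-- An integral submanifold is tangent to the distribution, whose rank on it is its dimension. Near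
each point it therefore stays in a central plaque, hence in one orbit, and it is connected. -/
theorem ImmersedSubmanifold.IsIntegral.incl_mem_orbitOf (hcover : ∀ z, ∃ X ∈ 𝒟, z ∈ X.dom)
    (hFI : ∀ X ∈ 𝒟, ∀ z₀, IsFlowInvariant (localVec z₀ X.vec) (X.chartDom z₀)
      (localDist z₀ (spannedDistribution 𝒟))) {N : ImmersedSubmanifold n M}
    (hN : N.IsIntegral (spannedDistribution 𝒟)) (p q : N.carrier) :
    N.incl q ∈ orbitOf (generatedPseudogroup 𝒟) (N.incl p) := by
  have hrank : ∀ q, Module.finrank ℝ (spannedDistribution 𝒟 (N.incl q)) = N.dim := by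
    intro q
    have h1 : LinearMap.range (mfderiv (𝓡 N.dim) (𝓡 n) N.incl q).toLinearMap =
        spannedDistribution 𝒟 (N.incl q) := by
      ext v
      exact hN q v
    rw [← h1, LinearMap.finrank_range_of_inj (N.immersion q)]
    exact finrank_euclideanSpace_fin
  have : Std.Symm fun p q : N.carrier =>
      N.incl q ∈ orbitOf (generatedPseudogroup 𝒟) (N.incl p) := ⟨fun _ _ h => mem_orbitOf_symm h⟩
  refine PreconnectedSpace.induction₂ (fun p q : N.carrier =>
    N.incl q ∈ orbitOf (generatedPseudogroup 𝒟) (N.incl p)) (fun p => ?_)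
    ⟨fun _ _ _ => mem_orbitOf_trans⟩ p q
  obtain ⟨c⟩ := exists_flatChart_orbitOf hcover hFI (N.incl p)
  set ψ := extChartAt (𝓡 N.dim) p with hψ
  have hsrc := mem_extChartAt_source (I := 𝓡 N.dim) p
  have h1 : ∀ᶠ x in nhds (ψ p), MDifferentiableAt 𝓘(ℝ, EuclideanSpace ℝ (Fin N.dim)) (𝓡 n)
      (fun x => N.incl (ψ.symm x)) x ∧
      Module.finrank ℝ (spannedDistribution 𝒟 (N.incl (ψ.symm x))) =
        Module.finrank ℝ (spannedDistribution 𝒟 (N.incl p)) ∧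
      ∀ v : EuclideanSpace ℝ (Fin N.dim), mfderiv 𝓘(ℝ, EuclideanSpace ℝ (Fin N.dim)) (𝓡 n)
        (fun x => N.incl (ψ.symm x)) x v ∈ spannedDistribution 𝒟 (N.incl (ψ.symm x)) := by
    filter_upwards [extChartAt_target_mem_nhds p] with x hx
    have h2 := hasMFDerivAt_extChartAt_symm hx
    have h3 := ((N.smooth (ψ.symm x)).mdifferentiableAt (by simp)).hasMFDerivAt.comp x h2
    refine ⟨h3.mdifferentiableAt, by rw [hrank, hrank], fun v => ?_⟩
    exact (hN _ _).1 ⟨_, (DFunLike.congr_fun h3.mfderiv v).symm⟩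
  have h2 : ψ.symm (ψ p) = p := ψ.left_inv hsrc
  have h3 := c.eventually_mem_plaque h1 (by rw [h2]; exact c.mem_source)
    (by rw [h2]; exact c.apply_self)
  have h4 : ContinuousAt ψ p := continuousAt_extChartAt p
  filter_upwards [h4.eventually h3, extChartAt_source_mem_nhds (I := 𝓡 N.dim) p] with q hq hq'
  rw [ψ.left_inv hq'] at hq
  have h5 := c.e.map_source hq.1
  have h6 : c.e (N.incl q) = ((c.e (N.incl q)).1, 0) := Prod.ext rfl hq.2
  rw [h6] at h5
  have h7 := c.plaque_subset _ h5
  rwa [← h6, c.e.left_inv hq.1] at h7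

/-- The orbit theorem: a distribution spanned by vector fields whose flows preserve it is
integrable, and its leaves are the orbits of the pseudogroup generated by the flows. -/
theorem isIntegrable_of_isFlowInvariant (hcover : ∀ z, ∃ X ∈ 𝒟, z ∈ X.dom)
    (hFI : ∀ X ∈ 𝒟, ∀ z₀, IsFlowInvariant (localVec z₀ X.vec) (X.chartDom z₀)
      (localDist z₀ (spannedDistribution 𝒟))) :
    IsIntegrable (spannedDistribution 𝒟) ∧
      leafPartition (spannedDistribution 𝒟) = orbitPartition (generatedPseudogroup 𝒟) := by
  have hself : ∀ z, z ∈ orbitOf (generatedPseudogroup 𝒟) z := fun z => mem_orbitOf_self (hcover z)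
  have hleaf : ∀ z, IsLeaf (spannedDistribution 𝒟) (orbitOf (generatedPseudogroup 𝒟) z) := by
    intro z
    obtain ⟨N, hN, hNz⟩ := exists_integral_orbitOf hcover hFI z
    -- Any larger integral submanifold again lies in a single orbit, so the orbit is maximal.
    refine ⟨N, hN, hNz, fun N' hN' hsub => Subset.antisymm ?_ hsub⟩
    rw [hNz] at hsub ⊢
    obtain ⟨p, hp⟩ := hsub (hself z)
    rintro _ ⟨q, rfl⟩
    have := hN'.incl_mem_orbitOf hcover hFI p q
    rwa [hp] at this
  refine ⟨fun z => ⟨_, hleaf z, hself z⟩, Subset.antisymm ?_ ?_⟩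
  -- A leaf is contained in the orbit of any of its points, itself an integral submanifold, and
  -- maximality forces equality.
  · rintro L ⟨N, hN, rfl, hmax⟩
    obtain ⟨p⟩ : Nonempty N.carrier := inferInstance
    obtain ⟨N', hN', hN'p⟩ := exists_integral_orbitOf hcover hFI (N.incl p)
    refine ⟨N.incl p, ?_⟩
    rw [← hN'p]
    refine hmax N' hN' ?_
    rw [hN'p]
    rintro _ ⟨q, rfl⟩
    exact hN.incl_mem_orbitOf hcover hFI p q
  · rintro _ ⟨z, rfl⟩
    exact hleaf z

end OrbitTheorem

/-! ### Differentials of functions in charts. -/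

section Differentials

variable {n : ℕ} {M : Type*} [TopologicalSpace M] [ChartedSpace (EuclideanSpace ℝ (Fin n)) M]

/-- The differential of a function at a point. -/
noncomputable def differential (n : ℕ) {M : Type*} [TopologicalSpace M]
    [ChartedSpace (EuclideanSpace ℝ (Fin n)) M] (f : M → ℝ) (z : M) :
    EuclideanSpace ℝ (Fin n) →L[ℝ] ℝ :=
  mfderiv (𝓡 n) 𝓘(ℝ, ℝ) f z

theorem differential_congr {f g : M → ℝ} {z : M} (h : f =ᶠ[nhds z] g) :
    differential n f z = differential n g z := h.mfderiv_eq

theorem hasDerivAt_comp_of_hasMFDerivAt {f : M → ℝ} {γ : ℝ → M} {t : ℝ}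
    {v : EuclideanSpace ℝ (Fin n)} (hγ : HasMFDerivAt 𝓘(ℝ, ℝ) (𝓡 n) γ t
      ((1 : ℝ →L[ℝ] ℝ).smulRight v)) (hf : MDifferentiableAt (𝓡 n) 𝓘(ℝ, ℝ) f (γ t)) :
    HasDerivAt (fun s => f (γ s)) (differential n f (γ t) v) t := by
  have h1 := hf.hasMFDerivAt.comp t hγ
  have h2 : HasMFDerivAt 𝓘(ℝ, ℝ) 𝓘(ℝ, ℝ) (fun s => f (γ s)) t
      (ContinuousLinearMap.toSpanSingleton ℝ (differential n f (γ t) v)) := by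
    refine h1.congr_mfderiv ?_
    refine ContinuousLinearMap.ext fun s => ?_
    exact (differential n f (γ t)).map_smul (s : ℝ) v
  exact h2.hasFDerivAt

variable [IsManifold (𝓡 n) ∞ M]

theorem contDiffAt_comp_extChartAt_symm {f : M → ℝ} {z₀ : M} {x : EuclideanSpace ℝ (Fin n)}
    (hx : x ∈ (extChartAt (𝓡 n) z₀).target)
    (hf : ContMDiffAt (𝓡 n) 𝓘(ℝ, ℝ) ∞ f ((extChartAt (𝓡 n) z₀).symm x)) :
    ContDiffAt ℝ ∞ (fun x => f ((extChartAt (𝓡 n) z₀).symm x)) x := by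
  rw [← contMDiffAt_iff_contDiffAt]
  exact hf.comp x ((contMDiffOn_extChartAt_symm (n := ∞) z₀).contMDiffAt
      ((isOpen_extChartAt_target z₀).mem_nhds hx))

/-- The differential of a function, computed in a chart. -/
theorem differential_eq_fderiv_comp {f : M → ℝ} {z₀ z : M}
    (hz : z ∈ (extChartAt (𝓡 n) z₀).source) (hf : ContMDiffAt (𝓡 n) 𝓘(ℝ, ℝ) ∞ f z) :
    differential n f z =
      (fderiv ℝ (fun x => f ((extChartAt (𝓡 n) z₀).symm x)) (extChartAt (𝓡 n) z₀ z)).comp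
        (mfderiv (𝓡 n) 𝓘(ℝ, EuclideanSpace ℝ (Fin n)) (extChartAt (𝓡 n) z₀) z) := by
  have h1 : ContDiffAt ℝ ∞ (fun x => f ((extChartAt (𝓡 n) z₀).symm x))
      (extChartAt (𝓡 n) z₀ z) := by
    refine contDiffAt_comp_extChartAt_symm ((extChartAt (𝓡 n) z₀).map_source hz) ?_
    rwa [(extChartAt (𝓡 n) z₀).left_inv hz]
  have h2 : HasMFDerivAt (𝓡 n) 𝓘(ℝ, EuclideanSpace ℝ (Fin n)) (extChartAt (𝓡 n) z₀) z
      (mfderiv (𝓡 n) 𝓘(ℝ, EuclideanSpace ℝ (Fin n)) (extChartAt (𝓡 n) z₀) z) :=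
    (mdifferentiableAt_extChartAt (by rwa [← extChartAt_source (𝓡 n)])).hasMFDerivAt
  have h3 := (h1.differentiableAt (by simp)).hasFDerivAt.hasMFDerivAt.comp z h2
  have h4 : f =ᶠ[nhds z] (fun x => f ((extChartAt (𝓡 n) z₀).symm x)) ∘ extChartAt (𝓡 n) z₀ := by
    filter_upwards [(isOpen_extChartAt_source z₀).mem_nhds hz] with y hy
    rw [Function.comp_apply, (extChartAt (𝓡 n) z₀).left_inv hy]
  exact (h3.congr_of_eventuallyEq h4).mfderiv

/-- The differential of a function, computed in a chart. -/
theorem differential_apply_localVec {f : M → ℝ} {z₀ : M} {x : EuclideanSpace ℝ (Fin n)}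
    (hx : x ∈ (extChartAt (𝓡 n) z₀).target)
    (hf : ContMDiffAt (𝓡 n) 𝓘(ℝ, ℝ) ∞ f ((extChartAt (𝓡 n) z₀).symm x))
    (X : (z : M) → TangentSpace (𝓡 n) z) :
    fderiv ℝ (fun x => f ((extChartAt (𝓡 n) z₀).symm x)) x (localVec z₀ X x) =
      differential n f ((extChartAt (𝓡 n) z₀).symm x) (X ((extChartAt (𝓡 n) z₀).symm x)) := by
  rw [differential_eq_fderiv_comp ((extChartAt (𝓡 n) z₀).map_target hx) hf,
    (extChartAt (𝓡 n) z₀).right_inv hx]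
  rfl

end Differentials

/-! ### Extension of germs, and derivations as tangent vectors. -/

section Germs

variable {n : ℕ} {M : Type*} [TopologicalSpace M] [ChartedSpace (EuclideanSpace ℝ (Fin n)) M]
  [IsManifold (𝓡 n) ∞ M] [T2Space M]

theorem exists_eventuallyEq_of_contMDiffOn {U : Set M} (hU : IsOpen U) {f : M → ℝ}
    (hf : ContMDiffOn (𝓡 n) 𝓘(ℝ, ℝ) ∞ f U) {z : M} (hz : z ∈ U) :
    ∃ F : C^∞⟮𝓡 n, M; ℝ⟯, ∀ᶠ y in nhds z, F y = f y := by
  obtain ⟨b, -, hb⟩ := (SmoothBumpFunction.nhds_basis_tsupport (I := 𝓡 n) z).mem_iff.1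
    (hU.mem_nhds hz)
  refine ⟨⟨fun y => b y * f y, contMDiff_of_tsupport fun x hx => ?_⟩, ?_⟩
  · have hx' : x ∈ U := hb (closure_mono (Function.support_mul_subset_left _ _) hx)
    exact b.contMDiffAt.mul (hf.contMDiffAt (hU.mem_nhds hx'))
  · filter_upwards [b.eventuallyEq_one] with y hy
    change b y * f y = f y
    rw [hy, Pi.one_apply, one_mul]

/-- Global functions that coincide near `z₀` with the coordinates of the chart at `z`. -/
theorem exists_coordinates {z z₀ : M} (hz : z ∈ (extChartAt (𝓡 n) z₀).source) :
    ∃ ξ : Fin n → C^∞⟮𝓡 n, M; ℝ⟯, ∀ i, ∀ᶠ y in nhds z, ξ i y = extChartAt (𝓡 n) z₀ y i := by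
  have h : ∀ i, ∃ F : C^∞⟮𝓡 n, M; ℝ⟯, ∀ᶠ y in nhds z, F y = extChartAt (𝓡 n) z₀ y i := by
    intro i
    refine exists_eventuallyEq_of_contMDiffOn (f := fun y => extChartAt (𝓡 n) z₀ y i)
      (isOpen_extChartAt_source z₀) (fun y hy => ?_) hz
    have h1 : ContDiff ℝ ∞ fun x : EuclideanSpace ℝ (Fin n) => x i :=
      (EuclideanSpace.proj i : EuclideanSpace ℝ (Fin n) →L[ℝ] ℝ).contDiff
    have h2 : ContMDiffAt (𝓡 n) 𝓘(ℝ, EuclideanSpace ℝ (Fin n)) ∞ (extChartAt (𝓡 n) z₀) y :=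
      contMDiffAt_extChartAt' (by rwa [← extChartAt_source (𝓡 n)])
    exact (h1.contMDiff.contMDiffAt.comp y h2).contMDiffWithinAt
  choose ξ hξ using h
  exact ⟨ξ, hξ⟩

variable {z : M} {δ : C^∞⟮𝓡 n, M; ℝ⟯ →ₗ[ℝ] ℝ}

/-- A bump function `B` supported where `f = g` gives `B * (f - g) = 0`; since `B z = 1`, the
Leibniz rule at `z` leaves `δ (f - g) = 0`. -/
theorem derivation_congr (hδ : ∀ f g, δ (f * g) = f z * δ g + g z * δ f)
    {f g : C^∞⟮𝓡 n, M; ℝ⟯} (h : ∀ᶠ y in nhds z, f y = g y) : δ f = δ g := by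
  obtain ⟨b, -, hb⟩ := (SmoothBumpFunction.nhds_basis_tsupport (I := 𝓡 n) z).mem_iff.1 h
  let B : C^∞⟮𝓡 n, M; ℝ⟯ := ⟨b, b.contMDiff⟩
  have hB : B z = 1 := b.eq_one
  have h0 : B * (f - g) = 0 := by
    ext x
    change b x * (f x - g x) = 0
    by_cases hx : b x = 0
    · rw [hx, zero_mul]
    · have : f x = g x := hb (subset_closure hx)
      rw [this, sub_self, mul_zero]
  have h1 := hδ B (f - g)
  have h2 : (f - g) z = 0 := sub_eq_zero.2 h.self_of_nhds
  rw [h0, map_zero, hB, h2, zero_mul, one_mul, add_zero, map_sub] at h1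
  exact sub_eq_zero.1 h1.symm

/-- A derivation at a point is given by a tangent vector. -/
theorem derivation_apply (hδ : ∀ f g, δ (f * g) = f z * δ g + g z * δ f) {z₀ : M}
    (hz : z ∈ (extChartAt (𝓡 n) z₀).source) {ξ : Fin n → C^∞⟮𝓡 n, M; ℝ⟯}
    (hξ : ∀ i, ∀ᶠ y in nhds z, ξ i y = extChartAt (𝓡 n) z₀ y i) (f : C^∞⟮𝓡 n, M; ℝ⟯) :
    δ f = fderiv ℝ (fun x => f ((extChartAt (𝓡 n) z₀).symm x)) (extChartAt (𝓡 n) z₀ z)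
      (WithLp.toLp 2 fun i => δ (ξ i)) := by
  set φ := extChartAt (𝓡 n) z₀ with hφ
  have hx : φ z ∈ φ.target := φ.map_source hz
  have h1 : ContDiffOn ℝ ∞ (fun x => f (φ.symm x)) φ.target := fun x hx =>
    (contDiffAt_comp_extChartAt_symm hx f.contMDiff.contMDiffAt).contDiffWithinAt
  obtain ⟨g, hg, hgf⟩ := h1.exists_contDiff_eventuallyEq (isOpen_extChartAt_target z₀) hx
  -- Hadamard's lemma writes `f` near `z` as `f z + ∑ l i * (ξ i - ξ i z)`. In the Leibniz rule only
  -- the values `l i z`, the partial derivatives of `f`, remain.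
  obtain ⟨L, hL, hL0, hgL⟩ := hg.exists_hadamard (φ z)
  let e : Fin n → EuclideanSpace ℝ (Fin n) := fun i => EuclideanSpace.basisFun (Fin n) ℝ i
  have hsum : ∀ (l : EuclideanSpace ℝ (Fin n) →L[ℝ] ℝ) v, l v = ∑ i, l (e i) * v i := by
    intro l v
    conv_lhs => rw [← (EuclideanSpace.basisFun (Fin n) ℝ).sum_repr v]
    rw [map_sum]
    refine Finset.sum_congr rfl fun i _ => ?_
    rw [map_smul, smul_eq_mul, mul_comm, EuclideanSpace.basisFun_repr]
  have h2 : ∀ i, ∃ F : C^∞⟮𝓡 n, M; ℝ⟯, ∀ᶠ y in nhds z, F y = L (φ y) (e i) := by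
    intro i
    refine exists_eventuallyEq_of_contMDiffOn (f := fun y => L (φ y) (e i))
      (isOpen_extChartAt_source z₀) (fun y hy => ?_) hz
    have h3 : ContDiff ℝ ∞ fun x : EuclideanSpace ℝ (Fin n) => L x (e i) :=
      hL.clm_apply contDiff_const
    have h4 : ContMDiffAt (𝓡 n) 𝓘(ℝ, EuclideanSpace ℝ (Fin n)) ∞ φ y :=
      contMDiffAt_extChartAt' (by rwa [← extChartAt_source (𝓡 n)])
    exact (h3.contMDiff.contMDiffAt.comp y h4).contMDiffWithinAt
  choose l hl using h2
  have hone : δ 1 = 0 := by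
    have := hδ 1 1
    rw [mul_one] at this
    have h1 : (1 : C^∞⟮𝓡 n, M; ℝ⟯) z = 1 := rfl
    rw [h1] at this
    linarith
  have hconst : ∀ c : ℝ, δ (c • 1) = 0 := fun c => by rw [map_smul, hone, smul_zero]
  have h5 : δ f = δ (f z • 1 + ∑ i, l i * (ξ i - φ z i • 1)) := by
    refine derivation_congr hδ ?_
    have h6 : ContinuousAt φ z := continuousAt_extChartAt' hz
    filter_upwards [h6.eventually hgf, Filter.eventually_all.2 hξ, Filter.eventually_all.2 hl,
      (isOpen_extChartAt_source z₀).mem_nhds hz] with y h7 h8 h9 h10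
    have h11 : g (φ z) = f z := hgf.self_of_nhds.trans (congrArg f (φ.left_inv hz))
    rw [φ.left_inv h10, hgL, hsum, h11] at h7
    rw [← h7, ContMDiffMap.coe_add, Pi.add_apply]
    congr 1
    · exact (mul_one _).symm
    · have h12 : (∑ i, l i * (ξ i - φ z i • 1) : C^∞⟮𝓡 n, M; ℝ⟯) y =
          ∑ i, (l i * (ξ i - φ z i • 1) : C^∞⟮𝓡 n, M; ℝ⟯) y :=
        map_sum (ContMDiffMap.evalRingHom y) _ _
      rw [h12]
      refine Finset.sum_congr rfl fun i _ => ?_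
      change _ = l i y * (ξ i y - φ z i * 1)
      rw [h8, h9, mul_one]
      rfl
  rw [h5, map_add, hconst, zero_add, map_sum, ← hgf.fderiv_eq, ← hL0, hsum]
  refine Finset.sum_congr rfl fun i _ => ?_
  have h13 : (ξ i - φ z i • 1 : C^∞⟮𝓡 n, M; ℝ⟯) z = 0 := by
    change ξ i z - φ z i * 1 = 0
    rw [(hξ i).self_of_nhds, mul_one, sub_self]
  rw [hδ, h13, zero_mul, add_zero, map_sub, hconst, sub_zero, (hl i).self_of_nhds]

end Germs

/-! ### Smooth germs, and testing vectors on global functions. -/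

section Coordinates

variable {n : ℕ} {M : Type*} [TopologicalSpace M] [ChartedSpace (EuclideanSpace ℝ (Fin n)) M]

/-- Near `z`, the function `f` coincides with a global smooth function. -/
def HasSmoothGerm (n : ℕ) {M : Type*} [TopologicalSpace M]
    [ChartedSpace (EuclideanSpace ℝ (Fin n)) M] (f : M → ℝ) (z : M) : Prop :=
  ∃ F : C^∞⟮𝓡 n, M; ℝ⟯, ∀ᶠ y in nhds z, F y = f y

theorem hasSmoothGerm_coe (F : C^∞⟮𝓡 n, M; ℝ⟯) (z : M) : HasSmoothGerm n F z :=
  ⟨F, Filter.Eventually.of_forall fun _ => rfl⟩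

theorem HasSmoothGerm.contMDiffAt {f : M → ℝ} {z : M} (h : HasSmoothGerm n f z) :
    ContMDiffAt (𝓡 n) 𝓘(ℝ, ℝ) ∞ f z := by
  obtain ⟨F, hF⟩ := h
  exact F.contMDiff.contMDiffAt.congr_of_eventuallyEq (hF.mono fun _ h => h.symm)

theorem eventually_nhds_extChartAt_symm {p : M → Prop} {z₀ : M} {x : EuclideanSpace ℝ (Fin n)}
    (hx : x ∈ (extChartAt (𝓡 n) z₀).target)
    (h : ∀ᶠ y in nhds ((extChartAt (𝓡 n) z₀).symm x), p y) :
    ∀ᶠ y in nhds x, p ((extChartAt (𝓡 n) z₀).symm y) :=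
  ((continuousOn_extChartAt_symm z₀).continuousAt
    ((isOpen_extChartAt_target z₀).mem_nhds hx)).eventually h

theorem fderiv_coordinate {z₀ : M} {x : EuclideanSpace ℝ (Fin n)}
    (hx : x ∈ (extChartAt (𝓡 n) z₀).target) {f : M → ℝ} {i : Fin n}
    (hf : ∀ᶠ y in nhds ((extChartAt (𝓡 n) z₀).symm x), f y = extChartAt (𝓡 n) z₀ y i)
    (v : EuclideanSpace ℝ (Fin n)) :
    fderiv ℝ (fun x => f ((extChartAt (𝓡 n) z₀).symm x)) x v = v i := by
  have h1 : (fun x => f ((extChartAt (𝓡 n) z₀).symm x)) =ᶠ[nhds x]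
      (EuclideanSpace.proj i : EuclideanSpace ℝ (Fin n) →L[ℝ] ℝ) := by
    filter_upwards [eventually_nhds_extChartAt_symm hx hf,
      (isOpen_extChartAt_target z₀).mem_nhds hx] with y hy hy'
    rw [hy, (extChartAt (𝓡 n) z₀).right_inv hy']
    rfl
  rw [h1.fderiv_eq, ContinuousLinearMap.fderiv]
  rfl

variable [IsManifold (𝓡 n) ∞ M]

theorem contMDiffAt_section_of_localVec {X : (z : M) → TangentSpace (𝓡 n) z} {z : M}
    (hX : ContDiffAt ℝ ∞ (localVec z X) (extChartAt (𝓡 n) z z)) :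
    ContMDiffAt (𝓡 n) (𝓡 n).tangent ∞ (fun z => (⟨z, X z⟩ : TangentBundle (𝓡 n) M)) z := by
  refine (Bundle.Trivialization.contMDiffAt_section_iff (IB := 𝓡 n) (n := ∞) (s := X)
    (e := trivializationAt (EuclideanSpace ℝ (Fin n)) (TangentSpace (𝓡 n)) z)
    (x₀ := z) (by simp)).2 ?_
  have h1 : ContMDiffAt (𝓡 n) 𝓘(ℝ, EuclideanSpace ℝ (Fin n)) ∞ (extChartAt (𝓡 n) z) z :=
    contMDiffAt_extChartAt
  refine (hX.contMDiffAt.comp z h1).congr_of_eventuallyEq ?_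
  filter_upwards [extChartAt_source_mem_nhds (I := 𝓡 n) z] with y hy
  have hy' : y ∈ (chartAt (EuclideanSpace ℝ (Fin n)) z).source := by
    rwa [← extChartAt_source (𝓡 n)]
  have h3 := TangentBundle.continuousLinearMapAt_trivializationAt (I := 𝓡 n) (M := M) hy'
  have h4 := DFunLike.congr_fun h3 (X y)
  rw [Bundle.Trivialization.continuousLinearMapAt_apply, Bundle.Trivialization.coe_linearMapAt_of_mem _
    (by simpa using hy')] at h4
  refine h4.trans ?_
  rw [Function.comp_apply, localVec, (extChartAt (𝓡 n) z).left_inv hy]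
  rfl

variable [T2Space M]

/-- Vectors are determined by the derivatives of smooth functions along them. -/
theorem chart_vector_ext {z₀ : M} {x : EuclideanSpace ℝ (Fin n)}
    (hx : x ∈ (extChartAt (𝓡 n) z₀).target) {v w : EuclideanSpace ℝ (Fin n)}
    (h : ∀ g : C^∞⟮𝓡 n, M; ℝ⟯, fderiv ℝ (fun x => g ((extChartAt (𝓡 n) z₀).symm x)) x v =
      fderiv ℝ (fun x => g ((extChartAt (𝓡 n) z₀).symm x)) x w) : v = w := by
  obtain ⟨ξ, hξ⟩ := exists_coordinates ((extChartAt (𝓡 n) z₀).map_target hx)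
  ext i
  rw [← fderiv_coordinate hx (hξ i), h, fderiv_coordinate hx (hξ i)]

theorem tangent_ext {z : M} {v w : EuclideanSpace ℝ (Fin n)}
    (h : ∀ g : C^∞⟮𝓡 n, M; ℝ⟯, differential n g z v = differential n g z w) : v = w := by
  have hz := mem_extChartAt_source (I := 𝓡 n) z
  refine (isInvertible_mfderiv_extChartAt (I := 𝓡 n) hz).injective
    (chart_vector_ext (z₀ := z) ((extChartAt (𝓡 n) z).map_source hz) fun g => ?_)
  have h1 := h g
  rw [differential_eq_fderiv_comp hz g.contMDiff.contMDiffAt] at h1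
  exact h1

end Coordinates

/-! ### Hamiltonian vectors and the bracket of local functions. -/

namespace PoissonStructure

variable {n : ℕ} {M : Type*} [TopologicalSpace M] [ChartedSpace (EuclideanSpace ℝ (Fin n)) M]
  (P : PoissonStructure n M)

/-- The derivation `g ↦ {g, F}(z)`. -/
noncomputable def evalBracket (F : C^∞⟮𝓡 n, M; ℝ⟯) (z : M) : C^∞⟮𝓡 n, M; ℝ⟯ →ₗ[ℝ] ℝ where
  toFun g := P.bracket g F z
  map_add' f g := by rw [P.add_left]; rfl
  map_smul' c f := by rw [P.smul_left]; rfl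

theorem evalBracket_mul (F : C^∞⟮𝓡 n, M; ℝ⟯) (z : M) (f g : C^∞⟮𝓡 n, M; ℝ⟯) :
    P.evalBracket F z (f * g) = f z * P.evalBracket F z g + g z * P.evalBracket F z f := by
  change P.bracket (f * g) F z = _
  rw [P.leibniz]
  rfl

theorem bracket_apply_skew (f g : C^∞⟮𝓡 n, M; ℝ⟯) (z : M) :
    P.bracket f g z = -P.bracket g f z := by
  rw [P.skew]
  rfl

theorem bracket_neg_right (f g : C^∞⟮𝓡 n, M; ℝ⟯) : P.bracket f (-g) = -P.bracket f g := by
  rw [P.skew, P.skew f g, ← neg_one_smul ℝ g, P.smul_left, neg_one_smul]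

/-- The Jacobi identity arranged as `[X_f, X_g] = X_{{g, f}}`, tested on `k`. -/
theorem bracket_bracket (f g k : C^∞⟮𝓡 n, M; ℝ⟯) :
    P.bracket (P.bracket k g) f - P.bracket (P.bracket k f) g =
      P.bracket k (P.bracket g f) := by
  have h := P.jacobi f k g
  rw [P.skew (P.bracket k g) f, P.skew (P.bracket k f) g, P.skew k f, bracket_neg_right, neg_neg]
  linear_combination -h

variable [IsManifold (𝓡 n) ∞ M] [T2Space M]

theorem bracket_congr {f f' g g' : C^∞⟮𝓡 n, M; ℝ⟯} {z : M} (hf : ∀ᶠ y in nhds z, f y = f' y)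
    (hg : ∀ᶠ y in nhds z, g y = g' y) : P.bracket f g z = P.bracket f' g' z := by
  have h1 : P.bracket f g z = P.bracket f' g z :=
    derivation_congr (P.evalBracket_mul g z) hf
  have h2 : P.bracket g f' z = P.bracket g' f' z :=
    derivation_congr (P.evalBracket_mul f' z) hg
  rw [h1, P.bracket_apply_skew, h2, ← P.bracket_apply_skew]

theorem exists_hamiltonian_vector (F : C^∞⟮𝓡 n, M; ℝ⟯) (z : M) :
    ∃ v : EuclideanSpace ℝ (Fin n), ∀ g : C^∞⟮𝓡 n, M; ℝ⟯,
      differential n g z v = P.bracket g F z := by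
  have hz := mem_extChartAt_source (I := 𝓡 n) z
  obtain ⟨ξ, hξ⟩ := exists_coordinates hz
  obtain ⟨v, hv⟩ := (isInvertible_mfderiv_extChartAt (I := 𝓡 n) hz).surjective
    (WithLp.toLp 2 fun i => P.bracket (ξ i) F z)
  refine ⟨v, fun g => ?_⟩
  rw [differential_eq_fderiv_comp hz g.contMDiff.contMDiffAt]
  refine (congrArg _ hv).trans ?_
  exact (derivation_apply (P.evalBracket_mul F z) hz hξ g).symm

/-- The value at `z` of the Hamiltonian vector field of a function that is smooth near `z`. -/
noncomputable def hamVec (f : M → ℝ) (z : M) : TangentSpace (𝓡 n) z :=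
  -- If `f` has no smooth germ at `z` the condition is vacuous and the value arbitrary.
  Classical.epsilon fun v : TangentSpace (𝓡 n) z =>
    ∀ F : C^∞⟮𝓡 n, M; ℝ⟯, (∀ᶠ y in nhds z, F y = f y) →
      ∀ g : C^∞⟮𝓡 n, M; ℝ⟯, differential n g z v = P.bracket g F z

/-- The Poisson bracket of locally defined smooth functions. -/
noncomputable def localBracket (f g : M → ℝ) (z : M) : ℝ :=
  differential n f z (P.hamVec g z)

/-- Derivations at a point come from vectors, and the bracket depends only on germs; so a vector
satisfying the condition for one representative of `f` satisfies it for all. -/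
theorem differential_hamVec {f : M → ℝ} {F : C^∞⟮𝓡 n, M; ℝ⟯} {z : M}
    (hF : ∀ᶠ y in nhds z, F y = f y) (g : C^∞⟮𝓡 n, M; ℝ⟯) :
    differential n g z (P.hamVec f z) = P.bracket g F z := by
  obtain ⟨v, hv⟩ := P.exists_hamiltonian_vector F z
  exact Classical.epsilon_spec (p := fun v : TangentSpace (𝓡 n) z =>
    ∀ F : C^∞⟮𝓡 n, M; ℝ⟯, (∀ᶠ y in nhds z, F y = f y) →
      ∀ g : C^∞⟮𝓡 n, M; ℝ⟯, differential n g z v = P.bracket g F z)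
    ⟨v, fun F' hF' g => (hv g).trans
      (P.bracket_congr (Filter.Eventually.of_forall fun _ => rfl)
        (hF.mp (hF'.mono fun y h h' => h'.trans h.symm)))⟩ F hF g

theorem localBracket_eq {f g : M → ℝ} {F G : C^∞⟮𝓡 n, M; ℝ⟯} {z : M}
    (hF : ∀ᶠ y in nhds z, F y = f y) (hG : ∀ᶠ y in nhds z, G y = g y) :
    P.localBracket f g z = P.bracket F G z := by
  have h : f =ᶠ[nhds z] F := hF.mono fun _ h => h.symm
  rw [localBracket, differential_congr h, P.differential_hamVec hG]

theorem hasSmoothGerm_localBracket {f g : M → ℝ} {z : M} (hf : HasSmoothGerm n f z)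
    (hg : HasSmoothGerm n g z) : HasSmoothGerm n (P.localBracket f g) z := by
  obtain ⟨F, hF⟩ := hf
  obtain ⟨G, hG⟩ := hg
  refine ⟨P.bracket F G, ?_⟩
  filter_upwards [eventually_eventually_nhds.2 hF, eventually_eventually_nhds.2 hG] with y h1 h2
  exact (P.localBracket_eq h1 h2).symm

theorem localBracket_skew {f g : M → ℝ} {z : M} (hf : HasSmoothGerm n f z)
    (hg : HasSmoothGerm n g z) : P.localBracket f g z = -P.localBracket g f z := by
  obtain ⟨F, hF⟩ := hf
  obtain ⟨G, hG⟩ := hg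
  rw [P.localBracket_eq hF hG, P.localBracket_eq hG hF, P.bracket_apply_skew]

/-- `X_f(z)` depends linearly on `df(z)`. -/
theorem hamVec_eq_sum {ι : Type*} [Fintype ι] {f : M → ℝ} {f' : ι → M → ℝ} {z : M} {a : ι → ℝ}
    (hf : HasSmoothGerm n f z) (hf' : ∀ i, HasSmoothGerm n (f' i) z)
    (h : differential n f z = ∑ i, a i • differential n (f' i) z) :
    (P.hamVec f z : EuclideanSpace ℝ (Fin n)) =
      ∑ i, a i • (P.hamVec (f' i) z : EuclideanSpace ℝ (Fin n)) := by
  refine tangent_ext (z := z) fun g => ?_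
  -- By skew-symmetry `dg(X_f) = -df(X_g)`, and the right side depends on `f` only through its
  -- differential, linearly.
  have h1 : ∀ {f : M → ℝ}, HasSmoothGerm n f z →
      differential n g z (P.hamVec f z) = -differential n f z (P.hamVec g z) := fun hf =>
    P.localBracket_skew (hasSmoothGerm_coe g z) hf
  have h2 : ∀ (w : EuclideanSpace ℝ (Fin n)) (u : ι → EuclideanSpace ℝ (Fin n)),
      (∀ i, differential n g z (u i) = -differential n (f' i) z w) →
      -(∑ i, a i • differential n (f' i) z) w = differential n g z (∑ i, a i • u i) := by
    intro w u hu
    rw [map_sum, sum_apply, ← Finset.sum_neg_distrib]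
    refine Finset.sum_congr rfl fun i _ => ?_
    rw [map_smul, hu, smul_neg]
    rfl
  rw [h1 hf, h]
  exact h2 _ _ fun i => h1 (hf' i)

theorem fderiv_localVec_hamVec {f : M → ℝ} {F : C^∞⟮𝓡 n, M; ℝ⟯} {z₀ : M}
    {x : EuclideanSpace ℝ (Fin n)} (hx : x ∈ (extChartAt (𝓡 n) z₀).target)
    (hF : ∀ᶠ y in nhds ((extChartAt (𝓡 n) z₀).symm x), F y = f y) (g : C^∞⟮𝓡 n, M; ℝ⟯) :
    fderiv ℝ (fun x => g ((extChartAt (𝓡 n) z₀).symm x)) x (localVec z₀ (P.hamVec f) x) =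
      P.bracket g F ((extChartAt (𝓡 n) z₀).symm x) := by
  rw [differential_apply_localVec hx g.contMDiff.contMDiffAt, P.differential_hamVec hF]

theorem contDiffAt_localVec_hamVec {f : M → ℝ} {z₀ : M}
    {x : EuclideanSpace ℝ (Fin n)} (hx : x ∈ (extChartAt (𝓡 n) z₀).target)
    (hf : HasSmoothGerm n f ((extChartAt (𝓡 n) z₀).symm x)) :
    ContDiffAt ℝ ∞ (localVec z₀ (P.hamVec f)) x := by
  obtain ⟨F, hF⟩ := hf
  obtain ⟨ξ, hξ⟩ := exists_coordinates ((extChartAt (𝓡 n) z₀).map_target hx)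
  rw [contDiffAt_euclidean]
  intro i
  refine (contDiffAt_comp_extChartAt_symm hx
    (P.bracket (ξ i) F).contMDiff.contMDiffAt).congr_of_eventuallyEq ?_
  filter_upwards [(isOpen_extChartAt_target z₀).mem_nhds hx,
    eventually_nhds_extChartAt_symm hx (eventually_eventually_nhds.2 hF),
    eventually_nhds_extChartAt_symm hx (eventually_eventually_nhds.2 (hξ i))] with y hy h1 h2
  rw [← P.fderiv_localVec_hamVec hy h1, fderiv_coordinate hy h2]

theorem contMDiffAt_hamVec {f : M → ℝ} {z : M} (hf : HasSmoothGerm n f z) :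
    ContMDiffAt (𝓡 n) (𝓡 n).tangent ∞
      (fun z => (⟨z, P.hamVec f z⟩ : TangentBundle (𝓡 n) M)) z := by
  have hz := mem_extChartAt_source (I := 𝓡 n) z
  refine contMDiffAt_section_of_localVec (P.contDiffAt_localVec_hamVec
    ((extChartAt (𝓡 n) z).map_source hz) ?_)
  rwa [(extChartAt (𝓡 n) z).left_inv hz]

/-- The Lie bracket of Hamiltonian vector fields is Hamiltonian. -/
theorem lieBracket_localVec_hamVec {f g : M → ℝ} {z₀ : M}
    {x : EuclideanSpace ℝ (Fin n)} (hx : x ∈ (extChartAt (𝓡 n) z₀).target)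
    (hf : HasSmoothGerm n f ((extChartAt (𝓡 n) z₀).symm x))
    (hg : HasSmoothGerm n g ((extChartAt (𝓡 n) z₀).symm x)) :
    VectorField.lieBracket ℝ (localVec z₀ (P.hamVec f)) (localVec z₀ (P.hamVec g)) x =
      localVec z₀ (P.hamVec (P.localBracket g f)) x := by
  -- Differentiating `{k, g} = dk(X_g)` along `X_f` produces a Hessian term, which cancels by
  -- symmetry when `f` and `g` are exchanged and the results are subtracted.
  have key : ∀ {f g : M → ℝ} {F G : C^∞⟮𝓡 n, M; ℝ⟯} (k : C^∞⟮𝓡 n, M; ℝ⟯),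
      (∀ᶠ y in nhds ((extChartAt (𝓡 n) z₀).symm x), F y = f y) →
      (∀ᶠ y in nhds ((extChartAt (𝓡 n) z₀).symm x), G y = g y) →
      P.bracket (P.bracket k G) F ((extChartAt (𝓡 n) z₀).symm x) =
        fderiv ℝ (fun x => k ((extChartAt (𝓡 n) z₀).symm x)) x
          (fderiv ℝ (localVec z₀ (P.hamVec g)) x (localVec z₀ (P.hamVec f) x)) +
        fderiv ℝ (fderiv ℝ fun x => k ((extChartAt (𝓡 n) z₀).symm x)) x
          (localVec z₀ (P.hamVec f) x) (localVec z₀ (P.hamVec g) x) := by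
    intro f g F G k hF hG
    have h1 : (fun y => fderiv ℝ (fun x => k ((extChartAt (𝓡 n) z₀).symm x)) y
        (localVec z₀ (P.hamVec g) y)) =ᶠ[nhds x]
        fun y => P.bracket k G ((extChartAt (𝓡 n) z₀).symm y) := by
      filter_upwards [(isOpen_extChartAt_target z₀).mem_nhds hx,
        eventually_nhds_extChartAt_symm hx (eventually_eventually_nhds.2 hG)] with y hy h1
      exact P.fderiv_localVec_hamVec hy h1 k
    have h2 : DifferentiableAt ℝ (fderiv ℝ fun x => k ((extChartAt (𝓡 n) z₀).symm x)) x :=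
      ((contDiffAt_comp_extChartAt_symm hx k.contMDiff.contMDiffAt).fderiv_right
        (m := 1) (by exact WithTop.coe_le_coe.2 (le_top (a := (2 : ℕ∞))))).differentiableAt (by simp)
    have h3 : DifferentiableAt ℝ (localVec z₀ (P.hamVec g)) x :=
      (P.contDiffAt_localVec_hamVec hx ⟨G, hG⟩).differentiableAt (by simp)
    have h4 := h2.hasFDerivAt.clm_apply h3.hasFDerivAt
    rw [← P.fderiv_localVec_hamVec hx hF (P.bracket k G), ← h1.fderiv_eq, h4.fderiv]
    rfl
  obtain ⟨F, hF⟩ := hf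
  obtain ⟨G, hG⟩ := hg
  have hGF : ∀ᶠ y in nhds ((extChartAt (𝓡 n) z₀).symm x), P.bracket G F y =
      P.localBracket g f y := by
    filter_upwards [eventually_eventually_nhds.2 hF, eventually_eventually_nhds.2 hG] with y h1 h2
    exact (P.localBracket_eq h2 h1).symm
  refine chart_vector_ext hx fun k => ?_
  have hsymm := (contDiffAt_comp_extChartAt_symm hx k.contMDiff.contMDiffAt).isSymmSndFDerivAt
    (by rw [minSmoothness_of_isRCLikeNormedField]
        exact WithTop.coe_le_coe.2 (le_top (a := (2 : ℕ∞))))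
    (localVec z₀ (P.hamVec f) x) (localVec z₀ (P.hamVec g) x)
  have h5 := key k hF hG
  have h6 := key k hG hF
  rw [P.fderiv_localVec_hamVec hx hGF, ← P.bracket_bracket, VectorField.lieBracket, map_sub]
  change _ = P.bracket (P.bracket k G) F _ - P.bracket (P.bracket k F) G _
  rw [h5, h6, hsymm]
  ring

/-- The Hamiltonian vector field of a smooth function on an open set. -/
noncomputable def hamField {U : Set M} (hU : IsOpen U) {f : M → ℝ}
    (hf : ContMDiffOn (𝓡 n) 𝓘(ℝ, ℝ) ∞ f U) : LocalVectorField n M where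
  dom := U
  isOpen_dom := hU
  vec := P.hamVec f
  smooth := fun _ hz => (P.contMDiffAt_hamVec
    (exists_eventuallyEq_of_contMDiffOn hU hf hz)).contMDiffWithinAt

theorem isHamiltonianField_hamField {U : Set M} (hU : IsOpen U) {f : M → ℝ}
    (hf : ContMDiffOn (𝓡 n) 𝓘(ℝ, ℝ) ∞ f U) : P.IsHamiltonianField (P.hamField hU hf) f :=
  fun _ _ _ hF g => P.differential_hamVec hF g

theorem IsHamiltonianField.vec_eq {X : LocalVectorField n M} {f : M → ℝ}
    (hX : P.IsHamiltonianField X f) {z : M} (hz : z ∈ X.dom) (hf : HasSmoothGerm n f z) :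
    X.vec z = P.hamVec f z := by
  obtain ⟨F, hF⟩ := hf
  exact tangent_ext (z := z) fun g => (hX z hz F hF g).trans (P.differential_hamVec hF g).symm

end PoissonStructure

/-- The coefficients with respect to a continuous family of linearly independent vectors depend
continuously on the parameter. -/
theorem exists_coefficients {V : Type*} [NormedAddCommGroup V] [NormedSpace ℝ V]
    [FiniteDimensional ℝ V] {r : ℕ} {α : Fin r → ℝ → V} {t₀ : ℝ}
    (hα : ∀ i, ∀ᶠ t in nhds t₀, ContinuousAt (α i) t)
    (hli : LinearIndependent ℝ fun i => α i t₀) :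
    ∃ Q : ℝ → V →L[ℝ] (Fin r → ℝ), ∀ᶠ t in nhds t₀, ContinuousAt Q t ∧
      ∀ a : Fin r → ℝ, Q t (∑ i, a i • α i t) = a := by
  let Λ : ℝ → (Fin r → ℝ) →L[ℝ] V := fun t =>
    ∑ i, (ContinuousLinearMap.proj i : (Fin r → ℝ) →L[ℝ] ℝ).smulRight (α i t)
  have hΛ : ∀ t a, Λ t a = ∑ i, a i • α i t := fun t a => by
    simp only [Λ, sum_apply]
    rfl
  have hinj : Function.Injective (Λ t₀).toLinearMap := by
    rw [← LinearMap.ker_eq_bot, LinearMap.ker_eq_bot']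
    intro a ha
    exact funext (Fintype.linearIndependent_iff.1 hli a ((hΛ t₀ a).symm.trans ha))
  -- A left inverse of the synthesis map at `t₀`, composed with the map at time `t`, is near the
  -- identity and so invertible; `Q t` is its inverse followed by this correction.
  obtain ⟨p, hp⟩ := LinearMap.exists_leftInverse_of_injective (Λ t₀).toLinearMap
    (LinearMap.ker_eq_bot.2 hinj)
  let p' : V →L[ℝ] (Fin r → ℝ) := p.toContinuousLinearMap
  let S : ℝ → (Fin r → ℝ) →L[ℝ] (Fin r → ℝ) := fun t => p'.comp (Λ t)
  have hcont : ∀ t, (∀ i, ContinuousAt (α i) t) → ContinuousAt S t := by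
    intro t ht
    have h1 : ContinuousAt Λ t := tendsto_finsetSum _ fun i _ =>
      ((ContinuousLinearMap.smulRightL ℝ (Fin r → ℝ) V
        (ContinuousLinearMap.proj i : (Fin r → ℝ) →L[ℝ] ℝ)).continuous.continuousAt.comp (ht i))
    exact (continuousAt_const (y := p')).clm_comp h1
  have hS0 : S t₀ = 1 := by
    ext1 a
    exact DFunLike.congr_fun hp a
  have hall := Filter.eventually_all.2 hα
  have hunit : ∀ᶠ t in nhds t₀, IsUnit (S t) := by
    refine (hcont t₀ hall.self_of_nhds).eventually (Units.isOpen.mem_nhds ?_)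
    change IsUnit (S t₀)
    rw [hS0]
    exact isUnit_one
  refine ⟨fun t => (Ring.inverse (S t)).comp p', ?_⟩
  filter_upwards [hall, hunit] with t ht hu
  constructor
  · obtain ⟨w, hw⟩ := hu
    have h2 : ContinuousAt Ring.inverse (S t) := hw ▸ NormedRing.inverse_continuousAt w
    exact (ContinuousAt.comp (f := S) h2 (hcont t ht)).clm_comp continuousAt_const
  · intro a
    rw [← hΛ]
    exact DFunLike.congr_fun (Ring.inverse_mul_cancel _ hu) a

/-! ### Flow invariance of polar distributions. -/

namespace PoissonStructure

variable {n : ℕ} {M : Type*} [TopologicalSpace M] [ChartedSpace (EuclideanSpace ℝ (Fin n)) M]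
  (P : PoissonStructure n M)

/-- The differentials at `z` of the locally defined `T`-invariant functions. -/
noncomputable def invariantCovectors (n : ℕ) {M : Type*} [TopologicalSpace M]
    [ChartedSpace (EuclideanSpace ℝ (Fin n)) M] (T : Set (M →. M)) (z : M) :
    Submodule ℝ (EuclideanSpace ℝ (Fin n) →L[ℝ] ℝ) :=
  Submodule.span ℝ {α | ∃ (U : Set M) (f : M → ℝ), IsOpen U ∧ IsInvariantSet T U ∧
    IsSmoothInvariantOn n T U f ∧ z ∈ U ∧ α = differential n f z}

variable [IsManifold (𝓡 n) ∞ M]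

theorem sum_differential_eq {r : ℕ} {f : Fin r → M → ℝ} {z₀ : M} {x : EuclideanSpace ℝ (Fin n)}
    (hx : x ∈ (extChartAt (𝓡 n) z₀).target)
    (hf : ∀ i, HasSmoothGerm n (f i) ((extChartAt (𝓡 n) z₀).symm x)) (a : Fin r → ℝ) :
    ∑ i, a i • differential n (f i) ((extChartAt (𝓡 n) z₀).symm x) =
      (∑ i, a i • fderiv ℝ (fun x => f i ((extChartAt (𝓡 n) z₀).symm x)) x).comp
        (mfderiv (𝓡 n) 𝓘(ℝ, EuclideanSpace ℝ (Fin n)) (extChartAt (𝓡 n) z₀)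
          ((extChartAt (𝓡 n) z₀).symm x)) := by
  refine ContinuousLinearMap.ext fun v => ?_
  have h1 : ∀ i, differential n (f i) ((extChartAt (𝓡 n) z₀).symm x) v =
      fderiv ℝ (fun x => f i ((extChartAt (𝓡 n) z₀).symm x)) x
        (mfderiv (𝓡 n) 𝓘(ℝ, EuclideanSpace ℝ (Fin n)) (extChartAt (𝓡 n) z₀)
          ((extChartAt (𝓡 n) z₀).symm x) v) := by
    intro i
    rw [differential_eq_fderiv_comp ((extChartAt (𝓡 n) z₀).map_target hx) (hf i).contMDiffAt,
      (extChartAt (𝓡 n) z₀).right_inv hx]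
    rfl
  have h2 : ∀ w : EuclideanSpace ℝ (Fin n), (∀ i,
      differential n (f i) ((extChartAt (𝓡 n) z₀).symm x) v =
        fderiv ℝ (fun x => f i ((extChartAt (𝓡 n) z₀).symm x)) x w) →
      (∑ i, a i • differential n (f i) ((extChartAt (𝓡 n) z₀).symm x)) v =
        (∑ i, a i • fderiv ℝ (fun x => f i ((extChartAt (𝓡 n) z₀).symm x)) x) w := by
    intro w hw
    rw [sum_apply, sum_apply]
    exact Finset.sum_congr rfl fun i _ => congrArg (a i • ·) (hw i)
  exact h2 _ h1

theorem continuousAt_fderiv_comp {f : M → ℝ} {z₀ : M} {c : ℝ → EuclideanSpace ℝ (Fin n)} {t : ℝ}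
    (hx : c t ∈ (extChartAt (𝓡 n) z₀).target)
    (hf : HasSmoothGerm n f ((extChartAt (𝓡 n) z₀).symm (c t))) (hc : ContinuousAt c t) :
    ContinuousAt (fun t => fderiv ℝ (fun x => f ((extChartAt (𝓡 n) z₀).symm x)) (c t)) t := by
  have h1 := ((contDiffAt_comp_extChartAt_symm hx hf.contMDiffAt).fderiv_right
        (m := 1) (by exact WithTop.coe_le_coe.2 (le_top (a := (2 : ℕ∞))))).continuousAt
  exact ContinuousAt.comp (f := c) h1 hc

variable [T2Space M] {T : Set (M →. M)}

theorem hamField_mem_polarFamily {U : Set M} (hU : IsOpen U) (hUT : IsInvariantSet T U) {f : M → ℝ}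
    (hf : IsSmoothInvariantOn n T U f) : P.hamField hU hf.1 ∈ P.polarFamily T :=
  ⟨hUT, f, hf, P.isHamiltonianField_hamField hU hf.1⟩

/-- The zero function is invariant on the whole of `M`. -/
theorem polarFamily_covers (z : M) : ∃ X ∈ P.polarFamily T, z ∈ X.dom :=
  ⟨_, P.hamField_mem_polarFamily isOpen_univ (fun _ _ _ _ _ _ => mem_univ _)
    (f := fun _ => 0) ⟨contMDiffOn_const, fun _ _ _ _ _ _ => rfl⟩, mem_univ z⟩

/-- Since `X_f(z)` is linear in `df(z)`, functions whose differentials span the invariant covectors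
have Hamiltonian vectors spanning the polar. -/
theorem polarDistribution_eq_span {r : ℕ} {f : Fin r → M → ℝ} {U : Fin r → Set M} {z : M}
    (hf : ∀ i, IsOpen (U i) ∧ IsInvariantSet T (U i) ∧ IsSmoothInvariantOn n T (U i) (f i) ∧
      z ∈ U i)
    (hspan : Submodule.span ℝ (range fun i => differential n (f i) z) = invariantCovectors n T z) :
    P.polarDistribution T z = Submodule.span ℝ (range fun i => P.hamVec (f i) z) := by
  have hgerm : ∀ i, HasSmoothGerm n (f i) z := fun i =>
    exists_eventuallyEq_of_contMDiffOn (hf i).1 (hf i).2.2.1.1 (hf i).2.2.2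
  apply le_antisymm
  · refine Submodule.span_le.2 ?_
    rintro _ ⟨X, ⟨hXT, g, hg, hX⟩, hz, rfl⟩
    have hgz : HasSmoothGerm n g z := exists_eventuallyEq_of_contMDiffOn X.isOpen_dom hg.1 hz
    have h1 : differential n g z ∈ invariantCovectors n T z :=
      Submodule.subset_span ⟨X.dom, g, X.isOpen_dom, hXT, hg, hz, rfl⟩
    rw [← hspan, Submodule.mem_span_range_iff_exists_fun] at h1
    obtain ⟨a, ha⟩ := h1
    have h2 := P.hamVec_eq_sum hgz hgerm ha.symm
    have h3 : (X.vec z : EuclideanSpace ℝ (Fin n)) =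
        ∑ i, a i • (P.hamVec (f i) z : EuclideanSpace ℝ (Fin n)) := (hX.vec_eq P hz hgz).trans h2
    exact (Submodule.mem_span_range_iff_exists_fun ℝ).2 ⟨a, h3.symm⟩
  · refine Submodule.span_le.2 ?_
    rintro _ ⟨i, rfl⟩
    exact Submodule.subset_span ⟨_, P.hamField_mem_polarFamily (hf i).1 (hf i).2.1 (hf i).2.2.1,
      (hf i).2.2.2, rfl⟩

/-- The polar distribution is preserved by the flows of the polar family, provided that invariant
functions are closed under the bracket and that the rank of their differentials is locally
constant along the flows. -/
theorem isFlowInvariant_polarDistribution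
    (hbr : ∀ (U : Set M) (f g : M → ℝ), IsOpen U → IsInvariantSet T U →
      IsSmoothInvariantOn n T U f → IsSmoothInvariantOn n T U g →
      ∀ F ∈ T, ∀ z ∈ U, ∀ z' ∈ F z, P.localBracket f g z' = P.localBracket f g z)
    (hrank : ∀ X ∈ P.polarFamily T, ∀ (γ : ℝ → M) (a b : ℝ), X.IsCurveOn γ a b →
      ∀ t₀ ∈ Ioo a b, ∀ᶠ t in nhds t₀, Module.finrank ℝ (invariantCovectors n T (γ t)) ≤
        Module.finrank ℝ (invariantCovectors n T (γ t₀)))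
    {X : LocalVectorField n M} (hX : X ∈ P.polarFamily T) (z₀ : M) :
    IsFlowInvariant (localVec z₀ X.vec) (X.chartDom z₀) (localDist z₀ (P.polarDistribution T)) := by
  refine isFlowInvariant_of_lieBracket ?_
  intro a b c hc t₀ ht₀
  set φ := extChartAt (𝓡 n) z₀ with hφ
  have hγ := X.isCurveOn_of_hasDerivAt hc
  -- Invariant functions `f i` whose differentials form a basis of the invariant covectors at time
  -- `t₀`; their Hamiltonian fields serve as the frame near `t₀`.
  obtain ⟨α, hα, hspan, hli⟩ := Submodule.exists_fun_fin_finrank_span_eq ℝ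
    {α | ∃ (U : Set M) (f : M → ℝ), IsOpen U ∧ IsInvariantSet T U ∧
      IsSmoothInvariantOn n T U f ∧ φ.symm (c t₀) ∈ U ∧ α = differential n f (φ.symm (c t₀))}
  choose U f hU hUT hf hz hα using hα
  obtain rfl : α = fun i => differential n (f i) (φ.symm (c t₀)) := funext hα
  have hr := hrank X hX _ a b hγ t₀ ht₀
  change ∀ᶠ t in nhds t₀, Module.finrank ℝ (invariantCovectors n T (φ.symm (c t))) ≤
    Module.finrank ℝ (invariantCovectors n T (φ.symm (c t₀))) at hr
  obtain ⟨hXT, f₀, hf₀, hXf₀⟩ := hX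
  have hct : ∀ t ∈ Ioo a b, c t ∈ φ.target := fun t ht => (hc t ht).1.1
  have hcont : ∀ t ∈ Ioo a b, ContinuousAt c t := fun t ht => (hc t ht).2.continuousAt
  have hUt : ∀ᶠ t in nhds t₀, ∀ i, φ.symm (c t) ∈ U i :=
    Filter.eventually_all.2 fun i => (hγ.continuousAt ht₀).eventually ((hU i).mem_nhds (hz i))
  have hgerm : ∀ i, ∀ z ∈ U i, HasSmoothGerm n (f i) z := fun i z hz =>
    exists_eventuallyEq_of_contMDiffOn (hU i) (hf i).1 hz
  have hgerm₀ : ∀ z ∈ X.dom, HasSmoothGerm n f₀ z := fun z hz =>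
    exists_eventuallyEq_of_contMDiffOn X.isOpen_dom hf₀.1 hz
  have hUt₀ := hUt.self_of_nhds
  have hIoo := isOpen_Ioo.mem_nhds ht₀
  obtain ⟨Q, hQ⟩ := exists_coefficients
    (α := fun i t => fderiv ℝ (fun x => f i (φ.symm x)) (c t)) (t₀ := t₀)
    (fun i => by
      filter_upwards [hIoo, hUt] with t ht htU
      exact continuousAt_fderiv_comp (hct t ht) (hgerm i _ (htU i)) (hcont t ht))
    (by
      rw [Fintype.linearIndependent_iff]
      intro a ha
      refine Fintype.linearIndependent_iff.1 hli a ?_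
      rw [sum_differential_eq (hct t₀ ht₀) fun i => hgerm i _ (hUt₀ i), ha]
      exact ContinuousLinearMap.zero_comp _)
  -- The bracket of `X_{f₀}` with `X_{f i}` is the Hamiltonian field of `{f i, f₀}`, so its
  -- coefficients are those of `d{f i, f₀}` in the basis `d(f i)`, extracted continuously by `Q t`.
  refine ⟨_, fun i => localVec z₀ (P.hamVec (f i)),
    fun i j t => Q t (fderiv ℝ (fun x => P.localBracket (f i) f₀ (φ.symm x)) (c t)) j, ?_⟩
  filter_upwards [hIoo, hUt, hr, hQ] with t ht htU hrt hQt
  have hx := hct t ht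
  have hX0 : φ.symm (c t) ∈ X.dom := (hγ t ht).1
  have hgt : ∀ i, HasSmoothGerm n (f i) (φ.symm (c t)) := fun i => hgerm i _ (htU i)
  have hbgerm : ∀ i, HasSmoothGerm n (P.localBracket (f i) f₀) (φ.symm (c t)) := fun i =>
    P.hasSmoothGerm_localBracket (hgt i) (hgerm₀ _ hX0)
  have hinv := isInvertible_mfderiv_extChartAt (I := 𝓡 n) (φ.map_target hx)
  have hcancel : ∀ l l' : EuclideanSpace ℝ (Fin n) →L[ℝ] ℝ,
      l.comp (mfderiv (𝓡 n) 𝓘(ℝ, EuclideanSpace ℝ (Fin n)) φ (φ.symm (c t))) =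
      l'.comp (mfderiv (𝓡 n) 𝓘(ℝ, EuclideanSpace ℝ (Fin n)) φ (φ.symm (c t))) → l = l' := by
    intro l l' h
    refine ContinuousLinearMap.ext fun v => ?_
    obtain ⟨w, rfl⟩ := hinv.surjective v
    exact DFunLike.congr_fun h w
  -- Independence persists near `t₀`, and the rank hypothesis forbids further invariant covectors,
  -- so the same functions still span.
  have hspant : Submodule.span ℝ (range fun i => differential n (f i) (φ.symm (c t))) =
      invariantCovectors n T (φ.symm (c t)) := by
    refine Submodule.eq_of_le_of_finrank_le (Submodule.span_le.2 ?_) ?_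
    · rintro _ ⟨i, rfl⟩
      exact Submodule.subset_span ⟨U i, f i, hU i, hUT i, hf i, htU i, rfl⟩
    · have hlit : LinearIndependent ℝ fun i => differential n (f i) (φ.symm (c t)) := by
        rw [Fintype.linearIndependent_iff]
        intro a ha
        rw [sum_differential_eq hx hgt] at ha
        have h1 := hcancel _ 0 (ha.trans (ContinuousLinearMap.zero_comp _).symm)
        have h2 := hQt.2 a
        rw [h1, map_zero] at h2
        exact fun i => congrFun h2.symm i
      rw [finrank_span_eq_card hlit, Fintype.card_fin]
      exact hrt
  refine ⟨fun i j => ?_, ?_, fun i => ⟨?_, ?_⟩⟩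
  · have h1 := hQt.1.clm_apply (continuousAt_fderiv_comp hx (hbgerm i) (hcont t ht))
    exact (continuous_apply j).continuousAt.comp h1
  · rw [localDist, P.polarDistribution_eq_span
      (fun i => ⟨hU i, hUT i, hf i, htU i⟩) hspant]
    have hmap : ∀ L : TangentSpace (𝓡 n) (φ.symm (c t)) →ₗ[ℝ] EuclideanSpace ℝ (Fin n),
        (Submodule.span ℝ (range fun i => P.hamVec (f i) (φ.symm (c t)))).map L =
        Submodule.span ℝ (range fun i => L (P.hamVec (f i) (φ.symm (c t)))) := fun L => by
      rw [Submodule.map_span, ← range_comp]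
      rfl
    exact hmap _
  · exact (P.contDiffAt_localVec_hamVec hx (hgt i)).differentiableAt (by simp)
  · have h1 : localVec z₀ X.vec =ᶠ[nhds (c t)] localVec z₀ (P.hamVec f₀) := by
      filter_upwards [(X.isOpen_chartDom z₀).mem_nhds (hc t ht).1] with y hy
      rw [localVec, localVec, hXf₀.vec_eq P hy.2 (hgerm₀ _ hy.2)]
    rw [h1.lieBracket_vectorField_eq Filter.EventuallyEq.rfl,
      P.lieBracket_localVec_hamVec hx (hgerm₀ _ hX0) (hgt i)]
    -- Here the closure of invariant functions under the bracket enters, on `U i ∩ X.dom`.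
    have h2 : differential n (P.localBracket (f i) f₀) (φ.symm (c t)) ∈
        invariantCovectors n T (φ.symm (c t)) := by
      refine Submodule.subset_span ⟨U i ∩ X.dom, _, (hU i).inter X.isOpen_dom,
        fun F hF z hz z' hz' => ⟨hUT i F hF z hz.1 z' hz', hXT F hF z hz.2 z' hz'⟩,
        ⟨fun z hz => (P.hasSmoothGerm_localBracket (hgerm i z hz.1)
          (hgerm₀ z hz.2)).contMDiffAt.contMDiffWithinAt, ?_⟩, ⟨htU i, hX0⟩, rfl⟩
      exact hbr _ _ _ ((hU i).inter X.isOpen_dom)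
        (fun F hF z hz z' hz' => ⟨hUT i F hF z hz.1 z' hz', hXT F hF z hz.2 z' hz'⟩)
        ⟨(hf i).1.mono inter_subset_left, fun F hF z hz => (hf i).2 F hF z hz.1⟩
        ⟨hf₀.1.mono inter_subset_right, fun F hF z hz => hf₀.2 F hF z hz.2⟩
    rw [← hspant, Submodule.mem_span_range_iff_exists_fun] at h2
    obtain ⟨a, ha⟩ := h2
    have h3 := P.hamVec_eq_sum (hbgerm i) hgt ha.symm
    have h4 : fderiv ℝ (fun x => P.localBracket (f i) f₀ (φ.symm x)) (c t) =
        ∑ j, a j • fderiv ℝ (fun x => f j (φ.symm x)) (c t) := by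
      apply hcancel
      rw [← sum_differential_eq hx hgt, ha]
      rw [differential_eq_fderiv_comp (φ.map_target hx) (hbgerm i).contMDiffAt, φ.right_inv hx]
    rw [h4, hQt.2]
    have h5 : ∀ (L : EuclideanSpace ℝ (Fin n) →L[ℝ] EuclideanSpace ℝ (Fin n))
        (w : EuclideanSpace ℝ (Fin n)) (u : Fin _ → EuclideanSpace ℝ (Fin n)),
        w = ∑ j, a j • u j → L w = ∑ j, a j • L (u j) := by
      rintro L _ u rfl
      rw [map_sum]
      exact Finset.sum_congr rfl fun j _ => map_smul L _ _
    exact h5 (mfderiv (𝓡 n) 𝓘(ℝ, EuclideanSpace ℝ (Fin n)) φ (φ.symm (c t))) _ _ h3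

end PoissonStructure

theorem isInvariantSet_univ {M : Type*} (T : Set (M →. M)) : IsInvariantSet T univ :=
  fun _ _ _ _ _ _ => mem_univ _

/-! ### Invariance under a generated pseudogroup through derivatives. -/

section InvariantFunctions

variable {n : ℕ} {M : Type*} [TopologicalSpace M] [ChartedSpace (EuclideanSpace ℝ (Fin n)) M]

theorem isSmoothInvariantOn_univ {T : Set (M →. M)} {f : C^∞⟮𝓡 n, M; ℝ⟯}
    (hf : f ∈ invariantFunctions n T) : IsSmoothInvariantOn n T univ f :=
  ⟨f.contMDiff.contMDiffOn, fun F hF z _ z' hz' => hf F hF z z' hz'⟩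

/-- An invariant function descends to the quotient, and continuity there is automatic for the
quotient topology. -/
theorem pullbackFunctions_eq (T : Set (M →. M)) :
    pullbackFunctions n T = invariantFunctions n T := by
  ext f
  constructor
  · rintro ⟨φ, -, hφ⟩ F hF z z' hz'
    rw [hφ, hφ]
    exact congrArg φ (Quot.sound ⟨F, hF, hz'⟩).symm
  · intro hf
    refine ⟨Quot.lift f fun x y hxy => ?_, continuous_quot_lift _ f.contMDiff.continuous,
      fun m => rfl⟩
    obtain ⟨F, hF, hy⟩ := hxy
    exact (hf F hF x y hy).symm

variable [IsManifold (𝓡 n) ∞ M] {𝒟 : Set (LocalVectorField n M)}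

theorem LocalVectorField.IsCurveOn.eq_of_differential_eq_zero {X : LocalVectorField n M}
    {γ : ℝ → M} {a b : ℝ} (hγ : X.IsCurveOn γ a b) {f : M → ℝ}
    (hf : ∀ t ∈ Ioo a b, MDifferentiableAt (𝓡 n) 𝓘(ℝ, ℝ) f (γ t) ∧
      differential n f (γ t) (X.vec (γ t)) = 0) {s t : ℝ} (hs : s ∈ Ioo a b) (ht : t ∈ Ioo a b) :
    f (γ s) = f (γ t) := by
  have h : ∀ t ∈ Ioo a b, HasDerivAt (fun s => f (γ s)) 0 t := fun t ht => by
    have := hasDerivAt_comp_of_hasMFDerivAt (hγ t ht).2 (hf t ht).1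
    rwa [(hf t ht).2] at this
  exact isOpen_Ioo.is_const_of_deriv_eq_zero isPreconnected_Ioo
    (fun t ht => (h t ht).differentiableAt.differentiableWithinAt)
    (fun t ht => (h t ht).deriv) hs ht

variable [T2Space M]

theorem differential_vec_eq_zero {X : LocalVectorField n M} (hX : X ∈ 𝒟) {U : Set M}
    (hU : IsOpen U) {f : M → ℝ} (hf : IsSmoothInvariantOn n (generatedPseudogroup 𝒟) U f) {z : M}
    (hz : z ∈ U) (hzX : z ∈ X.dom) : differential n f z (X.vec z) = 0 := by
  obtain ⟨ε, hε, γ, hγ, rfl⟩ := X.exists_isCurveOn hzX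
  have h0 : (0 : ℝ) ∈ Ioo (-ε) ε := ⟨by linarith, hε⟩
  have h1 := hasDerivAt_comp_of_hasMFDerivAt (hγ 0 h0).2
    ((hf.1.contMDiffAt (hU.mem_nhds hz)).mdifferentiableAt (by simp))
  have h2 : (fun s => f (γ s)) =ᶠ[nhds 0] fun _ => f (γ 0) := by
    filter_upwards [isOpen_Ioo.mem_nhds h0] with t ht
    obtain ⟨F, hF, h⟩ := (hγ.flowsTo h0 ht).mem_orbitOf hX
    exact hf.2 F hF _ hz _ h
  exact h1.unique ((hasDerivAt_const _ _).congr_of_eventuallyEq h2)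

theorem eq_of_forall_differential_eq_zero {U : Set M}
    (hU : IsInvariantSet (generatedPseudogroup 𝒟) U) {f : M → ℝ}
    (hf : ∀ z ∈ U, MDifferentiableAt (𝓡 n) 𝓘(ℝ, ℝ) f z)
    (h : ∀ X ∈ 𝒟, ∀ z ∈ U, z ∈ X.dom → differential n f z (X.vec z) = 0) :
    ∀ F ∈ generatedPseudogroup 𝒟, ∀ z ∈ U, ∀ z' ∈ F z, f z' = f z := by
  intro F hF z hz z' hz'
  refine (generatedPseudogroup_induction (r := fun m m' => m ∈ U → m' ∈ U ∧ f m' = f m)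
    (fun X hX t m m' hflow hm => ?_) (fun a b c hab hbc ha => ?_) hF z z' hz' hz).2
  · obtain ⟨γ, a, b, h0, ht, hγ, rfl, rfl⟩ := (X.flowsTo_iff _ _ _).1 hflow
    have hγU : ∀ s ∈ Ioo a b, γ s ∈ U := fun s hs => by
      obtain ⟨F, hF, h⟩ := (hγ.flowsTo h0 hs).mem_orbitOf hX
      exact hU F hF _ hm _ h
    exact ⟨hγU t ht, hγ.eq_of_differential_eq_zero
      (fun s hs => ⟨hf _ (hγU s hs), h X hX _ (hγU s hs) (hγ s hs).1⟩) ht h0⟩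
  · obtain ⟨hb, h1⟩ := hab ha
    obtain ⟨hc, h2⟩ := hbc hb
    exact ⟨hc, h2.trans h1⟩

theorem IsSmoothInvariantOn.hasSmoothGerm {T : Set (M →. M)} {U : Set M} (hU : IsOpen U)
    {f : M → ℝ} (hf : IsSmoothInvariantOn n T U f) {z : M} (hz : z ∈ U) : HasSmoothGerm n f z :=
  exists_eventuallyEq_of_contMDiffOn hU hf.1 hz

end InvariantFunctions

/-! ### Commutation of invariants, bipolars and centralizers. -/

namespace PoissonStructure

variable {n : ℕ} {M : Type*} [TopologicalSpace M] [ChartedSpace (EuclideanSpace ℝ (Fin n)) M]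
  (P : PoissonStructure n M)

theorem bracket_zero_left (g : C^∞⟮𝓡 n, M; ℝ⟯) : P.bracket 0 g = 0 := by
  have := P.smul_left 0 0 g
  rwa [zero_smul, zero_smul] at this

theorem bracket_zero_right (g : C^∞⟮𝓡 n, M; ℝ⟯) : P.bracket g 0 = 0 := by
  rw [P.skew, bracket_zero_left, neg_zero]

variable {T : Set (M →. M)}

/-- Pull-back of covectors along a surjective map is injective; `B` will be the derivative of a flow
or of an element of `A`. -/
theorem finrank_invariantCovectors_le {z w : M}
    {B : EuclideanSpace ℝ (Fin n) →L[ℝ] EuclideanSpace ℝ (Fin n)} (hB : Function.Surjective B)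
    (h : ∀ (U : Set M) (f : M → ℝ), IsOpen U → IsInvariantSet T U → IsSmoothInvariantOn n T U f →
      z ∈ U → ∃ (V : Set M) (g : M → ℝ), IsOpen V ∧ IsInvariantSet T V ∧
        IsSmoothInvariantOn n T V g ∧ w ∈ V ∧ differential n g w = (differential n f z).comp B) :
    Module.finrank ℝ (invariantCovectors n T z) ≤ Module.finrank ℝ (invariantCovectors n T w) := by
  let L : (EuclideanSpace ℝ (Fin n) →L[ℝ] ℝ) →ₗ[ℝ] (EuclideanSpace ℝ (Fin n) →L[ℝ] ℝ) :=
    { toFun l := l.comp B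
      map_add' _ _ := rfl
      map_smul' _ _ := rfl }
  have hL : Function.Injective L := by
    intro l l' hl
    refine ContinuousLinearMap.ext fun v => ?_
    obtain ⟨u, rfl⟩ := hB v
    exact DFunLike.congr_fun hl u
  have h1 : (invariantCovectors n T z).map L ≤ invariantCovectors n T w := by
    rw [invariantCovectors, Submodule.map_span, Submodule.span_le]
    rintro _ ⟨_, ⟨U, f, hU, hUT, hf, hz, rfl⟩, rfl⟩
    obtain ⟨V, g, hV, hVT, hg, hw, hgf⟩ := h U f hU hUT hf hz
    exact Submodule.subset_span ⟨V, g, hV, hVT, hg, hw, hgf.symm⟩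
  rw [(Submodule.equivMapOfInjective L hL (invariantCovectors n T z)).finrank_eq]
  exact Submodule.finrank_mono h1

variable [IsManifold (𝓡 n) ∞ M] [T2Space M]

theorem differential_vec {X : LocalVectorField n M} {f : M → ℝ} (hX : P.IsHamiltonianField X f)
    {z : M} (hz : z ∈ X.dom) (hf : HasSmoothGerm n f z) (g : M → ℝ) :
    differential n g z (X.vec z) = P.localBracket g f z := by
  rw [hX.vec_eq P hz hf]
  rfl

/-- Functions invariant under `T` and functions invariant under the polar of `T` commute. -/
theorem localBracket_eq_zero {U V : Set M} {f g : M → ℝ} (hU : IsOpen U) (hUT : IsInvariantSet T U)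
    (hf : IsSmoothInvariantOn n T U f) (hV : IsOpen V)
    (hg : IsSmoothInvariantOn n (P.polarPseudogroup T) V g) {z : M} (hzU : z ∈ U) (hzV : z ∈ V) :
    P.localBracket g f z = 0 :=
  differential_vec_eq_zero (P.hamField_mem_polarFamily hU hUT hf) hV hg hzV hzU

theorem bracket_eq_zero {f g : C^∞⟮𝓡 n, M; ℝ⟯} (hf : f ∈ invariantFunctions n T)
    (hg : g ∈ invariantFunctions n (P.polarPseudogroup T)) : P.bracket g f = 0 := by
  ext z
  have h := P.localBracket_eq_zero isOpen_univ (isInvariantSet_univ T)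
    (isSmoothInvariantOn_univ hf) isOpen_univ (isSmoothInvariantOn_univ hg)
    (mem_univ z) (mem_univ z)
  rwa [P.localBracket_eq (Filter.Eventually.of_forall fun _ => rfl)
    (Filter.Eventually.of_forall fun _ => rfl)] at h

/-- The bipolar is generated by fields `X_h` with `h` invariant under the polar pseudogroup, and
such `h` commute with `T`-invariant functions. -/
theorem invariantFunctions_subset_bipolar :
    invariantFunctions n T ⊆
      invariantFunctions n (P.polarPseudogroup (P.polarPseudogroup T)) := by
  intro f hf F hF z z' hz'
  refine eq_of_forall_differential_eq_zero (isInvariantSet_univ _)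
    (fun z _ => f.contMDiff.contMDiffAt.mdifferentiableAt (by simp)) ?_ F hF z (mem_univ z) z' hz'
  rintro X ⟨hXT, h, hh, hX⟩ y - hy
  have hgerm := hh.hasSmoothGerm X.isOpen_dom hy
  rw [P.differential_vec hX hy hgerm, P.localBracket_skew (hasSmoothGerm_coe f y) hgerm,
    P.localBracket_eq_zero isOpen_univ (isInvariantSet_univ T) (isSmoothInvariantOn_univ hf)
      X.isOpen_dom hh (mem_univ y) hy, neg_zero]

theorem orbitOf_bipolar_subset (hT : SeparatesOrbits n T) (hself : ∀ m, m ∈ orbitOf T m) (m : M) :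
    orbitOf (P.polarPseudogroup (P.polarPseudogroup T)) m ⊆ orbitOf T m := by
  rintro m' ⟨F, hF, hm'⟩
  rw [hT m m' fun f hf => (P.invariantFunctions_subset_bipolar hf F hF m m' hm').symm]
  exact hself m'

/-- The polar family involves locally defined `f`, while the centralizer tests only global ones; the
extension property supplies a global function with the same germ. -/
theorem centralizer_subset (hT : HasExtensionProperty n T) :
    P.centralizer (invariantFunctions n T) ⊆ invariantFunctions n (P.polarPseudogroup T) := by
  intro h hh F hF z z' hz'
  refine eq_of_forall_differential_eq_zero (isInvariantSet_univ _)
    (fun z _ => h.contMDiff.contMDiffAt.mdifferentiableAt (by simp)) ?_ F hF z (mem_univ z) z' hz'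
  rintro X ⟨hXT, f, hf, hX⟩ y - hy
  obtain ⟨V, -, hV, -, hyV, F, hF, hFf⟩ := hT X.dom X.isOpen_dom hXT f hf y hy
  rw [P.differential_vec hX hy (hf.hasSmoothGerm X.isOpen_dom hy),
    P.localBracket_eq (F := h) (G := F) (Filter.Eventually.of_forall fun _ => rfl), hh F hF]
  · rfl
  · filter_upwards [hV.mem_nhds hyV] with x hx using (hFf hx).symm

theorem globalHamiltonianFields_subset (hT : HasExtensionProperty n T) :
    P.globalHamiltonianFields (P.centralizer (invariantFunctions n T)) ⊆
      P.polarFamily (P.polarPseudogroup T) := by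
  rintro X ⟨hdom, h, hh, hX⟩
  refine ⟨by rw [hdom]; exact isInvariantSet_univ _, h, ?_, hX⟩
  rw [hdom]
  exact isSmoothInvariantOn_univ (P.centralizer_subset hT hh)

/-- If `X_h` is in the polar family, then `{f, h}` and `{g, h}` vanish near the point, and the
Jacobi identity gives `{{f, g}, h} = 0`. -/
theorem localBracket_invariant_polarPseudogroup {U : Set M} {f g : M → ℝ} (hU : IsOpen U)
    (hUT : IsInvariantSet (P.polarPseudogroup T) U)
    (hf : IsSmoothInvariantOn n (P.polarPseudogroup T) U f)
    (hg : IsSmoothInvariantOn n (P.polarPseudogroup T) U g) :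
    ∀ F ∈ P.polarPseudogroup T, ∀ z ∈ U, ∀ z' ∈ F z,
      P.localBracket f g z' = P.localBracket f g z := by
  refine eq_of_forall_differential_eq_zero hUT (fun z hz => (P.hasSmoothGerm_localBracket
    (hf.hasSmoothGerm hU hz) (hg.hasSmoothGerm hU hz)).contMDiffAt.mdifferentiableAt (by simp)) ?_
  rintro X ⟨hXT, h, hh, hX⟩ y hy hyX
  obtain ⟨F, hF⟩ := hf.hasSmoothGerm hU hy
  obtain ⟨G, hG⟩ := hg.hasSmoothGerm hU hy
  obtain ⟨H, hH⟩ := hh.hasSmoothGerm X.isOpen_dom hyX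
  have hzero : ∀ {f : M → ℝ} {F : C^∞⟮𝓡 n, M; ℝ⟯},
      IsSmoothInvariantOn n (P.polarPseudogroup T) U f → (∀ᶠ x in nhds y, F x = f x) →
      ∀ᶠ x in nhds y, P.bracket F H x = (0 : C^∞⟮𝓡 n, M; ℝ⟯) x := by
    intro f F hf hF
    filter_upwards [eventually_eventually_nhds.2 hF, eventually_eventually_nhds.2 hH,
      hU.mem_nhds hy, X.isOpen_dom.mem_nhds hyX] with x h1 h2 h3 h4
    rw [← P.localBracket_eq h1 h2]
    exact P.localBracket_eq_zero X.isOpen_dom hXT hh hU hf h4 h3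
  have hFG : ∀ᶠ x in nhds y, P.bracket F G x = P.localBracket f g x := by
    filter_upwards [eventually_eventually_nhds.2 hF, eventually_eventually_nhds.2 hG] with x h1 h2
    exact (P.localBracket_eq h1 h2).symm
  have hrefl : ∀ K : C^∞⟮𝓡 n, M; ℝ⟯, ∀ᶠ x in nhds y, K x = K x := fun K =>
    Filter.Eventually.of_forall fun _ => rfl
  rw [P.differential_vec hX hyX ⟨H, hH⟩, P.localBracket_eq hFG hH]
  have h1 := DFunLike.congr_fun (P.bracket_bracket H G F) y
  have h2 : P.bracket (P.bracket F G) H y - P.bracket (P.bracket F H) G y =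
    P.bracket F (P.bracket G H) y := h1
  rw [P.bracket_congr (hzero hf hF) (hrefl G), P.bracket_congr (hrefl F) (hzero hg hG),
    P.bracket_zero_left, P.bracket_zero_right] at h2
  exact sub_eq_zero.1 h2

end PoissonStructure

/-! ### Groups viewed as sets of local transformations. -/

section GroupTransformations

variable {M : Type*} {A : Subgroup (Equiv.Perm M)}

theorem perm_inv_apply_self (a : Equiv.Perm M) (x : M) : a⁻¹ (a x) = x := a.symm_apply_apply x

theorem perm_apply_inv_self (a : Equiv.Perm M) (x : M) : a (a⁻¹ x) = x := a.apply_symm_apply x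

theorem forall_groupTransformations {U : Set M} {Q : M → M → Prop} :
    (∀ F ∈ groupTransformations A, ∀ z ∈ U, ∀ z' ∈ F z, Q z z') ↔
      ∀ a ∈ A, ∀ z ∈ U, Q z (a z) := by
  constructor
  · intro h a ha z hz
    exact h _ ⟨a, ha, rfl⟩ z hz _ (Part.mem_some _)
  · rintro h _ ⟨a, ha, rfl⟩ z hz z' hz'
    rw [Part.mem_some_iff.1 hz']
    exact h a ha z hz

theorem mem_orbitOf_groupTransformations {m m' : M} :
    m' ∈ orbitOf (groupTransformations A) m ↔ ∃ a ∈ A, m' = a m := by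
  constructor
  · rintro ⟨_, ⟨a, ha, rfl⟩, h⟩
    exact ⟨a, ha, Part.mem_some_iff.1 h⟩
  · rintro ⟨a, ha, rfl⟩
    exact ⟨_, ⟨a, ha, rfl⟩, Part.mem_some _⟩

theorem mem_orbitOf_groupTransformations_self (m : M) : m ∈ orbitOf (groupTransformations A) m :=
  mem_orbitOf_groupTransformations.2 ⟨1, A.one_mem, rfl⟩

end GroupTransformations

/-! ### Local flows on the manifold. -/

section LocalFlow

variable {n : ℕ} {M : Type*} [TopologicalSpace M] [ChartedSpace (EuclideanSpace ℝ (Fin n)) M]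
  [IsManifold (𝓡 n) ∞ M]

/-- The local flow of a vector field near a point of its domain. -/
theorem LocalVectorField.exists_localFlow (X : LocalVectorField n M) {p : M} (hp : p ∈ X.dom) :
    ∃ ε > 0, ∃ V : Set M, IsOpen V ∧ p ∈ V ∧ ∃ Ψ : ℝ → M → M,
      (∀ y ∈ V, Ψ 0 y = y ∧ X.IsCurveOn (fun s => Ψ s y) (-ε) ε) ∧
      ∀ s ∈ Ioo (-ε) ε, ContMDiffOn (𝓡 n) (𝓡 n) ∞ (Ψ s) V ∧
        Function.Surjective (mfderiv (𝓡 n) (𝓡 n) (Ψ s) p) := by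
  set φ := extChartAt (𝓡 n) p with hφ
  have hsrc := mem_extChartAt_source (I := 𝓡 n) p
  obtain ⟨ε, hε, V, hV, hpV, Φ, hΦ, h⟩ := (X.contDiffOn_localVec p).exists_localFlow
    (X.isOpen_chartDom p) (X.mem_chartDom hp hsrc)
  have hVopen : IsOpen (φ.source ∩ φ ⁻¹' V) :=
    (continuousOn_extChartAt p).isOpen_inter_preimage (isOpen_extChartAt_source p) hV
  have hsm : ∀ s ∈ Ioo (-ε) ε, ∀ y ∈ V, ContDiffAt ℝ ∞ (fun x => Φ (s, x)) y := by
    intro s hs y hy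
    exact ContDiffAt.comp (f := fun x => (s, x)) y
      (hΦ.contDiffAt ((isOpen_Ioo.prod hV).mem_nhds ⟨hs, hy⟩))
      (contDiff_const.prodMk contDiff_id).contDiffAt
  have htar : ∀ s ∈ Ioo (-ε) ε, ∀ y ∈ V, Φ (s, y) ∈ φ.target := fun s hs y hy =>
    ((h y hy).2 s hs).1.1
  refine ⟨ε, hε, _, hVopen, ⟨hsrc, hpV⟩, fun s y => φ.symm (Φ (s, φ y)), ?_, ?_⟩
  · rintro y ⟨hy, hyV⟩
    refine ⟨?_, X.isCurveOn_of_hasDerivAt fun t ht =>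
      ⟨((h _ hyV).2 t ht).1, ((h _ hyV).2 t ht).2.1⟩⟩
    change φ.symm (Φ (0, φ y)) = y
    rw [(h _ hyV).1, φ.left_inv hy]
  · intro s hs
    constructor
    · rintro y ⟨hy, hyV⟩
      have h1 : ContMDiffAt (𝓡 n) 𝓘(ℝ, EuclideanSpace ℝ (Fin n)) ∞ φ y :=
        contMDiffAt_extChartAt' (by rwa [← extChartAt_source (𝓡 n)])
      have h2 := (contMDiffOn_extChartAt_symm (I := 𝓡 n) (n := ∞) p).contMDiffAt
        ((isOpen_extChartAt_target p).mem_nhds (htar s hs _ hyV))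
      exact ((h2.comp (φ y) (hsm s hs _ hyV).contMDiffAt).comp y h1).contMDiffWithinAt
    · have h1 : HasMFDerivAt (𝓡 n) 𝓘(ℝ, EuclideanSpace ℝ (Fin n)) φ p
          (mfderiv (𝓡 n) 𝓘(ℝ, EuclideanSpace ℝ (Fin n)) φ p) :=
        (mdifferentiableAt_extChartAt (mem_chart_source _ p)).hasMFDerivAt
      have h2 := ((hsm s hs _ hpV).differentiableAt (by simp)).hasFDerivAt.hasMFDerivAt
      have h3 := (hasMFDerivAt_extChartAt_symm (htar s hs _ hpV)).comp p (h2.comp p h1)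
      have h4 := isInvertible_mfderiv_extChartAt (I := 𝓡 n) hsrc
      have h5 := ((h _ hpV).2 s hs).2.2.1
      have h6 := isInvertible_mfderiv_extChartAt (I := 𝓡 n) (φ.map_target (htar s hs _ hpV))
      intro v
      obtain ⟨u, hu⟩ := h5.surjective (mfderiv (𝓡 n) 𝓘(ℝ, EuclideanSpace ℝ (Fin n)) φ
        (φ.symm (Φ (s, φ p))) v)
      obtain ⟨w, hw⟩ := h4.surjective u
      refine ⟨w, (DFunLike.congr_fun h3.mfderiv w).trans ?_⟩
      refine Eq.trans ?_ (h6.inverse_apply_self v)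
      have h7 := (congrArg (fderiv ℝ (fun x => Φ (s, x)) (φ p)) hw).trans hu
      exact congrArg (mfderiv (𝓡 n) 𝓘(ℝ, EuclideanSpace ℝ (Fin n)) φ
        (φ.symm (Φ (s, φ p)))).inverse h7

end LocalFlow

/-! ### The action of `A` on polar flows and invariant covectors. -/

namespace PoissonStructure

variable {n : ℕ} {M : Type*} [TopologicalSpace M] [ChartedSpace (EuclideanSpace ℝ (Fin n)) M]
  (P : PoissonStructure n M)

theorem contMDiff_of_mem_automorphismGroup {a : Equiv.Perm M} (ha : a ∈ P.automorphismGroup) :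
    ContMDiff (𝓡 n) (𝓡 n) ∞ a := ha.1

theorem bracket_comp {a : Equiv.Perm M} (ha : a ∈ P.automorphismGroup)
    (f g : C^∞⟮𝓡 n, M; ℝ⟯) :
    P.bracket (f.comp ⟨a, P.contMDiff_of_mem_automorphismGroup ha⟩)
        (g.comp ⟨a, P.contMDiff_of_mem_automorphismGroup ha⟩) =
      (P.bracket f g).comp ⟨a, P.contMDiff_of_mem_automorphismGroup ha⟩ := ha.2.2 f g

theorem differential_comp {a : Equiv.Perm M} (ha : a ∈ P.automorphismGroup) {f : M → ℝ} {z : M}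
    (hf : MDifferentiableAt (𝓡 n) 𝓘(ℝ, ℝ) f (a z)) :
    differential n (fun x => f (a x)) z =
      (differential n f (a z)).comp (mfderiv (𝓡 n) (𝓡 n) a z) :=
  mfderiv_comp z hf ((P.contMDiff_of_mem_automorphismGroup ha).mdifferentiable (by simp) z)

theorem mfderiv_surjective {a : Equiv.Perm M} (ha : a ∈ P.automorphismGroup) (z : M) :
    Function.Surjective (mfderiv (𝓡 n) (𝓡 n) a z) := by
  have ha' := P.automorphismGroup.inv_mem ha
  have h1 : HasMFDerivAt (𝓡 n) (𝓡 n) a z (mfderiv (𝓡 n) (𝓡 n) a z) :=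
    ((P.contMDiff_of_mem_automorphismGroup ha).mdifferentiable (by simp) z).hasMFDerivAt
  have h2 : HasMFDerivAt (𝓡 n) (𝓡 n) (a⁻¹ : Equiv.Perm M) (a z)
      (mfderiv (𝓡 n) (𝓡 n) (a⁻¹ : Equiv.Perm M) (a z)) :=
    ((P.contMDiff_of_mem_automorphismGroup ha').mdifferentiable (by simp) (a z)).hasMFDerivAt
  have h3 : HasMFDerivAt (𝓡 n) (𝓡 n) a ((a⁻¹ : Equiv.Perm M) (a z))
      (mfderiv (𝓡 n) (𝓡 n) a z) := by
    rw [perm_inv_apply_self]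
    exact h1
  have h4 := h3.comp (a z) h2
  have h5 : HasMFDerivAt (𝓡 n) (𝓡 n) (a ∘ (a⁻¹ : Equiv.Perm M)) (a z)
      (ContinuousLinearMap.id ℝ (TangentSpace (𝓡 n) (a z))) :=
    (hasMFDerivAt_id (a z)).congr_of_eventuallyEq
      (Filter.Eventually.of_forall fun x => perm_apply_inv_self a x)
  intro v
  exact ⟨_, DFunLike.congr_fun (hasMFDerivAt_unique h4 h5) v⟩

theorem eventually_comp {a : Equiv.Perm M} (ha : a ∈ P.automorphismGroup) {z : M} {p : M → Prop}
    (h : ∀ᶠ y in nhds (a z), p y) : ∀ᶠ y in nhds z, p (a y) :=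
  (P.contMDiff_of_mem_automorphismGroup ha).continuous.continuousAt.eventually h

variable [IsManifold (𝓡 n) ∞ M] [T2Space M] {A : Subgroup (Equiv.Perm M)}

/-- Representatives of the germs at `a z`, composed with the Poisson map `a`, represent the same
invariant functions at `z`. -/
theorem localBracket_invariant_group (hA : A ≤ P.automorphismGroup) {U : Set M} {f g : M → ℝ} (hU : IsOpen U)
    (hUA : IsInvariantSet (groupTransformations A) U)
    (hf : IsSmoothInvariantOn n (groupTransformations A) U f)
    (hg : IsSmoothInvariantOn n (groupTransformations A) U g) :
    ∀ F ∈ groupTransformations A, ∀ z ∈ U, ∀ z' ∈ F z,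
      P.localBracket f g z' = P.localBracket f g z := by
  rw [forall_groupTransformations (Q := fun z z' => P.localBracket f g z' = P.localBracket f g z)]
  intro a ha z hz
  have haz : a z ∈ U := forall_groupTransformations.1 hUA a ha z hz
  have hinv : ∀ {f : M → ℝ} {F : C^∞⟮𝓡 n, M; ℝ⟯},
      IsSmoothInvariantOn n (groupTransformations A) U f → (∀ᶠ x in nhds (a z), F x = f x) →
      ∀ᶠ x in nhds z, F.comp ⟨a, P.contMDiff_of_mem_automorphismGroup (hA ha)⟩ x = f x := by
    intro f F hf hF
    filter_upwards [P.eventually_comp (hA ha) hF, hU.mem_nhds hz] with x h1 h2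
    exact h1.trans (forall_groupTransformations (Q := fun z z' => f z' = f z) |>.1 hf.2 a ha x h2)
  obtain ⟨F, hF⟩ := hf.hasSmoothGerm hU haz
  obtain ⟨G, hG⟩ := hg.hasSmoothGerm hU haz
  rw [P.localBracket_eq hF hG, P.localBracket_eq (hinv hf hF) (hinv hg hG), P.bracket_comp (hA ha)]
  rfl

/-- Elements of `A` map integral curves of the polar family of `A` to integral curves. -/
theorem isCurveOn_group_comp (hA : A ≤ P.automorphismGroup) {X : LocalVectorField n M}
    (hX : X ∈ P.polarFamily (groupTransformations A)) {a : Equiv.Perm M} (ha : a ∈ A) {γ : ℝ → M}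
    {s t : ℝ} (hγ : X.IsCurveOn γ s t) : X.IsCurveOn (fun r => a (γ r)) s t := by
  obtain ⟨hXA, f, hf, hXf⟩ := hX
  intro r hr
  obtain ⟨h1, h2⟩ := hγ r hr
  have haz : a (γ r) ∈ X.dom := forall_groupTransformations.1 hXA a ha _ h1
  refine ⟨haz, ?_⟩
  have h3 : HasMFDerivAt (𝓡 n) (𝓡 n) a (γ r) (mfderiv (𝓡 n) (𝓡 n) a (γ r)) :=
    ((P.contMDiff_of_mem_automorphismGroup (hA ha)).mdifferentiable (by simp) _).hasMFDerivAt
  have h4 : mfderiv (𝓡 n) (𝓡 n) a (γ r) (X.vec (γ r)) = X.vec (a (γ r)) := by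
    obtain ⟨F, hF⟩ := hf.hasSmoothGerm X.isOpen_dom haz
    have hF' : ∀ᶠ x in nhds (γ r),
        F.comp ⟨a, P.contMDiff_of_mem_automorphismGroup (hA ha)⟩ x = f x := by
      filter_upwards [P.eventually_comp (hA ha) hF, X.isOpen_dom.mem_nhds h1] with x h1 h2
      exact h1.trans (forall_groupTransformations (Q := fun z z' => f z' = f z) |>.1 hf.2 a ha x h2)
    refine tangent_ext (z := a (γ r)) fun g => ?_
    have h5 := P.differential_comp (hA ha) (z := γ r)
      (g.contMDiff.contMDiffAt.mdifferentiableAt (by simp))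
    refine (DFunLike.congr_fun h5 (X.vec (γ r))).symm.trans ?_
    refine (hXf _ h1 _ hF' (g.comp ⟨a, P.contMDiff_of_mem_automorphismGroup (hA ha)⟩)).trans ?_
    rw [P.bracket_comp (hA ha)]
    exact (hXf _ haz _ hF g).symm
  refine (h3.comp r h2).congr_mfderiv (ContinuousLinearMap.ext fun c => ?_)
  refine ((mfderiv (𝓡 n) (𝓡 n) a (γ r)).map_smul (c : ℝ) (X.vec (γ r))).trans ?_
  exact congrArg (fun v : EuclideanSpace ℝ (Fin n) => (show ℝ from c) • v) h4

/-- The flows of the polar family commute with `A`; both rank comparisons below rest on this. -/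
theorem flowsTo_group_comp (hA : A ≤ P.automorphismGroup) {X : LocalVectorField n M}
    (hX : X ∈ P.polarFamily (groupTransformations A)) {a : Equiv.Perm M} (ha : a ∈ A) {t : ℝ}
    {m m' : M} (h : X.FlowsTo t m m') : X.FlowsTo t (a m) (a m') := by
  obtain ⟨γ, s, b, h0, ht, hγ, rfl, rfl⟩ := (X.flowsTo_iff _ _ _).1 h
  exact (X.flowsTo_iff _ _ _).2 ⟨_, s, b, h0, ht, P.isCurveOn_group_comp hA hX ha hγ, rfl, rfl⟩

/-- An invariant function near `γ t` is pulled back by the time `t - t₀` flow to one near `γ t₀`.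
The flow commutes with `A`, so the pull-back extends to an `A`-invariant neighbourhood; its
derivative is surjective, so ranks compare. -/
theorem eventually_finrank_invariantCovectors_group (hA : A ≤ P.automorphismGroup) {X : LocalVectorField n M}
    (hX : X ∈ P.polarFamily (groupTransformations A)) {γ : ℝ → M} {α β : ℝ}
    (hγ : X.IsCurveOn γ α β) {t₀ : ℝ} (ht₀ : t₀ ∈ Ioo α β) :
    ∀ᶠ t in nhds t₀, Module.finrank ℝ (invariantCovectors n (groupTransformations A) (γ t)) ≤
      Module.finrank ℝ (invariantCovectors n (groupTransformations A) (γ t₀)) := by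
  obtain ⟨ε, hε, V, hV, hpV, Ψ, hΨ, hΨs⟩ := X.exists_localFlow (hγ t₀ ht₀).1
  have h2 := (hΨ _ hpV).2.comp_add (-t₀)
  have hmem : t₀ ∈ Ioo (max α (-ε - -t₀)) (min β (ε - -t₀)) :=
    ⟨max_lt ht₀.1 (by linarith), lt_min ht₀.2 (by linarith)⟩
  have h3 := (hγ.mono (le_max_left α (-ε - -t₀)) (min_le_left β (ε - -t₀))).eqOn
    (h2.mono (le_max_right _ _) (min_le_right _ _)) hmem
    (by rw [add_neg_cancel, (hΨ _ hpV).1])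
  filter_upwards [isOpen_Ioo.mem_nhds hmem] with t ht
  have hs : t + -t₀ ∈ Ioo (-ε) ε :=
    ⟨by linarith [(le_max_right α (-ε - -t₀)).trans_lt ht.1],
      by linarith [ht.2.trans_le (min_le_right β (ε - -t₀))]⟩
  have h0 : (0 : ℝ) ∈ Ioo (-ε) ε := ⟨by linarith, hε⟩
  set s := t + -t₀ with hs_def
  obtain ⟨hsm, hsurj⟩ := hΨs s hs
  refine finrank_invariantCovectors_le (B := mfderiv (𝓡 n) (𝓡 n) (Ψ s) (γ t₀)) hsurj ?_
  rw [h3 ht]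
  intro U f hU hUA hf hz
  classical
  let V' : Set M := V ∩ Ψ s ⁻¹' U
  have hV' : IsOpen V' := hsm.continuousOn.isOpen_inter_preimage hV hU
  -- The `A`-saturation of the neighbourhood where the local flow lands in `U`.
  let W : Set M := ⋃ a ∈ A, (a : M → M) ⁻¹' V'
  have hW : IsOpen W := isOpen_biUnion fun a ha =>
    hV'.preimage (P.contMDiff_of_mem_automorphismGroup (hA ha)).continuous
  -- `G` is defined through `FlowsTo` rather than `Ψ s`, which makes sense on all of `W`; the value
  -- `0` elsewhere is a default.
  let G : M → ℝ := fun x => if h : ∃ x' ∈ U, X.FlowsTo s x x' then f h.choose else 0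
  have hG : ∀ {x x'}, x' ∈ U → X.FlowsTo s x x' → G x = f x' := by
    intro x x' hx' hflow
    have h : ∃ x' ∈ U, X.FlowsTo s x x' := ⟨x', hx', hflow⟩
    have h1 : G x = f h.choose := dif_pos h
    rw [h1, h.choose_spec.2.unique hflow]
  have hUA' := forall_groupTransformations.1 hUA
  have hfA := (forall_groupTransformations (Q := fun z z' => f z' = f z)).1 hf.2
  have hGa : ∀ {a : Equiv.Perm M}, a ∈ A → ∀ {x}, a x ∈ V' → G x = f (Ψ s (a x)) := by
    intro a ha x hx
    have h1 := (hΨ _ hx.1).2.flowsTo h0 hs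
    rw [(hΨ _ hx.1).1, sub_zero] at h1
    have h2 := P.flowsTo_group_comp hA hX (A.inv_mem ha) h1
    rw [perm_inv_apply_self] at h2
    rw [hG (hUA' _ (A.inv_mem ha) _ hx.2) h2]
    exact hfA _ (A.inv_mem ha) _ hx.2
  have hcomp : ∀ y ∈ V', ContMDiffAt (𝓡 n) 𝓘(ℝ, ℝ) ∞ (fun y => f (Ψ s y)) y := fun y hy =>
    ContMDiffAt.comp (f := Ψ s) y (hf.1.contMDiffAt (hU.mem_nhds hy.2))
      (hsm.contMDiffAt (hV.mem_nhds hy.1))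
  refine ⟨W, G, hW, ?_, ⟨?_, ?_⟩, ?_, ?_⟩
  · refine forall_groupTransformations.2 fun b hb z hz => ?_
    obtain ⟨a, ha, hz⟩ := mem_iUnion₂.1 hz
    refine mem_iUnion₂.2 ⟨a * b⁻¹, A.mul_mem ha (A.inv_mem hb), ?_⟩
    change a (b⁻¹ (b z)) ∈ V'
    rwa [perm_inv_apply_self]
  · intro x hx
    obtain ⟨a, ha, hx⟩ := mem_iUnion₂.1 hx
    have hac := P.contMDiff_of_mem_automorphismGroup (hA ha)
    have h1 : ContMDiffAt (𝓡 n) 𝓘(ℝ, ℝ) ∞ (fun x => f (Ψ s (a x))) x :=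
      ContMDiffAt.comp (f := a) x (hcomp (a x) hx) hac.contMDiffAt
    refine (h1.congr_of_eventuallyEq ?_).contMDiffWithinAt
    filter_upwards [(hV'.preimage hac.continuous).mem_nhds hx] with y hy using hGa ha hy
  · refine (forall_groupTransformations (Q := fun z z' => G z' = G z)).2 fun b hb z hz => ?_
    obtain ⟨a, ha, hz⟩ := mem_iUnion₂.1 hz
    have h1 : (a * b⁻¹) (b z) = a z := congrArg a (perm_inv_apply_self b z)
    rw [hGa ha hz, hGa (A.mul_mem ha (A.inv_mem hb)) (x := b z) (by rw [h1]; exact hz), h1]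
  · exact mem_iUnion₂.2 ⟨1, A.one_mem, hpV, hz⟩
  · have h1 : G =ᶠ[nhds (γ t₀)] fun y => f (Ψ s y) := by
      filter_upwards [hV'.mem_nhds ⟨hpV, hz⟩] with y hy
      exact hGa A.one_mem (x := y) hy
    rw [differential_congr h1]
    exact mfderiv_comp (γ t₀)
      ((hf.1.contMDiffAt (hU.mem_nhds hz)).mdifferentiableAt (by simp))
      ((hsm.contMDiffAt (hV.mem_nhds hpV)).mdifferentiableAt (by simp))

/-- Since `a` commutes with the flows generating `G_{A'}`, composition with `a` carries local
`G_{A'}`-invariants near `a z` to such invariants near `z`. -/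
theorem finrank_invariantCovectors_polar_le (hA : A ≤ P.automorphismGroup) {a : Equiv.Perm M} (ha : a ∈ A) (z : M) :
    Module.finrank ℝ
        (invariantCovectors n (P.polarPseudogroup (groupTransformations A)) (a z)) ≤
      Module.finrank ℝ
        (invariantCovectors n (P.polarPseudogroup (groupTransformations A)) z) := by
  refine finrank_invariantCovectors_le (P.mfderiv_surjective (hA ha) z) ?_
  intro U f hU hUT hf hz
  have hac := P.contMDiff_of_mem_automorphismGroup (hA ha)
  have key : ∀ F ∈ P.polarPseudogroup (groupTransformations A), ∀ x, ∀ x' ∈ F x,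
      a x ∈ U → a x' ∈ U ∧ f (a x') = f (a x) := by
    intro F hF
    refine generatedPseudogroup_induction (r := fun x x' => a x ∈ U → a x' ∈ U ∧ f (a x') = f (a x))
      (fun X hX t m m' h hm => ?_) (fun p q r hpq hqr hp => ?_) hF
    · obtain ⟨F', hF', h'⟩ := (P.flowsTo_group_comp hA hX ha h).mem_orbitOf hX
      exact ⟨hUT F' hF' _ hm _ h', hf.2 F' hF' _ hm _ h'⟩
    · obtain ⟨hq, h1⟩ := hpq hp
      obtain ⟨hr, h2⟩ := hqr hq
      exact ⟨hr, h2.trans h1⟩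
  refine ⟨a ⁻¹' U, fun x => f (a x), hU.preimage hac.continuous,
    fun F hF x hx x' hx' => (key F hF x x' hx' hx).1,
    ⟨fun x hx => ?_, fun F hF x hx x' hx' => (key F hF x x' hx' hx).2⟩, hz, ?_⟩
  · exact (ContMDiffAt.comp (f := a) x (hf.1.contMDiffAt (hU.mem_nhds hx))
      hac.contMDiffAt).contMDiffWithinAt
  · exact P.differential_comp (hA ha)
      ((hf.1.contMDiffAt (hU.mem_nhds hz)).mdifferentiableAt (by simp))

end PoissonStructure

/-! ### Orbit inclusions, integrability and the Howe property. -/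

namespace PoissonStructure

variable {n : ℕ} {M : Type*} [TopologicalSpace M] [ChartedSpace (EuclideanSpace ℝ (Fin n)) M]
  (P : PoissonStructure n M) [IsManifold (𝓡 n) ∞ M] {A : Subgroup (Equiv.Perm M)}

theorem IsStronglyHamiltonian.isWeaklyHamiltonian (h : P.IsStronglyHamiltonian A) :
    P.IsWeaklyHamiltonian A := fun a ha m => ⟨_, h a ha, Part.mem_some (a m)⟩

variable [T2Space M]

theorem orbitOf_bipolar_subset_group (hsep : SeparatesOrbits n (groupTransformations A)) (m : M) :
    orbitOf (P.polarPseudogroup (P.polarPseudogroup (groupTransformations A))) m ⊆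
      orbitOf (groupTransformations A) m :=
  P.orbitOf_bipolar_subset hsep mem_orbitOf_groupTransformations_self m

theorem IsStronglyHamiltonian.subset_bipolar (h : P.IsStronglyHamiltonian A)
    (hext : HasExtensionProperty n (groupTransformations A)) :
    groupTransformations A ⊆
      P.polarPseudogroup (P.polarPseudogroup (groupTransformations A)) := by
  rintro _ ⟨a, ha, rfl⟩
  exact generatedPseudogroup_mono (P.globalHamiltonianFields_subset hext) (h a ha)

theorem IsWeaklyHamiltonian.orbitOf_subset (h : P.IsWeaklyHamiltonian A)
    (hext : HasExtensionProperty n (groupTransformations A)) (m : M) :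
    orbitOf (groupTransformations A) m ⊆
      orbitOf (P.polarPseudogroup (P.polarPseudogroup (groupTransformations A))) m := by
  intro m' hm'
  obtain ⟨a, ha, rfl⟩ := mem_orbitOf_groupTransformations.1 hm'
  obtain ⟨F, hF, h⟩ := h a ha m
  exact ⟨F, generatedPseudogroup_mono (P.globalHamiltonianFields_subset hext) hF, h⟩

theorem isIntegrable_polarDistribution_group (hA : A ≤ P.automorphismGroup) :
    IsIntegrable (P.polarDistribution (groupTransformations A)) ∧
      leafPartition (P.polarDistribution (groupTransformations A)) =
        orbitPartition (P.polarPseudogroup (groupTransformations A)) :=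
  isIntegrable_of_isFlowInvariant P.polarFamily_covers fun _ hX z₀ =>
    P.isFlowInvariant_polarDistribution
      (fun _ _ _ hU hUA hf hg => P.localBracket_invariant_group hA hU hUA hf hg)
      (fun _ hX _ _ _ hγ _ ht₀ => P.eventually_finrank_invariantCovectors_group hA hX hγ ht₀) hX z₀

/-- Separation confines a flow line of the bipolar family to one `A`-orbit, so its points are
related by elements of `A`, which control the rank of the invariant covectors. -/
theorem isIntegrable_polarDistribution_bipolar (hA : A ≤ P.automorphismGroup)
    (hsep : SeparatesOrbits n (groupTransformations A)) :
    IsIntegrable (P.polarDistribution (P.polarPseudogroup (groupTransformations A))) ∧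
      leafPartition (P.polarDistribution (P.polarPseudogroup (groupTransformations A))) =
        orbitPartition (P.polarPseudogroup (P.polarPseudogroup (groupTransformations A))) := by
  refine isIntegrable_of_isFlowInvariant P.polarFamily_covers fun X hX z₀ =>
    P.isFlowInvariant_polarDistribution
      (fun _ _ _ hU hUA hf hg => P.localBracket_invariant_polarPseudogroup hU hUA hf hg)
      (fun X hX γ a b hγ t₀ ht₀ => ?_) hX z₀
  filter_upwards [isOpen_Ioo.mem_nhds ht₀] with t ht
  obtain ⟨g, hg, h⟩ := mem_orbitOf_groupTransformations.1
    (P.orbitOf_bipolar_subset_group hsep (γ t₀) ((hγ.flowsTo ht₀ ht).mem_orbitOf hX))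
  rw [h]
  exact P.finrank_invariantCovectors_polar_le hA hg (γ t₀)

/-- Commutation gives one inclusion on each side, the extension properties the other. The
centralizer of the `G_{A'}`-invariants first lands among the `G_{A''}`-invariants, and the orbit
inclusion makes these `A`-invariant. -/
theorem isHowePair_of_orbitOf_subset (hext : HasExtensionProperty n (groupTransformations A))
    (hext' : HasExtensionProperty n (P.polarPseudogroup (groupTransformations A)))
    (h : ∀ m, orbitOf (groupTransformations A) m ⊆
      orbitOf (P.polarPseudogroup (P.polarPseudogroup (groupTransformations A))) m) :
    P.IsHowePair (groupTransformations A) (P.polarPseudogroup (groupTransformations A)) := by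
  rw [IsHowePair, pullbackFunctions_eq, pullbackFunctions_eq]
  refine ⟨Subset.antisymm (P.centralizer_subset hext) fun k hk f hf => P.bracket_eq_zero hf hk,
    Subset.antisymm (fun k hk F hF z z' hz' => ?_) fun f hf k hk => ?_⟩
  · obtain ⟨G, hG, hz'⟩ := h z ⟨F, hF, hz'⟩
    exact P.centralizer_subset hext' hk G hG z z' hz'
  · rw [P.skew, P.bracket_eq_zero hf hk, neg_zero]

end PoissonStructure

theorem proposition6p2 {n : ℕ} {M : Type*} [TopologicalSpace M]
    [ChartedSpace (EuclideanSpace ℝ (Fin n)) M] [IsManifold (𝓡 n) ∞ M]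
    [T2Space M] [SecondCountableTopology M]
    (P : PoissonStructure n M) (A : Subgroup (Equiv.Perm M)) (hA : A ≤ P.automorphismGroup) :
    -- strongly Hamiltonian case: `A ⊂ G_{A''}`
    (P.IsStronglyHamiltonian A → HasExtensionProperty n (groupTransformations A) →
      groupTransformations A ⊆
        P.polarPseudogroup (P.polarPseudogroup (groupTransformations A))) ∧
    -- weakly Hamiltonian case: `A · m ⊂ G_{A''} · m`
    (P.IsWeaklyHamiltonian A → HasExtensionProperty n (groupTransformations A) →
      ∀ m : M, orbitOf (groupTransformations A) m ⊆
        orbitOf (P.polarPseudogroup (P.polarPseudogroup (groupTransformations A))) m) ∧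
    -- separation: `G_{A''} · m ⊂ A · m`
    (SeparatesOrbits n (groupTransformations A) →
      ∀ m : M, orbitOf (P.polarPseudogroup (P.polarPseudogroup (groupTransformations A))) m ⊆
        orbitOf (groupTransformations A) m) ∧
    -- both: `A` is von Neumann, the diagram is a dual pair, and possibly a Howe pair
    (P.IsStronglyHamiltonian A ∨ P.IsWeaklyHamiltonian A →
      HasExtensionProperty n (groupTransformations A) →
      SeparatesOrbits n (groupTransformations A) →
      P.IsVonNeumann (groupTransformations A) ∧
      P.IsDualPair (groupTransformations A) (P.polarPseudogroup (groupTransformations A)) ∧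
      (HasExtensionProperty n (P.polarPseudogroup (groupTransformations A)) →
        P.IsHowePair (groupTransformations A)
          (P.polarPseudogroup (groupTransformations A)))) := by
  refine ⟨fun h hext => h.subset_bipolar P hext, fun h hext => h.orbitOf_subset P hext,
    P.orbitOf_bipolar_subset_group, fun hham hext hsep => ?_⟩
  have hweak : P.IsWeaklyHamiltonian A := hham.elim (fun h => h.isWeaklyHamiltonian P) id
  -- The orbits of `A` and `G_{A''}` coincide; the orbit theorem converts this equality into one of
  -- leaves and orbits.
  have horb : orbitPartition (P.polarPseudogroup (P.polarPseudogroup (groupTransformations A))) =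
      orbitPartition (groupTransformations A) :=
    congrArg Set.range (funext fun m => Subset.antisymm (P.orbitOf_bipolar_subset_group hsep m)
      (hweak.orbitOf_subset P hext m))
  obtain ⟨h1, h2⟩ := P.isIntegrable_polarDistribution_group hA
  obtain ⟨h3, h4⟩ := P.isIntegrable_polarDistribution_bipolar hA hsep
  exact ⟨⟨h1, h3, h4.trans horb⟩, ⟨h1, h3, h2, h4.trans horb⟩,
    fun hext' => P.isHowePair_of_orbitOf_subset hext hext' (hweak.orbitOf_subset P hext)⟩
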